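/- **Setting.** Let $d,r\ge 1$ be integers, $1<p,q<\infty$ with conjugate exponents $p'=\frac p{p-1}$, $q'=\frac q{q-1}$, and $K_1,K_2>0$, $C_K=[-K_1,K_1]\times[-K_2,K_2]^d\subset\mathbb R\times\mathbb R^d$. For complex-valued functions and sequences put $$\|f\|_{L^{p,q}}=\Big(\int_{\mathbb R}\Big(\int_{\mathbb R^d}|f(x,y)|^q\,dy\Big)^{p/q}dx\Big)^{1/p},\qquad \|c\|_{l^{p,q}}=\Big(\sum_j\Big(\sum_k|c(j,k)|^q\Big)^{p/q}\Big)^{1/p},$$ with $\|f\|_{L^{p,q}(C_K)}=\|f\mathbf 1_{C_K}\|_{L^{p,q}}$, and $\|\mathbf c\|_{l^{p,q}}=\sum_{i=1}^r\|c_i\|_{l^{p,q}}$ for $\mathbf c=(c_1,\dots,c_r)$. For a function $f$ without further indication, $\|f\|$ means $\|f\|_{L^{p,q}(\mathbb R\times\mathbb R^d)}$. For $k\in\mathbb Z^d$, $|k|$ is the maximum norm; for $y\in\mathbb R^d$, $|y|$ is the Euclidean norm. *(A1)* $\Phi=(\phi_1,\dots,\phi_r)^T$ with $\phi_i\in L^{p,q}(\mathbb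 R\times\mathbb R^d)$ continuous, and there are constants $\alpha_1,\alpha_2,\tilde c>0$ and $s_1,s_2>d+1-\frac1p-\frac dq$ with $|\phi_i(x,y)|\le \tilde c\,(1+|x|)^{-s_1}(1+|y|)^{-s_2}$ for all $(x,y)$ and $$\alpha_1\|\mathbf c\|_{l^{p,q}}\le\Big\|\sum_{k_1\in\mathbb Z}\sum_{k_2\in\mathbb Z^d}\mathbf c^T(k_1,k_2)\Phi(\cdot-k_1,\cdot-k_2)\Big\|\le\alpha_2\|\mathbf c\|_{l^{p,q}}\qquad(\mathbf c\in (l^{p,q}(\mathbb Z\times\mathbb Z^d))^r).$$ *(A2)* $\psi\in L^1(\mathbb R^{d+1})$, $\operatorname{supp}\psi\subseteq C_K$, and $\psi\neq0$. Put $L=\|\psi\|_{L^{1,1}(C_K)}>0$. *(A3)* $\rho$ is a probability density on $C_K$ with $0<\mathcal C_{\rho,1}\le\rho\le\mathcal C_{\rho,2}$ on $C_K$. Let $V^{p,q}(\Phi)$ be the set of all $\sum_{k_1,k_2}\mathbf c^T(k_1,k_2)\Phi(\cdot-k_1,\cdot-k_2)$ with $\mathbf c\in(l^{p,q}(\mathbb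 Z\times\mathbb Z^d))^r$ and, for $0<\delta<1$, $$V^{p,q}_\psi(\Phi,\delta,C_K)=\big\{f\in V^{p,q}(\Phi):\ \|f\|_{L^{p,q}(C_K)}\ge(1-\delta)\|f\|,\ \ \|f*\psi\|_{L^{p,q}(C_K)}\ge(1-\delta)L\|f\|\big\}.$$ Let $z_{j,k}=(x_j,y_k)$, $j,k\in\mathbb N$, denote a doubly indexed family of independent, identically distributed random vectors in $C_K$ with density $\rho$ (the whole family $(z_{j,k})_{j,k}$ is independent). **Constants.** Let $0<\delta<1$, $0<\epsilon<1-\delta$, $0<\gamma<1-\dfrac{\epsilon}{(1-\delta-\epsilon)^{1+pq}}$, $\omega=(1-\delta-\epsilon)L$, $P=(2K_1)^{q-1}(2K_2)^{d(p-1)}$, $$c^*=\frac{4\tilde c}{2^{\frac{p+q}{pq}}\alpha_1}\Big(\sum_{k_1\in\mathbb Z}(1+|k_1|)^{-s_1p'}\Big)^{1/p'}\Big(\sum_{k_2\in\mathbb Z^d}(1+|k_2|)^{-s_2q'}\Big)^{1/q'},\qquad s=\min\{s_1,s_2\}+\tfrac1p+\tfrac dq-(d+1).$$ For $\kappa_1,\kappa_2,\epsilon_1,\epsilon_2>0$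 set $$N_1(\kappa_1,\kappa_2,\epsilon_1)=\max\{\kappa_1,\kappa_2\}+\Big(\tfrac{2^{d+1}\tilde c\,\kappa_1^{1/p}\kappa_2^{d/q}}{\alpha_1\epsilon_1}\Big[\tfrac{d^{1/q'}(1+\kappa_2)^{\frac{d-1}{q'}+\frac1{p'}}}{(s_2q'-d)^{1/q'}}+\tfrac{(1+\kappa_1)^{d/q'}}{(s_1p'-1)^{1/p'}}+\tfrac{d^{1/q'}(1+\kappa_2)^{\frac{d-1}{q'}}}{(s_1p'-1)^{1/p'}(s_2q'-d)^{1/q'}}\Big]\Big)^{1/s},$$ $$N_2(\kappa_1,\kappa_2,\epsilon_2)=\max\{\kappa_1,\kappa_2\}+\Big(\tfrac{2^{\frac1{p'}+\frac d{q'}}\tilde c}{\alpha_1\epsilon_2}\Big[\tfrac{d^{1/q'}(1+\kappa_2)^{\frac{d-1}{q'}+\frac1{p'}}}{(s_2q'-d)^{1/q'}}+\tfrac{(1+\kappa_1)^{d/q'}}{(s_1p'-1)^{1/p'}}+\tfrac{d^{1/q'}(1+\kappa_2)^{\frac{d-1}{q'}}}{(s_1p'-1)^{1/p'}(s_2q'-d)^{1/q'}}\Big]\Big)^{1/s}.$$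 Let $N$ be any positive integer with $$N\ge\max\Big\{N_1(2K_1,2K_2,\epsilon),\ N_2\Big(2K_1,2K_2,\frac{\epsilon\,\mathcal C_{\rho,1}(c^*)^{1-pq}}{P}\Big)\Big\}$$ (for instance the least one). Put $\Lambda=\dfrac{\gamma\,\mathcal C_{\rho,1}(c^*L)^{1-pq}\omega^{pq}}{P}$, $G=\gamma\,\mathcal C_{\rho,1}\Big(\dfrac{\omega}{c^*L}\Big)^{pq}$ and $$\mathcal A_1=2\exp\!\big(r(2N+1)^{d+1}\ln(4c^*+1)\big),\qquad \mathcal A_2=\frac{4\big((2c^*+\frac14)(c^*+\frac14)\big)^{r(2N+1)^{d+1}}}{3r(\ln2)^2(2N+1)^{d+1}},$$ $$\beta_1=\frac{(2K_1)^{1-q}(2K_2)^{d(1-p)}\big(\frac{\sqrt3}2G\big)^2}{6P+G},\qquad \beta_2=\frac{(2K_1)^{1-q}(2K_2)^{d(1-p)}(Gc^*)^2}{18\sqrt2\,(81P+2Gc^*)}.$$ **Theorem.** Let $n,m$ be positive integers with $$nm>\frac{54\,r\sqrt2\,(\ln2)(2N+1)^{d+1}L}{\Lambda^2}\,\big(2\Lambda+81L\big).$$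 Then with probability at least $1-\mathcal A_1e^{-nm\beta_1}-\mathcal A_2e^{-nm\beta_2}$ the inequality $$A\|f\|\le\Big\|\{(f*\psi)(z_{j,k})\}_{1\le j\le n,\,1\le k\le m}\Big\|_{l^{p,q}}\le B\|f\|$$ holds simultaneously for all $f\in V^{p,q}_\psi(\Phi,\delta,C_K)$, where $$A=\frac{\mathcal C_{\rho,1}(c^*)^{1-pq}L\big((1-\gamma)(1-\delta-\epsilon)^{1+pq}-\epsilon\big)}{P}\,n^{1/p}m^{1/q},$$ $$B=\frac{\alpha_2L}{\alpha_1}\Big(\frac{\mathcal C_{\rho,2}}{(2K_1)^{\frac{1-p}p}(2K_2)^{\frac{d(1-q)}q}}+\frac{\gamma\,\mathcal C_{\rho,1}(c^*)^{1-pq}(1-\delta-\epsilon)^{pq}}{P}\Big)nm+\frac{\epsilon\,\mathcal C_{\rho,1}(c^*)^{1-pq}L}{P}\,n^{1/p}m^{1/q}.$$ -/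

import Mathlib

open MeasureTheory ProbabilityTheory
open scoped ENNReal Convolution

noncomputable section

namespace RandomAverageSampling

/-- The domain `ℝ × ℝ^d`; the second factor carries the Euclidean norm, and the product carries
Lebesgue measure. -/
abbrev Domain (d : ℕ) : Type := ℝ × EuclideanSpace ℝ (Fin d)

/-! ### Mixed norms -/

/-- `‖f‖_{L^{p,q}(ℝ × ℝ^d)} = (∫ (∫ |f(x,y)|^q dy)^{p/q} dx)^{1/p}`, with values in `[0,∞]`. -/
def mixedNorm {d : ℕ} (p q : ℝ) (f : Domain d → ℂ) : ℝ≥0∞ :=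
  (∫⁻ x : ℝ, (∫⁻ y : EuclideanSpace ℝ (Fin d), ‖f (x, y)‖ₑ ^ q) ^ (p / q)) ^ (1 / p)

/-- `‖f‖_{L^{p,q}(C)}` for a subset `C` of `ℝ × ℝ^d`. -/
def mixedNormOn {d : ℕ} (p q : ℝ) (C : Set (Domain d)) (f : Domain d → ℂ) : ℝ≥0∞ :=
  mixedNorm p q (C.indicator f)

/-- `‖c‖_{l^{p,q}} = (∑_i (∑_k |c(i,k)|^q)^{p/q})^{1/p}`, with values in `[0,∞]`, for a complex
array over arbitrary (finite or infinite) index types. -/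
def seqMixedNorm {ι κ : Type*} (p q : ℝ) (c : ι → κ → ℂ) : ℝ≥0∞ :=
  (∑' i, (∑' k, ‖c i k‖ₑ ^ q) ^ (p / q)) ^ (1 / p)

/-- `‖c‖_{l^{p,q}} = ∑_i ‖c_i‖_{l^{p,q}}` for an `r`-tuple of arrays indexed by `ℤ × ℤ^d`. -/
def vecSeqMixedNorm {d r : ℕ} (p q : ℝ) (c : Fin r → ℤ → (Fin d → ℤ) → ℂ) : ℝ≥0∞ :=
  ∑ i, seqMixedNorm p q (c i)

/-! ### Shift-invariant spaces -/

/-- The integer point `(k₁, k₂)` of `ℝ × ℝ^d`. -/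
def latticePoint {d : ℕ} (k : ℤ × (Fin d → ℤ)) : Domain d :=
  ((k.1 : ℝ), WithLp.toLp 2 (fun i => (k.2 i : ℝ)))

/-- The function `∑_{k₁,k₂} c^T(k₁,k₂) Φ(· - k₁, · - k₂)`. Whenever `c ∈ (l^{p,q})^r` and the
generators decay as in `GeneratorAssumption`, the series converges absolutely at every point. -/
def shiftSeries {d r : ℕ} (φ : Fin r → Domain d → ℂ) (c : Fin r → ℤ → (Fin d → ℤ) → ℂ) :
    Domain d → ℂ :=
  fun z => ∑' k : ℤ × (Fin d → ℤ), ∑ i, c i k.1 k.2 * φ i (z - latticePoint k)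

/-- `V^{p,q}(Φ)`. As for all elements of Lebesgue spaces, functions are identified almost
everywhere. -/
def shiftInvariantSpace {d r : ℕ} (p q : ℝ) (φ : Fin r → Domain d → ℂ) : Set (Domain d → ℂ) :=
  {f | ∃ c : Fin r → ℤ → (Fin d → ℤ) → ℂ,
    vecSeqMixedNorm p q c < ∞ ∧ f =ᵐ[volume] shiftSeries φ c}

/-- The cuboid `C_K = [-K₁, K₁] × [-K₂, K₂]^d`. -/
def cuboid (d : ℕ) (K₁ K₂ : ℝ) : Set (Domain d) :=
  {z | |z.1| ≤ K₁ ∧ ∀ i, |z.2 i| ≤ K₂}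

/-- `V^{p,q}(Φ, δ, C)`: the signals concentrated on `C`. -/
def concentrated {d r : ℕ} (p q : ℝ) (φ : Fin r → Domain d → ℂ) (δ : ℝ) (C : Set (Domain d)) :
    Set (Domain d → ℂ) :=
  {f | f ∈ shiftInvariantSpace p q φ ∧
    ENNReal.ofReal (1 - δ) * mixedNorm p q f ≤ mixedNormOn p q C f}

/-- The average `(f * ψ)(z) = ∫ f(t) ψ(z - t) dt`. -/
def average {d : ℕ} (f ψ : Domain d → ℂ) : Domain d → ℂ :=
  f ⋆[ContinuousLinearMap.mul ℂ ℂ, volume] ψ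

/-- `V_ψ^{p,q}(Φ, δ, C)`. -/
def averageConcentrated {d r : ℕ} (p q : ℝ) (φ : Fin r → Domain d → ℂ) (ψ : Domain d → ℂ)
    (δ : ℝ) (C : Set (Domain d)) : Set (Domain d → ℂ) :=
  {f | f ∈ concentrated p q φ δ C ∧
    ENNReal.ofReal (1 - δ) * mixedNormOn 1 1 C ψ * mixedNorm p q f ≤
      mixedNormOn p q C (average f ψ)}

/-! ### Standing assumptions -/

/-- Generators in `L^{p,q}` with stable shifts that are continuous with polynomial decay. -/
structure GeneratorAssumption {d r : ℕ} (p q : ℝ) (φ : Fin r → Domain d → ℂ)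
    (α₁ α₂ ctilde s₁ s₂ : ℝ) : Prop where
  continuous : ∀ i, Continuous (φ i)
  memLpq : ∀ i, mixedNorm p q (φ i) < ∞
  α₁_pos : 0 < α₁
  α₂_pos : 0 < α₂
  lower : ∀ c : Fin r → ℤ → (Fin d → ℤ) → ℂ, vecSeqMixedNorm p q c < ∞ →
    ENNReal.ofReal α₁ * vecSeqMixedNorm p q c ≤ mixedNorm p q (shiftSeries φ c)
  upper : ∀ c : Fin r → ℤ → (Fin d → ℤ) → ℂ, vecSeqMixedNorm p q c < ∞ →
    mixedNorm p q (shiftSeries φ c) ≤ ENNReal.ofReal α₂ * vecSeqMixedNorm p q c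
  ctilde_pos : 0 < ctilde
  s₁_gt : (d : ℝ) + 1 - 1 / p - d / q < s₁
  s₂_gt : (d : ℝ) + 1 - 1 / p - d / q < s₂
  decay : ∀ i z, ‖φ i z‖ ≤ ctilde / ((1 + |z.1|) ^ s₁ * (1 + ‖z.2‖) ^ s₂)

/-- The averaging function is integrable and supported in `C`. -/
structure AveragingAssumption {d : ℕ} (C : Set (Domain d)) (ψ : Domain d → ℂ) : Prop where
  integrable : Integrable ψ volume
  support : ∀ᵐ z : Domain d, z ∉ C → ψ z = 0

/-- `ρ` is a probability density on `C` with `0 < C₁ ≤ ρ ≤ C₂` there. -/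
structure DensityAssumption {d : ℕ} (C : Set (Domain d)) (ρ : Domain d → ℝ) (C₁ C₂ : ℝ) :
    Prop where
  aemeasurable : AEMeasurable ρ (volume.restrict C)
  total : ∫⁻ z in C, ENNReal.ofReal (ρ z) = 1
  lower_pos : 0 < C₁
  upper_pos : 0 < C₂
  lower : ∀ z ∈ C, C₁ ≤ ρ z
  upper : ∀ z ∈ C, ρ z ≤ C₂

/-- The probability distribution on `C` with density `ρ`. -/
def densityLaw {d : ℕ} (C : Set (Domain d)) (ρ : Domain d → ℝ) : Measure (Domain d) :=
  (volume.restrict C).withDensity (fun z => ENNReal.ofReal (ρ z))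

/-! ### Constants -/

/-- The constant `c^*`. The norm of `k : Fin d → ℤ` is the maximum norm. -/
def cStar (d : ℕ) (p q α₁ ctilde s₁ s₂ : ℝ) : ℝ :=
  4 * ctilde / ((2 : ℝ) ^ ((p + q) / (p * q)) * α₁)
    * (∑' k : ℤ, 1 / (1 + |(k : ℝ)|) ^ (s₁ * p / (p - 1))) ^ ((p - 1) / p)
    * (∑' k : Fin d → ℤ, 1 / (1 + ‖k‖) ^ (s₂ * q / (q - 1))) ^ ((q - 1) / q)

/-- `(2K₁)^{q-1} (2K₂)^{d(p-1)}`. -/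
def volFactor (d : ℕ) (p q K₁ K₂ : ℝ) : ℝ :=
  (2 * K₁) ^ (q - 1) * (2 * K₂) ^ ((d : ℝ) * (p - 1))

/-- `γ C_{ρ,1} (c^* ‖ψ‖)^{1-pq} ω^{pq} / ((2K₁)^{q-1} (2K₂)^{d(p-1)})`; here and below `c` stands
for `c^*` and `L` for `‖ψ‖_{L^{1,1}(C_K)}`. -/
def deviation (d : ℕ) (p q K₁ K₂ γ C₁ c L ω : ℝ) : ℝ :=
  γ * C₁ * (c * L) ^ (1 - p * q) * ω ^ (p * q) / volFactor d p q K₁ K₂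

/-- The lower threshold for the number `nm` of samples. -/
def sampleThreshold (d r N : ℕ) (p q K₁ K₂ γ C₁ c L ω : ℝ) : ℝ :=
  54 * r * √2 * Real.log 2 * (2 * (N : ℝ) + 1) ^ (d + 1) * L
      / deviation d p q K₁ K₂ γ C₁ c L ω ^ 2
    * (2 * deviation d p q K₁ K₂ γ C₁ c L ω + 81 * L)

/-- The constant `𝒜₁`. -/
def constA₁ (d r N : ℕ) (c : ℝ) : ℝ :=
  2 * Real.exp (r * (2 * (N : ℝ) + 1) ^ (d + 1) * Real.log (4 * c + 1))

/-- The constant `𝒜₂`. -/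
def constA₂ (d r N : ℕ) (c : ℝ) : ℝ :=
  4 * ((2 * c + 1 / 4) * (c + 1 / 4)) ^ (r * (2 * N + 1) ^ (d + 1))
    / (3 * r * Real.log 2 ^ 2 * (2 * (N : ℝ) + 1) ^ (d + 1))

/-- The rate `β₁`. -/
def rateβ₁ (d : ℕ) (p q K₁ K₂ γ C₁ c L ω : ℝ) : ℝ :=
  (2 * K₁) ^ (1 - q) * (2 * K₂) ^ ((d : ℝ) * (1 - p))
      * (√3 / 2 * γ * C₁ * (ω / (c * L)) ^ (p * q)) ^ 2
    / (6 * volFactor d p q K₁ K₂ + γ * C₁ * (ω / (c * L)) ^ (p * q))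

/-- The rate `β₂`. -/
def rateβ₂ (d : ℕ) (p q K₁ K₂ γ C₁ c L ω : ℝ) : ℝ :=
  (2 * K₁) ^ (1 - q) * (2 * K₂) ^ ((d : ℝ) * (1 - p))
      * (γ * C₁ * (ω / (c * L)) ^ (p * q) * c) ^ 2
    / (18 * √2 * (81 * volFactor d p q K₁ K₂ + 2 * γ * C₁ * (ω / (c * L)) ^ (p * q) * c))

/-- The decay surplus `s = min{s₁, s₂} + 1/p + d/q - (d+1)`. -/
def surplus (d : ℕ) (p q s₁ s₂ : ℝ) : ℝ :=
  min s₁ s₂ + 1 / p + d / q - (d + 1)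

/-- `N₁(K₁, K₂, ε₁)`, where `p'` and `q'` are the conjugate exponents. -/
def approxN₁ (d : ℕ) (p q α₁ ctilde s₁ s₂ K₁ K₂ ε₁ : ℝ) : ℝ :=
  let p' := p / (p - 1)
  let q' := q / (q - 1)
  max K₁ K₂ +
    (ctilde * K₁ ^ (1 / p) * K₂ ^ (d / q) * (d : ℝ) ^ (1 / q')
          * (1 + K₂) ^ ((d - 1) / q' + 1 / p') * 2 ^ (d + 1)
        / (α₁ * ε₁ * (s₂ * q' - d) ^ (1 / q'))
      + ctilde * K₁ ^ (1 / p) * K₂ ^ (d / q) * (1 + K₁) ^ (d / q') * 2 ^ (d + 1)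
        / (α₁ * ε₁ * (s₁ * p' - 1) ^ (1 / p'))
      + ctilde * K₁ ^ (1 / p) * K₂ ^ (d / q) * (d : ℝ) ^ (1 / q')
          * (1 + K₂) ^ ((d - 1) / q') * 2 ^ (d + 1)
        / (α₁ * ε₁ * (s₁ * p' - 1) ^ (1 / p') * (s₂ * q' - d) ^ (1 / q')))
      ^ (1 / surplus d p q s₁ s₂)

/-- `N₂(K₁, K₂, ε₂)`, where `p'` and `q'` are the conjugate exponents. -/
def approxN₂ (d : ℕ) (p q α₁ ctilde s₁ s₂ K₁ K₂ ε₂ : ℝ) : ℝ :=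
  let p' := p / (p - 1)
  let q' := q / (q - 1)
  max K₁ K₂ +
    (ctilde * (d : ℝ) ^ (1 / q') * (1 + K₂) ^ ((d - 1) / q' + 1 / p')
          * (2 : ℝ) ^ (1 / p' + d / q')
        / (α₁ * ε₂ * (s₂ * q' - d) ^ (1 / q'))
      + ctilde * (1 + K₁) ^ (d / q') * (2 : ℝ) ^ (1 / p' + d / q')
        / (α₁ * ε₂ * (s₁ * p' - 1) ^ (1 / p'))
      + ctilde * (d : ℝ) ^ (1 / q') * (1 + K₂) ^ ((d - 1) / q')
          * (2 : ℝ) ^ (1 / p' + d / q')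
        / (α₁ * ε₂ * (s₁ * p' - 1) ^ (1 / p') * (s₂ * q' - d) ^ (1 / q')))
      ^ (1 / surplus d p q s₁ s₂)

/-- The lower sampling constant `A`. -/
def lowerConst (d n m : ℕ) (p q K₁ K₂ δ ε γ C₁ c L : ℝ) : ℝ :=
  C₁ * c ^ (1 - p * q) * L * ((1 - γ) * (1 - δ - ε) ^ (1 + p * q) - ε)
      / volFactor d p q K₁ K₂
    * (n : ℝ) ^ (1 / p) * (m : ℝ) ^ (1 / q)

/-- The upper sampling constant `B`. -/
def upperConst (d n m : ℕ) (p q K₁ K₂ δ ε γ α₁ α₂ C₁ C₂ c L : ℝ) : ℝ :=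
  α₂ * L / α₁
      * (C₂ / ((2 * K₁) ^ ((1 - p) / p) * (2 * K₂) ^ ((d : ℝ) * ((1 - q) / q)))
        + γ * C₁ * c ^ (1 - p * q) * (1 - δ - ε) ^ (p * q) / volFactor d p q K₁ K₂)
      * (n * m)
    + ε * C₁ * c ^ (1 - p * q) * L / volFactor d p q K₁ K₂
      * (n : ℝ) ^ (1 / p) * (m : ℝ) ^ (1 / q)

end RandomAverageSampling

end

/-! The space `V^{p,q}(Φ)` is infinite-dimensional, but averages at points of `C_K` only see a
signal on the doubled cuboid, because `ψ` is supported in `C_K`. There the decay of the generators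
makes all coefficients outside the box of size `N` negligible: `N₂` controls the pointwise error of
the averages, `N₁` their mixed-norm error. What remains is a uniform law of large numbers for the
functions `|F * ψ|`, with `F` a series over the box; they form a family indexed by a space of
complex dimension `D = r(2N+1)^{d+1}`.

Three facts then give the sampling inequality.

Expectation. A function bounded by `M` satisfies `‖g‖^{pq} ≤ M^{pq-1} P ∫|g|` on the cuboid
(`iteratedNorm_rpow_le`). For the truncated average, `M = c^* L ‖f‖`, and the concentration
hypothesis, up to the truncation error, bounds its mixed norm from below. This bounds the mean of
its modulus below by a multiple of `‖f‖` (`le_expectation_average`). The embedding of `L^{p,q}(C_K)`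
into `L^1` gives the upper bound.

Deviation. The modulus of the average depends on the coefficients in a Lipschitz way, uniformly in
the sample point (`averageModulus_lipschitz`). Chaining over nets of the unit ball, with Hoeffding's
inequality at every level (`uniform_deviation_unitBall`), bounds all deviations at once. Hoeffding's
exponents are better than the rates `β₁` and `β₂`; this surplus absorbs the real dimension `2D` and
the sum over levels (`chaining_bound_le`). Squaring the covering factor is harmless because the
claim is void when `𝒜₁ e^{-nmβ₁} > 1`.

Discretization. Hölder's inequality for finite arrays turns empirical means of moduli into lower
bounds for `l^{p,q}` norms, and the contraction of `l^1` into `l^{p,q}` gives upper bounds.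

The constant `c^*` requires a bound for the shifted sums of `(1+|y|)^{-t}` over `ℤ^d` without a loss
exponential in `d`. It holds because `(1+|y|)^{-t}` is a positive mixture of Gaussians, and a
periodized Gaussian has its maximum at the lattice points by Poisson summation
(`tsum_one_add_norm_sub_rpow_le`). -/

namespace RandomAverageSampling

/-! ### Nets of the unit ball in finite dimension -/

section Covering

open Metric Module

variable {E : Type*} [NormedAddCommGroup E] [NormedSpace ℝ E] [FiniteDimensional ℝ E]

/-- A volume argument bounds the cardinality of separated subsets of the unit ball. -/
lemma card_le_of_separated_unitBall {η : ℝ} (hη : 0 < η) (s : Finset E)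
    (hs : ∀ x ∈ s, ‖x‖ ≤ 1) (h : ∀ x ∈ s, ∀ y ∈ s, x ≠ y → η ≤ ‖x - y‖) :
    (s.card : ℝ) ≤ (1 + 2 / η) ^ finrank ℝ E := by
  borelize E
  let μ : Measure E := Measure.addHaar
  have hη2 : 0 < η / 2 := by positivity
  have hρ : 0 < 1 + η / 2 := by positivity
  have D : Set.Pairwise (s : Set E) (Function.onFun Disjoint fun c => ball (c : E) (η / 2)) := by
    rintro c hc d hd hcd
    apply ball_disjoint_ball
    rw [dist_eq_norm]
    linarith [h c hc d hd hcd]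
  have hsub : (⋃ c ∈ s, ball (c : E) (η / 2)) ⊆ ball (0 : E) (1 + η / 2) := by
    refine Set.iUnion₂_subset fun x hx => ball_subset_ball' ?_
    rw [dist_zero_right]
    linarith [hs x hx]
  have I : (s.card : ℝ≥0∞) * ENNReal.ofReal ((η / 2) ^ finrank ℝ E) * μ (ball 0 1) ≤
      ENNReal.ofReal ((1 + η / 2) ^ finrank ℝ E) * μ (ball 0 1) :=
    calc
      _ = μ (⋃ c ∈ s, ball (c : E) (η / 2)) := by
        rw [measure_biUnion_finset D fun c _ => measurableSet_ball]
        simp only [μ.addHaar_ball_of_pos _ hη2]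
        simp only [Finset.sum_const, nsmul_eq_mul, mul_assoc]
      _ ≤ μ (ball (0 : E) (1 + η / 2)) := measure_mono hsub
      _ = _ := by simp only [μ.addHaar_ball_of_pos _ hρ]
  have J : (s.card : ℝ≥0∞) * ENNReal.ofReal ((η / 2) ^ finrank ℝ E) ≤
      ENNReal.ofReal ((1 + η / 2) ^ finrank ℝ E) :=
    (ENNReal.mul_le_mul_iff_left (measure_ball_pos _ _ zero_lt_one).ne' measure_ball_lt_top.ne).1 I
  have K := ENNReal.toReal_le_of_le_ofReal (pow_nonneg hρ.le _) J
  rw [ENNReal.toReal_mul, ENNReal.toReal_natCast, ENNReal.toReal_ofReal (by positivity)] at K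
  have : (1 + 2 / η) ^ finrank ℝ E = (1 + η / 2) ^ finrank ℝ E / (η / 2) ^ finrank ℝ E := by
    rw [← div_pow]
    congr 1
    field_simp
    ring
  rw [this, le_div_iff₀ (by positivity)]
  exact K

/-- The unit ball of a finite-dimensional space has an `η`-net of cardinality at most
`(1 + 2 / η) ^ dim`. -/
lemma exists_net_unitBall {η : ℝ} (hη : 0 < η) :
    ∃ s : Finset E, (∀ x ∈ s, ‖x‖ ≤ 1) ∧ (∀ x : E, ‖x‖ ≤ 1 → ∃ y ∈ s, ‖x - y‖ ≤ η) ∧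
      (s.card : ℝ) ≤ (1 + 2 / η) ^ finrank ℝ E := by
  classical
  -- A separated set of maximal cardinality is a net: a point farther than `η` from all its elements
  -- could be added. The volume bound makes the maximum exist.
  let Q : ℕ → Prop := fun k => ∃ s : Finset E, s.card = k ∧ (∀ x ∈ s, ‖x‖ ≤ 1) ∧
    ∀ x ∈ s, ∀ y ∈ s, x ≠ y → η ≤ ‖x - y‖
  let M := ⌊(1 + 2 / η) ^ finrank ℝ E⌋₊
  have hQM : ∀ k, Q k → k ≤ M := by
    rintro k ⟨s, rfl, h1, h2⟩
    exact Nat.le_floor (card_le_of_separated_unitBall hη s h1 h2)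
  have hQ0 : Q 0 := ⟨∅, by simp⟩
  obtain ⟨s, hcard, h1, h2⟩ := Nat.findGreatest_spec (P := Q) (Nat.zero_le M) hQ0
  refine ⟨s, h1, fun x hx => ?_, card_le_of_separated_unitBall hη s h1 h2⟩
  by_contra! hcon
  have hxs : x ∉ s := fun hmem => by
    have := hcon x hmem
    simp at this
    linarith
  have hQ : Q (s.card + 1) := by
    refine ⟨insert x s, Finset.card_insert_of_notMem hxs, ?_, ?_⟩
    · intro y hy
      rcases Finset.mem_insert.1 hy with rfl | hy
      exacts [hx, h1 y hy]
    · intro y hy z hz hyz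
      rcases Finset.mem_insert.1 hy with rfl | hy' <;> rcases Finset.mem_insert.1 hz with rfl | hz
      · exact absurd rfl hyz
      · exact (hcon z hz).le
      · rw [norm_sub_rev]
        exact (hcon y hy').le
      · exact h2 y hy' z hz hyz
  have := Nat.le_findGreatest (hQM _ hQ) hQ
  omega

end Covering

/-! ### Hoeffding's inequality and chaining -/

section Chaining

variable {S Ω ι : Type*} [MeasurableSpace S] [MeasurableSpace Ω] [Fintype ι]
  {ν : Measure S} {P : Measure Ω}

/-- The centred empirical sum of `h` along the samples `X`. -/
noncomputable def centredSum (ν : Measure S) (X : ι → Ω → S) (h : S → ℝ) (w : Ω) : ℝ :=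
  ∑ i, (h (X i w) - ∫ s, h s ∂ν)

lemma integrable_of_mem_Icc_everywhere [IsFiniteMeasure ν] {h : S → ℝ} (hm : Measurable h) {a b : ℝ}
    (hb : ∀ s, h s ∈ Set.Icc a b) : Integrable h ν :=
  Integrable.of_mem_Icc a b hm.aemeasurable (ae_of_all _ hb)

/-- Hoeffding's inequality, two-sided. -/
lemma hoeffding_centredSum [IsProbabilityMeasure P] [Nonempty ι] {X : ι → Ω → S} (hindep : iIndepFun X P)
    (hlaw : ∀ i, HasLaw (X i) ν P) {h : S → ℝ} (hm : Measurable h) {a R : ℝ} (hR : 0 < R)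
    (hb : ∀ s, h s ∈ Set.Icc a (a + R)) {t : ℝ} (ht : 0 ≤ t) :
    P {w | t ≤ |centredSum ν X h w|} ≤
      ENNReal.ofReal (2 * Real.exp (-(2 * t ^ 2 / (Fintype.card ι * R ^ 2)))) := by
  have hcomp : ∀ i, AEMeasurable (fun w => h (X i w)) P := fun i =>
    hm.comp_aemeasurable (hlaw i).aemeasurable
  have hint : ∀ i, ∫ w, h (X i w) ∂P = ∫ s, h s ∂ν := fun i =>
    (hlaw i).integral_comp (f := h) hm.aestronglyMeasurable
  have hsub : ∀ i, HasSubgaussianMGF (fun w => h (X i w) - ∫ s, h s ∂ν)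
      ((‖(a + R) - a‖₊ / 2) ^ 2) P := fun i => by
    rw [← hint i]
    exact hasSubgaussianMGF_of_mem_Icc (hcomp i) (ae_of_all _ fun w => hb _)
  have hind : iIndepFun (fun i w => h (X i w) - ∫ s, h s ∂ν) P :=
    hindep.comp (fun _ s => h s - ∫ s, h s ∂ν) fun _ => hm.sub_const _
  have hind' : iIndepFun (fun i w => -(h (X i w) - ∫ s, h s ∂ν)) P :=
    hindep.comp (fun _ s => -(h s - ∫ s, h s ∂ν)) fun _ => (hm.sub_const _).neg
  have h1 := HasSubgaussianMGF.measure_sum_ge_le_of_iIndepFun hind (s := Finset.univ)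
    (fun i _ => hsub i) ht
  have h2 := HasSubgaussianMGF.measure_sum_ge_le_of_iIndepFun hind' (s := Finset.univ)
    (fun i _ => (hsub i).neg) ht
  have hexp : -t ^ 2 / (2 * ((∑ _i : ι, (‖(a + R) - a‖₊ / 2) ^ 2 : NNReal) : ℝ))
      = -(2 * t ^ 2 / (Fintype.card ι * R ^ 2)) := by
    have : (Fintype.card ι : ℝ) ≠ 0 := by exact_mod_cast Fintype.card_ne_zero
    push_cast
    simp only [add_sub_cancel_left, Real.norm_eq_abs, Finset.sum_const, Finset.card_univ,
      nsmul_eq_mul, div_pow, sq_abs]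
    field_simp
  push_cast at h1 h2 hexp
  rw [hexp] at h1 h2
  have hsubset : {w | t ≤ |centredSum ν X h w|} ⊆
      {w | t ≤ ∑ i, (h (X i w) - ∫ s, h s ∂ν)} ∪
        {w | t ≤ ∑ i, -(h (X i w) - ∫ s, h s ∂ν)} := by
    intro w hw
    rcases le_abs.1 (show t ≤ |centredSum ν X h w| from hw) with hw | hw
    · exact Or.inl hw
    · refine Or.inr ?_
      simpa [centredSum, Finset.sum_neg_distrib] using hw
  calc P {w | t ≤ |centredSum ν X h w|}
      ≤ P {w | t ≤ ∑ i, (h (X i w) - ∫ s, h s ∂ν)} +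
        P {w | t ≤ ∑ i, -(h (X i w) - ∫ s, h s ∂ν)} :=
        (measure_mono hsubset).trans (measure_union_le _ _)
    _ ≤ ENNReal.ofReal (Real.exp (-(2 * t ^ 2 / (Fintype.card ι * R ^ 2)))) +
        ENNReal.ofReal (Real.exp (-(2 * t ^ 2 / (Fintype.card ι * R ^ 2)))) := by
        gcongr
        · exact (ENNReal.le_ofReal_iff_toReal_le (measure_ne_top _ _) (Real.exp_pos _).le).2 h1
        · exact (ENNReal.le_ofReal_iff_toReal_le (measure_ne_top _ _) (Real.exp_pos _).le).2 h2
    _ = _ := by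
        rw [← ENNReal.ofReal_add (Real.exp_pos _).le (Real.exp_pos _).le, ← two_mul]

lemma measure_biUnion_finset_le_card {α : Type*} (s : Finset α) (B : α → Set Ω) {K u : ℝ}
    (hK : (s.card : ℝ) ≤ K) (hB : ∀ x ∈ s, P (B x) ≤ ENNReal.ofReal u) (hu : 0 ≤ u) :
    P (⋃ x ∈ s, B x) ≤ ENNReal.ofReal (K * u) := by
  calc P (⋃ x ∈ s, B x) ≤ ∑ x ∈ s, P (B x) := measure_biUnion_finset_le _ _
    _ ≤ ∑ _x ∈ s, ENNReal.ofReal u := Finset.sum_le_sum hB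
    _ = ENNReal.ofReal (s.card * u) := by
        rw [Finset.sum_const, nsmul_eq_mul, ENNReal.ofReal_mul (by positivity),
          ENNReal.ofReal_natCast]
    _ ≤ _ := ENNReal.ofReal_le_ofReal (by gcongr)

variable {E : Type*} [NormedAddCommGroup E] [NormedSpace ℝ E] [FiniteDimensional ℝ E]

/-- Uniform deviation bound, by chaining, for a Lipschitz family of functions indexed by the unit
ball of a finite-dimensional space. -/
theorem uniform_deviation_unitBall [IsProbabilityMeasure ν] [IsProbabilityMeasure P]
    [Nonempty ι] {X : ι → Ω → S} (hindep : iIndepFun X P)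
    (hlaw : ∀ i, HasLaw (X i) ν P) {G : E → S → ℝ} (hm : ∀ e, Measurable (G e))
    {b c θ : ℝ} (hb : 0 < b) (hc : 0 < c) (hθ : 0 < θ)
    (hG0 : ∀ s, G 0 s = 0) (hGnn : ∀ e s, 0 ≤ G e s)
    (hlip : ∀ e e' s, |G e s - G e' s| ≤ b * ‖e - e'‖) :
    ∃ A : Set Ω, MeasurableSet A ∧
      P Aᶜ ≤ ENNReal.ofReal ((1 + 4 * c) ^ Module.finrank ℝ E *
            (2 * Real.exp (-(Fintype.card ι * θ ^ 2 / 2)))) +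
          ∑' l : ℕ, ENNReal.ofReal ((1 + 4 * c * 2 ^ (l + 1)) ^ Module.finrank ℝ E *
            (2 * Real.exp (-(Fintype.card ι * θ ^ 2 * c ^ 2 * (16 / 9) ^ (l + 1) / 32)))) ∧
      ∀ w ∈ A, ∀ e, ‖e‖ ≤ 1 → |centredSum ν X (G e) w| ≤ Fintype.card ι * (b * θ) := by
  classical
  set T : ℝ := (Fintype.card ι : ℝ) with hT
  have hTpos : 0 < T := by
    rw [hT]
    exact_mod_cast Fintype.card_pos
  -- The mesh at level `l` is `1/(2c 2^l)`. At level `0` the covering bound becomes `(1+4c)^dim`,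
  -- which is the origin of the base `4c^*+1` in `𝒜₁`.
  have hη : ∀ l : ℕ, 0 < 1 / (2 * c * 2 ^ l) := fun l => by positivity
  choose s hs1 hs2 hs3 using fun l : ℕ => exists_net_unitBall (E := E) (hη l)
  have hs3' : ∀ l, ((s l).card : ℝ) ≤ (1 + 4 * c * 2 ^ l) ^ Module.finrank ℝ E := fun l => by
    have h := hs3 l
    have : 2 / (1 / (2 * c * 2 ^ l)) = 4 * c * 2 ^ l := by
      field_simp
      norm_num
    rwa [this] at h
  choose! π hπ1 hπ2 using hs2
  -- Nonnegativity gives range `b` instead of `2b` in Hoeffding's inequality.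
  have hbound : ∀ e, ‖e‖ ≤ 1 → ∀ s, G e s ∈ Set.Icc 0 b := fun e he s => by
    refine ⟨hGnn e s, ?_⟩
    have h := hlip e 0 s
    rw [hG0, sub_zero, sub_zero, abs_of_nonneg (hGnn e s)] at h
    nlinarith
  have hGint : ∀ e, ‖e‖ ≤ 1 → Integrable (G e) ν := fun e he =>
    integrable_of_mem_Icc_everywhere (hm e) (hbound e he)
  have hdiff : ∀ e e', ‖e‖ ≤ 1 → ‖e'‖ ≤ 1 → ∀ w,
      centredSum ν X (fun s => G e s - G e' s) w =
        centredSum ν X (G e) w - centredSum ν X (G e') w := fun e e' he he' w => by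
    simp only [centredSum]
    rw [integral_sub (hGint e he) (hGint e' he'), ← Finset.sum_sub_distrib]
    exact Finset.sum_congr rfl fun i _ => by ring
  -- The total deviation `T b θ` is shared out: one half to level `0` and the fraction
  -- `(1/4)(2/3)^(l+1)` to the step from level `l` to `l+1`, which adds up to the other half. The
  -- shares decay by `2/3` while the ranges decay by `1/2`, so Hoeffding's exponent grows by the
  -- factor `(4/3)^2 = 16/9` at each level and outruns the growth of the nets.
  set B0 : Set Ω := ⋃ e ∈ s 0, {w | T * (b * θ) / 2 ≤ |centredSum ν X (G e) w|} with hB0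
  set B : ℕ → Set Ω := fun l => ⋃ e ∈ s (l + 1),
    {w | T * (b * θ) * ((1 / 4) * (2 / 3) ^ (l + 1)) ≤
      |centredSum ν X (fun x => G e x - G (π l e) x) w|} with hB
  have hPB0 : P B0 ≤ ENNReal.ofReal ((1 + 4 * c) ^ Module.finrank ℝ E *
      (2 * Real.exp (-(T * θ ^ 2 / 2)))) := by
    refine measure_biUnion_finset_le_card _ _ (by simpa using hs3' 0) (fun e he => ?_)
      (by positivity)
    refine (hoeffding_centredSum hindep hlaw (hm e) hb
      (a := 0) (by simpa using hbound e (hs1 0 e he)) (t := T * (b * θ) / 2) (by positivity)).trans_eq ?_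
    congr 4
    rw [← hT]
    field_simp
  have hPB : ∀ l, P (B l) ≤ ENNReal.ofReal ((1 + 4 * c * 2 ^ (l + 1)) ^ Module.finrank ℝ E *
      (2 * Real.exp (-(T * θ ^ 2 * c ^ 2 * (16 / 9) ^ (l + 1) / 32)))) := fun l => by
    refine measure_biUnion_finset_le_card _ _ (hs3' (l + 1)) (fun e he => ?_) (by positivity)
    have he1 := hs1 (l + 1) e he
    have hR : 0 < b * (1 / (c * 2 ^ l)) := by positivity
    refine (hoeffding_centredSum hindep hlaw ((hm e).sub (hm (π l e)))
      (a := -(b * (1 / (2 * c * 2 ^ l)))) hR (fun x => ?_)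
      (t := T * (b * θ) * ((1 / 4) * (2 / 3) ^ (l + 1))) (by positivity)).trans_eq ?_
    · have h := (hlip e (π l e) x).trans
        (mul_le_mul_of_nonneg_left (hπ2 l e he1) hb.le)
      rw [abs_le] at h
      refine ⟨h.1, h.2.trans (le_of_eq ?_)⟩
      field_simp
      ring
    · congr 4
      rw [← hT]
      have h169 : ((16 : ℝ) / 9) ^ (l + 1) = ((2 / 3) ^ (l + 1)) ^ 2 * (2 * 2 ^ l) ^ 2 := by
        rw [← pow_succ', ← pow_mul, ← pow_mul, mul_comm (l + 1) 2, pow_mul, pow_mul, ← mul_pow]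
        norm_num
      rw [h169]
      field_simp
      ring
  -- The samples are only almost everywhere measurable, so the bad set is replaced by a measurable
  -- hull of the same measure.
  refine ⟨(toMeasurable P (B0 ∪ ⋃ l, B l))ᶜ, (measurableSet_toMeasurable _ _).compl, ?_, ?_⟩
  · rw [compl_compl, measure_toMeasurable]
    exact (measure_union_le _ _).trans
      (add_le_add hPB0 ((measure_iUnion_le _).trans (ENNReal.tsum_le_tsum hPB)))
  · intro w hw
    have hw' : w ∉ B0 ∪ ⋃ l, B l := fun h => hw (subset_toMeasurable _ _ h)
    have hw0 : ∀ e ∈ s 0, |centredSum ν X (G e) w| ≤ T * (b * θ) / 2 := fun e he => by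
      by_contra! hcon
      exact hw' (Or.inl (Set.mem_biUnion he hcon.le))
    have hwl : ∀ l, ∀ e ∈ s (l + 1), |centredSum ν X (fun x => G e x - G (π l e) x) w| ≤
        T * (b * θ) * ((1 / 4) * (2 / 3) ^ (l + 1)) := fun l e he => by
      by_contra! hcon
      exact hw' (Or.inr (Set.mem_iUnion.2 ⟨l, Set.mem_biUnion he hcon.le⟩))
    have hnet : ∀ l, ∀ e ∈ s l,
        |centredSum ν X (G e) w| ≤ T * (b * θ) * (1 - (1 / 2) * (2 / 3) ^ l) := by
      intro l
      induction l with
      | zero =>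
        intro e he
        refine (hw0 e he).trans (le_of_eq ?_)
        ring
      | succ l ih =>
        intro e he
        have he1 := hs1 (l + 1) e he
        have h1 := hwl l e he
        rw [hdiff e _ he1 (hs1 l _ (hπ1 l e he1))] at h1
        have h2 := ih _ (hπ1 l e he1)
        have h3 := abs_add_le (centredSum ν X (G e) w - centredSum ν X (G (π l e)) w)
          (centredSum ν X (G (π l e)) w)
        rw [sub_add_cancel] at h3
        refine (h3.trans (add_le_add h1 h2)).trans (le_of_eq ?_)
        ring
    intro e he
    -- An arbitrary point is compared with its nearest net point at level `l`; the error is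
    -- deterministic, by the Lipschitz bound for both the sum and the mean, and tends to `0`.
    have hlim : ∀ l : ℕ, |centredSum ν X (G e) w| ≤
        T * (b * θ) + T * (2 * (b / (2 * c))) * (1 / 2) ^ l := fun l => by
      have hpe := hπ1 l e he
      have hpe1 := hs1 l _ hpe
      have h1 := hnet l _ hpe
      have h2 : |centredSum ν X (fun x => G e x - G (π l e) x) w| ≤
          T * (2 * (b / (2 * c))) * (1 / 2) ^ l := by
        have hd : ∀ x, |G e x - G (π l e) x| ≤ b * (1 / (2 * c * 2 ^ l)) := fun x =>
          (hlip e (π l e) x).trans (mul_le_mul_of_nonneg_left (hπ2 l e he) hb.le)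
        have hI : |∫ x, (G e x - G (π l e) x) ∂ν| ≤ b * (1 / (2 * c * 2 ^ l)) := by
          have := norm_integral_le_of_norm_le_const (μ := ν)
            (f := fun x => G e x - G (π l e) x) (ae_of_all _ hd)
          simpa using this
        calc |centredSum ν X (fun x => G e x - G (π l e) x) w|
            ≤ ∑ _i : ι, 2 * (b * (1 / (2 * c * 2 ^ l))) := by
              refine (Finset.abs_sum_le_sum_abs _ _).trans (Finset.sum_le_sum fun i _ => ?_)
              refine (abs_sub _ _).trans ?_
              linarith [hd (X i w)]
          _ = _ := by
              rw [Finset.sum_const, Finset.card_univ, nsmul_eq_mul, ← hT, one_div_pow]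
              field_simp
      rw [hdiff e _ he hpe1] at h2
      have h3 := abs_add_le (centredSum ν X (G e) w - centredSum ν X (G (π l e)) w)
        (centredSum ν X (G (π l e)) w)
      rw [sub_add_cancel] at h3
      have h4 : T * (b * θ) * (1 - (1 / 2) * (2 / 3) ^ l) ≤ T * (b * θ) := by
        have : 0 ≤ T * (b * θ) * ((1 / 2) * (2 / 3) ^ l) := by positivity
        nlinarith
      linarith
    have htend : Filter.Tendsto (fun l : ℕ => T * (b * θ) + T * (2 * (b / (2 * c))) * (1 / 2) ^ l)
        Filter.atTop (nhds (T * (b * θ) + T * (2 * (b / (2 * c))) * 0)) :=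
      ((tendsto_pow_atTop_nhds_zero_of_lt_one (by norm_num) (by norm_num)).const_mul _).const_add _
    rw [mul_zero, add_zero] at htend
    exact ge_of_tendsto' htend hlim

end Chaining

end RandomAverageSampling

namespace RandomAverageSampling

/-! ### Comparison of the chaining bound with the stated constants -/

section Numerics

/-- At `x = 1` this is `(1+4c)² = 16(c+1/4)² ≤ 16(2c+1/4)(c+1/4)`. It converts a covering number in
real dimension `2D` into the `D`-th power occurring in `𝒜₂`. -/
lemma one_add_four_mul_sq_le {c x : ℝ} (hc : 0 < c) (hx : 1 ≤ x) :
    (1 + 4 * c * x) ^ 2 ≤ 16 * x ^ 2 * ((2 * c + 1 / 4) * (c + 1 / 4)) := by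
  have h1 : 1 + 4 * c * x ≤ x * (1 + 4 * c) := by nlinarith
  have h2 : 0 ≤ 1 + 4 * c * x := by positivity
  calc (1 + 4 * c * x) ^ 2 ≤ (x * (1 + 4 * c)) ^ 2 := by gcongr
    _ = x ^ 2 * (1 + 4 * c) ^ 2 := by ring
    _ ≤ x ^ 2 * (16 * ((2 * c + 1 / 4) * (c + 1 / 4))) := by
      gcongr
      nlinarith
    _ = _ := by ring

/-- The contribution of one refinement level in the chaining bound. -/
lemma chaining_level_le {c J κ : ℝ} {D : ℕ} (hc : 0 < c) (hκ : 0 < κ) (hD : 1 ≤ D)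
    (hJ : 4000 * (D : ℝ) ≤ J) (l : ℕ) :
    (1 + 4 * c * 2 ^ (l + 1)) ^ (2 * D) * (2 * Real.exp (-(J * (16 / 9) ^ (l + 1) / 32))) ≤
      ((2 * c + 1 / 4) * (c + 1 / 4)) ^ D * Real.exp (-(J / (18 * √2 * (81 + 2 * κ)))) *
        (2 / D * (1 / 2) ^ (l + 1)) := by
  have hD' : (1 : ℝ) ≤ D := by exact_mod_cast hD
  have hDpos : (0 : ℝ) < D := by linarith
  have hJpos : 0 < J := by linarith
  set k : ℕ := l + 1 with hk
  have hk1 : (1 : ℝ) ≤ (k : ℝ) := by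
    rw [hk]
    push_cast
    linarith [(Nat.cast_nonneg l : (0 : ℝ) ≤ l)]
  have hsqrt : (1.4 : ℝ) ≤ √2 := Real.le_sqrt_of_sq_le (by norm_num)
  have hden : J / (18 * √2 * (81 + 2 * κ)) ≤ J / 2000 := by
    have : (2000 : ℝ) ≤ 18 * √2 * (81 + 2 * κ) := by nlinarith
    gcongr
  -- By Bernoulli's inequality. Growth linear in the level is already enough below.
  have hpow : 7 / 9 * (k : ℝ) ≤ (16 / 9 : ℝ) ^ k := by
    have := one_add_mul_le_pow (a := (7 / 9 : ℝ)) (by norm_num) k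
    norm_num at this ⊢
    linarith
  -- Since `J ≥ 4000 D`, the exponent `7Jk/288` pays both for `J/2000`, which dominates the rate
  -- `β₂`, and for `80 D k`, which beats the covering number `e^{5Dk}` and the factor `D 2^k`.
  have hexp : -(J * (16 / 9) ^ k / 32) ≤
      -(J / (18 * √2 * (81 + 2 * κ))) + -(80 * D * k) := by
    have h1 : J * (7 / 9 * (k : ℝ)) ≤ J * (16 / 9 : ℝ) ^ k := by gcongr
    have h2 : 4000 * (D : ℝ) * k ≤ J * k := by gcongr
    have h3 : J ≤ J * k := by nlinarith
    nlinarith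
  have hX : (1 + 4 * c * 2 ^ k) ^ (2 * D) ≤
      Real.exp (5 * D * k) * ((2 * c + 1 / 4) * (c + 1 / 4)) ^ D := by
    have h1 : (1 : ℝ) ≤ 2 ^ k := one_le_pow₀ (by norm_num)
    have h8 : (16 : ℝ) * (2 ^ k) ^ 2 ≤ Real.exp (5 * k) := by
      calc (16 : ℝ) * (2 ^ k) ^ 2 ≤ 16 ^ k * (2 ^ k) ^ 2 := by
            gcongr
            exact le_self_pow₀ (by norm_num) (by omega)
        _ = 64 ^ k := by rw [← pow_mul, mul_comm k 2, pow_mul, ← mul_pow]; norm_num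
        _ ≤ (Real.exp 5) ^ k := by
            gcongr
            have h := Real.exp_one_gt_d9
            have h5 : Real.exp 5 = Real.exp 1 ^ 5 := by rw [← Real.exp_nat_mul]; norm_num
            rw [h5]
            calc (64 : ℝ) ≤ 2.7 ^ 5 := by norm_num
              _ ≤ _ := by
                gcongr
                linarith
        _ = Real.exp (5 * k) := by rw [← Real.exp_nat_mul, mul_comm]
    rw [pow_mul]
    calc ((1 + 4 * c * 2 ^ k) ^ 2) ^ D
        ≤ (Real.exp (5 * k) * ((2 * c + 1 / 4) * (c + 1 / 4))) ^ D := by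
          gcongr
          exact (one_add_four_mul_sq_le hc h1).trans (by gcongr)
      _ = _ := by
          rw [mul_pow, ← Real.exp_nat_mul]
          congr 2
          ring
  have hfin : Real.exp (5 * D * k) * (2 * Real.exp (-(80 * D * k))) ≤ 2 / D * (1 / 2) ^ k := by
    have hDe : (D : ℝ) ≤ Real.exp (D * k) := by
      have := Real.add_one_le_exp ((D : ℝ) * k)
      nlinarith
    have h2e : (2 : ℝ) ^ k ≤ Real.exp (D * k) := by
      calc (2 : ℝ) ^ k ≤ (Real.exp 1) ^ k := by
            gcongr
            linarith [Real.exp_one_gt_d9]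
        _ = Real.exp k := by rw [← Real.exp_nat_mul, mul_one]
        _ ≤ _ := Real.exp_le_exp.2 (by nlinarith)
    have h3 : (D : ℝ) * 2 ^ k * Real.exp (5 * D * k) * Real.exp (-(80 * D * k)) ≤ 1 := by
      calc (D : ℝ) * 2 ^ k * Real.exp (5 * D * k) * Real.exp (-(80 * D * k))
          ≤ Real.exp (D * k) * Real.exp (D * k) * Real.exp (5 * D * k) *
              Real.exp (-(80 * D * k)) := by gcongr
        _ = Real.exp (-(73 * D * k)) := by
            rw [← Real.exp_add, ← Real.exp_add, ← Real.exp_add]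
            congr 1
            ring
        _ ≤ 1 := Real.exp_le_one_iff.2 (by
            have : (0 : ℝ) ≤ 73 * D * k := by positivity
            linarith)
    rw [one_div_pow, div_mul_div_comm, mul_one, le_div_iff₀ (by positivity)]
    nlinarith
  calc (1 + 4 * c * 2 ^ k) ^ (2 * D) * (2 * Real.exp (-(J * (16 / 9) ^ k / 32)))
      ≤ (Real.exp (5 * D * k) * ((2 * c + 1 / 4) * (c + 1 / 4)) ^ D) *
        (2 * (Real.exp (-(J / (18 * √2 * (81 + 2 * κ)))) * Real.exp (-(80 * D * k)))) := by
        rw [← Real.exp_add]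
        gcongr
    _ = ((2 * c + 1 / 4) * (c + 1 / 4)) ^ D * Real.exp (-(J / (18 * √2 * (81 + 2 * κ)))) *
        (Real.exp (5 * D * k) * (2 * Real.exp (-(80 * D * k)))) := by ring
    _ ≤ _ := by gcongr

/-- The chaining bound in real dimension `2 D` is dominated by the two exponential terms of the
sampling theorem. -/
lemma chaining_bound_le {c θ T : ℝ} {D : ℕ} (hc : 0 < c) (hθ : 0 < θ) (hT : 0 < T) (hD : 1 ≤ D)
    (hthr : 54 * √2 * Real.log 2 * D * (2 * (θ * c) + 81) < T * (θ * c) ^ 2)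
    (hY : (1 + 4 * c) ^ D * Real.exp (-(T * (3 / 4 * θ ^ 2 / (6 + θ)))) ≤ 1) :
    ENNReal.ofReal ((1 + 4 * c) ^ (2 * D) * (2 * Real.exp (-(T * θ ^ 2 / 2)))) +
        ∑' l : ℕ, ENNReal.ofReal ((1 + 4 * c * 2 ^ (l + 1)) ^ (2 * D) *
          (2 * Real.exp (-(T * θ ^ 2 * c ^ 2 * (16 / 9) ^ (l + 1) / 32)))) ≤
      ENNReal.ofReal (2 * ((1 + 4 * c) ^ D * Real.exp (-(T * (3 / 4 * θ ^ 2 / (6 + θ))))) +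
        4 * ((2 * c + 1 / 4) * (c + 1 / 4)) ^ D / (3 * Real.log 2 ^ 2 * D) *
          Real.exp (-(T * ((θ * c) ^ 2 / (18 * √2 * (81 + 2 * (θ * c))))))) := by
  have hD' : (1 : ℝ) ≤ D := by exact_mod_cast hD
  have hDpos : (0 : ℝ) < D := by linarith
  have hlog1 : (0.69 : ℝ) ≤ Real.log 2 := by linarith [Real.log_two_gt_d9]
  have hlog2 : Real.log 2 ≤ 0.7 := by linarith [Real.log_two_lt_d9]
  have hlogpos : 0 < Real.log 2 := by linarith
  have hsqrt : (1.4 : ℝ) ≤ √2 := Real.le_sqrt_of_sq_le (by norm_num)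
  set κ := θ * c with hκ
  have hκpos : 0 < κ := by positivity
  set J := T * κ ^ 2 with hJdef
  -- The sample threshold enters here: `54 √2 ln 2 ≥ 52` and `52 · 81 ≥ 4000`.
  have hJ : 4000 * (D : ℝ) ≤ J := by
    have h1 : (52 : ℝ) ≤ 54 * √2 * Real.log 2 := by nlinarith
    have h2 : 52 * (D : ℝ) * 81 ≤ 54 * √2 * Real.log 2 * D * (2 * κ + 81) := by
      gcongr
      linarith
    nlinarith
  rw [ENNReal.ofReal_add (by positivity) (by positivity)]
  refine add_le_add (ENNReal.ofReal_le_ofReal ?_) ?_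
  -- Hoeffding's exponent `θ²/2` is at least twice the rate `β₁`. The level-zero term is therefore
  -- at most twice the square of `(1+4c)^D e^{-Tβ₁}`, and one of the two factors is dropped by `hY`.
  · have hβ : T * (3 / 4 * θ ^ 2 / (6 + θ)) + T * (3 / 4 * θ ^ 2 / (6 + θ)) ≤ T * θ ^ 2 / 2 := by
      have : 3 / 4 * θ ^ 2 / (6 + θ) ≤ θ ^ 2 / 4 := by
        rw [div_le_iff₀ (by positivity)]
        nlinarith [sq_nonneg θ, mul_pos hθ (pow_pos hθ 2)]
      nlinarith
    have h0 : 0 ≤ (1 + 4 * c) ^ D * Real.exp (-(T * (3 / 4 * θ ^ 2 / (6 + θ)))) := by positivity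
    calc (1 + 4 * c) ^ (2 * D) * (2 * Real.exp (-(T * θ ^ 2 / 2)))
        ≤ (1 + 4 * c) ^ (2 * D) * (2 * Real.exp (-(T * (3 / 4 * θ ^ 2 / (6 + θ))) +
          -(T * (3 / 4 * θ ^ 2 / (6 + θ))))) := by
          gcongr
          linarith
      _ = 2 * (((1 + 4 * c) ^ D * Real.exp (-(T * (3 / 4 * θ ^ 2 / (6 + θ))))) *
          ((1 + 4 * c) ^ D * Real.exp (-(T * (3 / 4 * θ ^ 2 / (6 + θ)))))) := by
          rw [Real.exp_add, two_mul, pow_add]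
          ring
      _ ≤ _ := mul_le_mul_of_nonneg_left (mul_le_of_le_one_left h0 hY) (by norm_num)
  · have hlevel := fun l => chaining_level_le hc hκpos hD hJ l
    have hJeq : T * θ ^ 2 * c ^ 2 = J := by rw [hJdef, hκ]; ring
    have hJ2 : T * (κ ^ 2 / (18 * √2 * (81 + 2 * κ))) = J / (18 * √2 * (81 + 2 * κ)) := by
      rw [hJdef]; ring
    rw [hJeq, hJ2]
    set Q := ((2 * c + 1 / 4) * (c + 1 / 4)) ^ D * Real.exp (-(J / (18 * √2 * (81 + 2 * κ))))
      with hQ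
    have hQpos : 0 < Q := by positivity
    have hsum : HasSum (fun l : ℕ => Q * (2 / D * (1 / 2 : ℝ) ^ (l + 1))) (Q * (2 / D * 1)) := by
      refine ((?_ : HasSum (fun l : ℕ => (1 / 2 : ℝ) ^ (l + 1)) 1).mul_left (2 / (D : ℝ))).mul_left Q
      have := hasSum_geometric_two.mul_left (1 / 2 : ℝ)
      simpa [pow_succ'] using this
    calc ∑' l : ℕ, ENNReal.ofReal ((1 + 4 * c * 2 ^ (l + 1)) ^ (2 * D) *
          (2 * Real.exp (-(J * (16 / 9) ^ (l + 1) / 32))))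
        ≤ ∑' l : ℕ, ENNReal.ofReal (Q * (2 / D * (1 / 2 : ℝ) ^ (l + 1))) :=
          ENNReal.tsum_le_tsum fun l => ENNReal.ofReal_le_ofReal (hlevel l)
      _ = ENNReal.ofReal (Q * (2 / D * 1)) := by
          rw [← ENNReal.ofReal_tsum_of_nonneg (fun l => by positivity) hsum.summable, hsum.tsum_eq]
      _ ≤ _ := by
          refine ENNReal.ofReal_le_ofReal ?_
          -- This amounts to `3 (ln 2)² ≤ 2`.
          have h1 : 2 / (D : ℝ) * 1 ≤ 4 / (3 * Real.log 2 ^ 2 * D) := by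
            rw [mul_one, div_le_div_iff₀ hDpos (by positivity)]
            have : Real.log 2 ^ 2 ≤ 0.7 ^ 2 := by gcongr
            nlinarith
          calc Q * (2 / D * 1) ≤ Q * (4 / (3 * Real.log 2 ^ 2 * D)) := by gcongr
            _ = _ := by rw [hQ]; ring

end Numerics

end RandomAverageSampling

namespace RandomAverageSampling

/-! ### Periodized Gaussians and mixtures of Gaussians -/

section GaussianMixture

/-- Gaussian sums over shifted integers converge. -/
lemma summable_exp_neg_mul_int_sub_sq {v : ℝ} (hv : 0 < v) (y : ℝ) :
    Summable fun n : ℤ => Real.exp (-v * (n - y) ^ 2) := by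
  have h1 : Summable fun n : ℤ => Real.exp (-|(n : ℝ)|) := by
    refine Summable.of_nat_of_neg ?_ ?_ <;> simpa using Real.summable_exp_neg_nat
  refine Summable.of_nonneg_of_le (fun n => (Real.exp_pos _).le) (fun n => ?_)
    (h1.mul_left (Real.exp (1 / (4 * v) + |y|)))
  rw [← Real.exp_add, Real.exp_le_exp]
  have h2 : |(n : ℝ)| ≤ |n - y| + |y| := by
    have := abs_add_le ((n : ℝ) - y) y
    rwa [sub_add_cancel] at this
  have h3 : |n - y| ≤ v * (n - y) ^ 2 + 1 / (4 * v) := by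
    rw [← sq_abs (n - y)]
    have h4 : 0 ≤ v * (|n - y| - 1 / (2 * v)) ^ 2 := by positivity
    have h5 : v * (|n - y| - 1 / (2 * v)) ^ 2 = v * |n - y| ^ 2 - |n - y| + 1 / (4 * v) := by
      field_simp
      ring
    linarith
  linarith

/-- A periodized Gaussian is largest at the lattice points. -/
lemma tsum_exp_neg_mul_int_sub_sq_le {v : ℝ} (hv : 0 < v) (y : ℝ) :
    ∑' n : ℤ, Real.exp (-v * (n - y) ^ 2) ≤ ∑' n : ℤ, Real.exp (-v * (n : ℝ) ^ 2) := by
  set a : ℝ := Real.pi / v with ha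
  have hapos : 0 < a := by positivity
  have hare : 0 < (a : ℂ).re := by simpa using hapos
  have hva : Real.pi / a = v := by
    rw [ha]
    field_simp
  -- Poisson summation writes the periodized Gaussian at `x` as a multiple of a character series
  -- whose terms have moduli independent of `x`.
  have key : ∀ x : ℝ, ∑' n : ℤ, Complex.exp (-Real.pi * a * n ^ 2 +
        2 * Real.pi * (Complex.I * x) * n) =
      1 / (a : ℂ) ^ (1 / 2 : ℂ) * ((∑' n : ℤ, Real.exp (-v * (n - x) ^ 2) : ℝ) : ℂ) := by
    intro x
    rw [Complex.tsum_exp_neg_quadratic hare (Complex.I * x), Complex.ofReal_tsum]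
    congr 1
    refine tsum_congr fun n => ?_
    rw [Complex.ofReal_exp]
    congr 1
    have : (-(Real.pi : ℂ) / a) = ((-v : ℝ) : ℂ) := by
      rw [← hva]
      push_cast
      ring
    rw [this]
    push_cast
    rw [show (n : ℂ) + Complex.I * (Complex.I * x) = n - x by
      rw [← mul_assoc, Complex.I_mul_I]; ring]
  have hnorm : ∀ (x : ℝ) (n : ℤ), ‖Complex.exp (-Real.pi * a * n ^ 2 +
      2 * Real.pi * (Complex.I * x) * n)‖ = Real.exp (-(Real.pi * a) * (n - 0) ^ 2) := by
    intro x n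
    rw [Complex.norm_exp]
    congr 1
    have : (-(Real.pi : ℂ) * a * n ^ 2 + 2 * Real.pi * (Complex.I * x) * n) =
        ((-(Real.pi * a) * (n - 0) ^ 2 : ℝ) : ℂ) + ((2 * Real.pi * x * n : ℝ) : ℂ) * Complex.I := by
      push_cast
      ring
    rw [this, Complex.add_re, Complex.ofReal_re, Complex.re_ofReal_mul, Complex.I_re, mul_zero,
      add_zero]
  have hC : 0 < ‖1 / (a : ℂ) ^ (1 / 2 : ℂ)‖ := by
    rw [norm_pos_iff]
    refine one_div_ne_zero ?_
    rw [Complex.cpow_ne_zero_iff_of_exponent_ne_zero (by norm_num)]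
    exact_mod_cast hapos.ne'
  have hnn : ∀ x : ℝ, 0 ≤ ∑' n : ℤ, Real.exp (-v * (n - x) ^ 2) := fun x =>
    tsum_nonneg fun n => (Real.exp_pos _).le
  have h1 := congrArg norm (key y)
  have h0 := key 0
  have hreal : ∑' n : ℤ, Complex.exp (-Real.pi * a * n ^ 2 +
      2 * Real.pi * (Complex.I * (0 : ℝ)) * n) =
      ((∑' n : ℤ, Real.exp (-(Real.pi * a) * (n - 0) ^ 2) : ℝ) : ℂ) := by
    rw [Complex.ofReal_tsum]
    refine tsum_congr fun n => ?_
    rw [Complex.ofReal_exp]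
    congr 1
    push_cast
    ring
  rw [hreal] at h0
  have h0' := congrArg norm h0
  rw [norm_mul, Complex.norm_real, Complex.norm_real, Real.norm_of_nonneg (hnn 0),
    Real.norm_of_nonneg (tsum_nonneg fun n => (Real.exp_pos _).le)] at h0'
  rw [norm_mul, Complex.norm_real, Real.norm_of_nonneg (hnn y)] at h1
  have hs : Summable fun n : ℤ => ‖Complex.exp (-Real.pi * a * n ^ 2 +
      2 * Real.pi * (Complex.I * y) * n)‖ := by
    simp_rw [hnorm y]
    simpa using summable_exp_neg_mul_int_sub_sq (by positivity : 0 < Real.pi * a) 0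
  -- The triangle inequality for the series at `y`; at `0` all terms are positive, so the sum of
  -- moduli is the value there.
  have h2 := norm_tsum_le_tsum_norm hs
  simp_rw [hnorm y] at h2
  rw [h1, h0'] at h2
  have h3 := le_of_mul_le_mul_left h2 hC
  simpa using h3

lemma tsum_ofReal_exp_neg_mul_int_sub_sq_le {v : ℝ} (hv : 0 < v) (y : ℝ) :
    ∑' n : ℤ, ENNReal.ofReal (Real.exp (-v * (n - y) ^ 2)) ≤
      ∑' n : ℤ, ENNReal.ofReal (Real.exp (-v * (n : ℝ) ^ 2)) := by
  rw [← ENNReal.ofReal_tsum_of_nonneg (fun n => (Real.exp_pos _).le)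
      (summable_exp_neg_mul_int_sub_sq hv y),
    ← ENNReal.ofReal_tsum_of_nonneg (fun n => (Real.exp_pos _).le)
      (by simpa using summable_exp_neg_mul_int_sub_sq hv 0)]
  exact ENNReal.ofReal_le_ofReal (tsum_exp_neg_mul_int_sub_sq_le hv y)

/-- The sum of a product function over a finite product is the product of the sums. -/
lemma tsum_pi_prod {d : ℕ} {κ : Type*} (g : Fin d → κ → ℝ≥0∞) :
    ∑' k : Fin d → κ, ∏ i, g i (k i) = ∏ i, ∑' n, g i n := by
  induction d with
  | zero => simp
  | succ d ih =>
    rw [← (Fin.consEquiv fun _ => κ).tsum_eq, Fin.prod_univ_succ, ← ih fun i => g i.succ,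
      ← ENNReal.tsum_mul_right]
    simp_rw [Fin.consEquiv_apply, Fin.prod_univ_succ, Fin.cons_zero, Fin.cons_succ]
    rw [ENNReal.tsum_prod (f := fun a (b : Fin d → κ) => g 0 a * ∏ i, g (Fin.succ i) (b i))]
    simp_rw [ENNReal.tsum_mul_left]

/-- A periodized Gaussian on `ℝ^d` is largest at the lattice points. -/
lemma tsum_pi_ofReal_exp_neg_le {d : ℕ} {v : ℝ} (hv : 0 < v) (y : Fin d → ℝ) :
    ∑' k : Fin d → ℤ, ENNReal.ofReal (Real.exp (-v * ∑ i, (k i - y i) ^ 2)) ≤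
      ∑' k : Fin d → ℤ, ENNReal.ofReal (Real.exp (-v * ∑ i, (k i : ℝ) ^ 2)) := by
  have h : ∀ x : Fin d → ℝ, ∑' k : Fin d → ℤ,
      ENNReal.ofReal (Real.exp (-v * ∑ i, (k i - x i) ^ 2)) =
      ∏ i, ∑' n : ℤ, ENNReal.ofReal (Real.exp (-v * (n - x i) ^ 2)) := by
    intro x
    rw [← tsum_pi_prod]
    refine tsum_congr fun k => ?_
    rw [Finset.mul_sum, Real.exp_sum, ENNReal.ofReal_prod_of_nonneg fun i _ => (Real.exp_pos _).le]
  have h0 := h fun _ => 0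
  simp only [sub_zero] at h0
  rw [h y, h0]
  exact Finset.prod_le_prod' fun i _ => tsum_ofReal_exp_neg_mul_int_sub_sq_le hv (y i)

/-- Glasser's substitution for the Gaussian integral. -/
lemma lintegral_exp_neg_sub_inv_sq {a b : ℝ} (ha : 0 < a) (hb : 0 < b) :
    ∫⁻ w in Set.Ioi (0 : ℝ), ENNReal.ofReal (Real.exp (-(a * w - b / w) ^ 2)) =
      ENNReal.ofReal (√Real.pi / (2 * a)) := by
  set F : ℝ → ℝ≥0∞ := fun x => ENNReal.ofReal (Real.exp (-x ^ 2)) with hF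
  have hFm : Measurable F := by fun_prop
  set φ : ℝ → ℝ := fun w => a * w - b / w with hφ
  set I := ∫⁻ w in Set.Ioi (0 : ℝ), F (φ w) with hI
  have hG : ∫⁻ x, F x = ENNReal.ofReal √Real.pi := by
    have h := integral_gaussian 1
    simp only [neg_mul, one_mul, div_one] at h
    rw [← h, ofReal_integral_eq_lintegral_ofReal
      (by simpa using integrable_exp_neg_mul_sq (b := 1) one_pos)
      (ae_of_all _ fun x => (Real.exp_pos _).le)]
  have hd1 : ∀ w ∈ Set.Ioi (0 : ℝ), HasDerivWithinAt φ (a + b / w ^ 2) (Set.Ioi 0) w := by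
    intro w hw
    have hw : (0 : ℝ) < w := hw
    have h := ((hasDerivAt_id w).const_mul a).sub ((hasDerivAt_inv hw.ne').const_mul b)
    have h' : HasDerivAt φ (a * 1 - b * (-(w ^ 2)⁻¹)) w := by
      refine h.congr_of_eventuallyEq (Filter.Eventually.of_forall fun x => ?_)
      simp [hφ, div_eq_mul_inv]
    exact (h'.congr_deriv (by ring)).hasDerivWithinAt
  have hmono : StrictMonoOn φ (Set.Ioi 0) := by
    intro x hx y hy hxy
    have hx : (0 : ℝ) < x := hx
    have : b / y < b / x := div_lt_div_of_pos_left hb hx hxy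
    simp only [hφ]
    nlinarith
  have himg1 : φ '' Set.Ioi 0 = Set.univ := by
    -- The preimage of `x` is the positive root of `a w² - x w - b = 0`.
    refine Set.eq_univ_of_forall fun x => ?_
    have hdisc : 0 ≤ x ^ 2 + 4 * a * b := by positivity
    have hsq := Real.sq_sqrt hdisc
    have hlt : |x| < √(x ^ 2 + 4 * a * b) := by
      rw [← Real.sqrt_sq_eq_abs]
      refine Real.sqrt_lt_sqrt (sq_nonneg _) ?_
      have : 0 < 4 * a * b := by positivity
      linarith
    have hpos : 0 < x + √(x ^ 2 + 4 * a * b) := by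
      have := neg_abs_le x
      linarith
    generalize √(x ^ 2 + 4 * a * b) = R at hsq hpos
    refine ⟨(x + R) / (2 * a), div_pos hpos (by positivity), ?_⟩
    have hbw : b / ((x + R) / (2 * a)) = (R - x) / 2 := by
      rw [div_eq_iff (by positivity)]
      field_simp
      nlinarith
    simp only [hφ]
    rw [hbw]
    field_simp
    ring
  -- The substitution `x = a w - b/w` has derivative `a + b/w²`, which splits the Gaussian integral
  -- into two parts. They turn out to be equal.
  have h1 : ∫⁻ x, F x = ENNReal.ofReal a * I +
      ∫⁻ w in Set.Ioi (0 : ℝ), ENNReal.ofReal (b / w ^ 2) * F (φ w) := by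
    rw [← setLIntegral_univ F, ← himg1, lintegral_image_eq_lintegral_deriv_mul_of_monotoneOn
      measurableSet_Ioi hd1 hmono.monotoneOn F, hI,
      ← lintegral_const_mul' _ _ ENNReal.ofReal_ne_top]
    rw [← lintegral_add_left (by fun_prop)]
    refine lintegral_congr fun w => ?_
    rw [ENNReal.ofReal_add ha.le (by positivity), add_mul]
  -- The map `w ↦ b/(a w)` changes the sign of `a w - b/w`. Since `F` is even, it exchanges the two
  -- parts.
  set χ : ℝ → ℝ := fun w => b / (a * w) with hχ
  have hd2 : ∀ w ∈ Set.Ioi (0 : ℝ), HasDerivWithinAt χ (-(b / (a * w ^ 2))) (Set.Ioi 0) w := by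
    intro w hw
    have hw : (0 : ℝ) < w := hw
    have h := (hasDerivAt_inv hw.ne').const_mul (b / a)
    have h' : HasDerivAt χ (b / a * (-(w ^ 2)⁻¹)) w := by
      refine h.congr_of_eventuallyEq (Filter.Eventually.of_forall fun x => ?_)
      simp only [hχ]
      rw [div_mul_eq_div_div, div_eq_mul_inv]
    exact (h'.congr_deriv (by field_simp)).hasDerivWithinAt
  have hanti : AntitoneOn χ (Set.Ioi 0) := by
    intro x hx y hy hxy
    have hx : (0 : ℝ) < x := hx
    simp only [hχ]
    gcongr
  have himg2 : χ '' Set.Ioi 0 = Set.Ioi 0 := by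
    ext x
    constructor
    · rintro ⟨w, hw, rfl⟩
      have hw : (0 : ℝ) < w := hw
      exact div_pos hb (mul_pos ha hw)
    · intro hx
      have hx : (0 : ℝ) < x := hx
      refine ⟨b / (a * x), div_pos hb (mul_pos ha hx), ?_⟩
      simp only [hχ]
      field_simp
  have h2 : ENNReal.ofReal a * I =
      ∫⁻ w in Set.Ioi (0 : ℝ), ENNReal.ofReal (b / w ^ 2) * F (φ w) := by
    rw [hI]
    conv_lhs => rw [← himg2]
    rw [lintegral_image_eq_lintegral_deriv_mul_of_antitoneOn measurableSet_Ioi hd2 hanti,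
      ← lintegral_const_mul' _ _ ENNReal.ofReal_ne_top]
    refine setLIntegral_congr_fun measurableSet_Ioi fun w hw => ?_
    have hw : (0 : ℝ) < w := hw
    have hφχ : φ (χ w) = -φ w := by
      simp only [hφ, hχ]
      field_simp
      ring
    have hFe : F (φ (χ w)) = F (φ w) := by
      rw [hφχ]
      simp [hF]
    simp only [hFe]
    rw [← mul_assoc, ← ENNReal.ofReal_mul ha.le]
    congr 2
    field_simp
  rw [hG, ← h2, ← two_mul, ← mul_assoc] at h1
  have h2a : (2 : ℝ≥0∞) * ENNReal.ofReal a = ENNReal.ofReal (2 * a) := by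
    rw [ENNReal.ofReal_mul (by norm_num), ENNReal.ofReal_ofNat]
  rw [h2a] at h1
  rw [ENNReal.ofReal_div_of_pos (by positivity), h1, mul_comm, ENNReal.mul_div_cancel_right]
  · exact (ENNReal.ofReal_pos.2 (by positivity)).ne'
  · exact ENNReal.ofReal_ne_top

/-- The exponential `e^{-u r}` as a mixture of Gaussians in `r`. -/
lemma ofReal_exp_neg_mul_eq_lintegral {u r : ℝ} (hu : 0 < u) (hr : 0 ≤ r) :
    ENNReal.ofReal (Real.exp (-(u * r))) =
      ∫⁻ w in Set.Ioi (0 : ℝ), ENNReal.ofReal (u / √Real.pi * Real.exp (-(u * w / 2) ^ 2)) *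
        ENNReal.ofReal (Real.exp (-(1 / w ^ 2) * r ^ 2)) := by
  have hpi : 0 < √Real.pi := Real.sqrt_pos.2 Real.pi_pos
  have hu2 : 0 < u / 2 := by positivity
  have hcore : ∫⁻ w in Set.Ioi (0 : ℝ), ENNReal.ofReal (Real.exp (-(u * w / 2) ^ 2)) *
        ENNReal.ofReal (Real.exp (-(1 / w ^ 2) * r ^ 2)) =
      ENNReal.ofReal (√Real.pi / u * Real.exp (-(u * r))) := by
    -- For `r > 0` the identity `(uw/2)² + r²/w² = (uw/2 - r/w)² + u r` reduces the claim to
    -- Glasser's substitution. That substitution needs `r > 0`, so `r = 0` is the half-line Gaussian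
    -- integral.
    rcases hr.eq_or_lt with rfl | hr
    · have h := integral_gaussian_Ioi ((u / 2) ^ 2)
      have hu4 : √(Real.pi / (u / 2) ^ 2) / 2 = √Real.pi / u := by
        rw [Real.sqrt_div Real.pi_pos.le, Real.sqrt_sq hu2.le]
        field_simp
      simp only [mul_zero, neg_zero, Real.exp_zero, mul_one, ENNReal.ofReal_one, ne_eq,
        OfNat.ofNat_ne_zero, not_false_eq_true, zero_pow]
      rw [← hu4, ← h, ofReal_integral_eq_lintegral_ofReal
        (integrable_exp_neg_mul_sq (by positivity)).integrableOn
        (ae_of_all _ fun x => (Real.exp_pos _).le)]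
      refine lintegral_congr fun w => ?_
      congr 2
      ring
    · have h := lintegral_exp_neg_sub_inv_sq hu2 hr
      rw [show √Real.pi / (2 * (u / 2)) = √Real.pi / u by ring] at h
      rw [mul_comm, ENNReal.ofReal_mul (Real.exp_pos _).le, ← h,
        ← lintegral_const_mul' _ _ ENNReal.ofReal_ne_top]
      refine setLIntegral_congr_fun measurableSet_Ioi fun w hw => ?_
      have hw : (0 : ℝ) < w := hw
      rw [← ENNReal.ofReal_mul (Real.exp_pos _).le, ← ENNReal.ofReal_mul (Real.exp_pos _).le,
        ← Real.exp_add, ← Real.exp_add]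
      congr 2
      field_simp
      ring
  simp_rw [ENNReal.ofReal_mul (show 0 ≤ u / √Real.pi by positivity), mul_assoc]
  rw [lintegral_const_mul' _ _ ENNReal.ofReal_ne_top, hcore, ← ENNReal.ofReal_mul (by positivity)]
  congr 1
  field_simp

/-- Gamma-integral representation of `(1 + r)^{-t}`. -/
lemma ofReal_one_add_rpow_neg_eq_lintegral {t r : ℝ} (ht : 0 < t) (hr : 0 ≤ r) :
    ENNReal.ofReal (1 / (1 + r) ^ t) =
      ∫⁻ u in Set.Ioi (0 : ℝ), ENNReal.ofReal (u ^ (t - 1) * Real.exp (-u) / Real.Gamma t) *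
        ENNReal.ofReal (Real.exp (-(u * r))) := by
  have hΓ := Real.Gamma_pos_of_pos ht
  have h1r : 0 < 1 + r := by linarith
  have h := Real.integral_rpow_mul_exp_neg_mul_Ioi ht h1r
  have hint : IntegrableOn (fun u : ℝ => u ^ (t - 1) * Real.exp (-((1 + r) * u)))
      (Set.Ioi 0) := by
    by_contra hcon
    rw [integral_undef hcon] at h
    have : 0 < (1 / (1 + r)) ^ t * Real.Gamma t := by positivity
    linarith
  have h2 : 1 / (1 + r) ^ t =
      ∫ u in Set.Ioi (0 : ℝ), u ^ (t - 1) * Real.exp (-((1 + r) * u)) / Real.Gamma t := by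
    rw [integral_div, h, Real.div_rpow zero_le_one h1r.le, Real.one_rpow]
    field_simp
  rw [h2, ofReal_integral_eq_lintegral_ofReal (hint.div_const _)]
  · refine setLIntegral_congr_fun measurableSet_Ioi fun u hu => ?_
    have hu : (0 : ℝ) < u := hu
    rw [← ENNReal.ofReal_mul (by positivity)]
    congr 1
    rw [show -((1 + r) * u) = -u + -(u * r) by ring, Real.exp_add]
    ring
  · refine (ae_restrict_iff' measurableSet_Ioi).2 (ae_of_all _ fun u hu => ?_)
    have hu : (0 : ℝ) < u := hu
    have : 0 ≤ u ^ (t - 1) * Real.exp (-((1 + r) * u)) / Real.Gamma t := by positivity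
    exact this

/-- The periodization of `(1 + |y|)^{-t}` on `ℝ^d` is largest at the lattice points. -/
lemma tsum_one_add_norm_sub_rpow_le {d : ℕ} {t : ℝ} (ht : 0 < t) (y : EuclideanSpace ℝ (Fin d)) :
    ∑' k : Fin d → ℤ, ENNReal.ofReal
        (1 / (1 + ‖y - WithLp.toLp 2 (fun i => (k i : ℝ))‖) ^ t) ≤
      ∑' k : Fin d → ℤ, ENNReal.ofReal
        (1 / (1 + ‖(WithLp.toLp 2 (fun i => (k i : ℝ)) : EuclideanSpace ℝ (Fin d))‖) ^ t) := by
  -- The periodization is a superposition, with positive weights that do not depend on `x`, of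
  -- periodized Gaussians, so it suffices to compare the latter. They factor over the coordinates.
  have hrep : ∀ x : EuclideanSpace ℝ (Fin d), ∑' k : Fin d → ℤ, ENNReal.ofReal
        (1 / (1 + ‖x - WithLp.toLp 2 (fun i => (k i : ℝ))‖) ^ t) =
      ∫⁻ u in Set.Ioi (0 : ℝ), ENNReal.ofReal (u ^ (t - 1) * Real.exp (-u) / Real.Gamma t) *
        ∫⁻ w in Set.Ioi (0 : ℝ), ENNReal.ofReal (u / √Real.pi * Real.exp (-(u * w / 2) ^ 2)) *
          ∑' k : Fin d → ℤ, ENNReal.ofReal (Real.exp (-(1 / w ^ 2) * ∑ i, (k i - x i) ^ 2)) := by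
    intro x
    have hsq : ∀ k : Fin d → ℤ, ‖x - WithLp.toLp 2 (fun i => (k i : ℝ))‖ ^ 2 =
        ∑ i, (k i - x i) ^ 2 := by
      intro k
      rw [EuclideanSpace.norm_sq_eq]
      refine Finset.sum_congr rfl fun i _ => ?_
      simp only [PiLp.sub_apply, Real.norm_eq_abs, sq_abs]
      ring
    simp_rw [fun k : Fin d → ℤ => ofReal_one_add_rpow_neg_eq_lintegral ht
      (norm_nonneg (x - WithLp.toLp 2 (fun i => (k i : ℝ))))]
    rw [← lintegral_tsum fun k => by fun_prop]
    refine setLIntegral_congr_fun measurableSet_Ioi fun u hu => ?_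
    have hu : (0 : ℝ) < u := hu
    rw [ENNReal.tsum_mul_left]
    congr 1
    simp_rw [fun k : Fin d → ℤ => ofReal_exp_neg_mul_eq_lintegral hu
      (norm_nonneg (x - WithLp.toLp 2 (fun i => (k i : ℝ)))), hsq]
    rw [← lintegral_tsum fun k => by fun_prop]
    simp_rw [ENNReal.tsum_mul_left]
  have h0 := hrep 0
  simp only [zero_sub, norm_neg, PiLp.zero_apply, sub_zero] at h0
  rw [hrep y, h0]
  refine lintegral_mono fun u => ?_
  refine mul_le_mul_right (setLIntegral_mono' measurableSet_Ioi fun w hw => ?_) _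
  have hw : (0 : ℝ) < w := hw
  exact mul_le_mul_right (tsum_pi_ofReal_exp_neg_le (by positivity) _) _

end GaussianMixture

end RandomAverageSampling

namespace RandomAverageSampling

/-! ### Lattice sums with polynomial decay -/

section LatticeSums

/-- Integral comparison for a decreasing function. The sum starts at `x + 1`, so the integral may
start at `x`, without an extra boundary term. -/
lemma tsum_add_succ_rpow_le {x τ : ℝ} (hx : 0 < x) (hτ : 1 < τ) :
    ∑' i : ℕ, ENNReal.ofReal (1 / (x + ((i + 1 : ℕ) : ℝ)) ^ τ) ≤
      ENNReal.ofReal (1 / (x ^ (τ - 1) * (τ - 1))) := by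
  refine ENNReal.tsum_le_of_sum_range_le fun n => ?_
  rw [← ENNReal.ofReal_sum_of_nonneg fun i _ => by positivity]
  refine ENNReal.ofReal_le_ofReal ?_
  have hanti : AntitoneOn (fun u : ℝ => u ^ (-τ)) (Set.Icc x (x + n)) := by
    intro u hu v hv huv
    exact Real.rpow_le_rpow_of_nonpos (hx.trans_le hu.1) huv (by linarith)
  have h := hanti.sum_le_integral
  rw [integral_rpow (Or.inr ⟨by linarith, by
    rw [Set.uIcc_of_le (by linarith [(Nat.cast_nonneg n : (0 : ℝ) ≤ n)])]
    exact fun h0 => absurd h0.1 (not_le.2 hx)⟩)] at h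
  have hterm : ∀ i : ℕ, 1 / (x + ((i + 1 : ℕ) : ℝ)) ^ τ = (x + ((i + 1 : ℕ) : ℝ)) ^ (-τ) := by
    intro i
    rw [Real.rpow_neg (by positivity), one_div]
  simp_rw [hterm]
  refine h.trans ?_
  have h1 : 0 ≤ (x + n) ^ (-τ + 1) := by positivity
  have h2 : x ^ (-τ + 1) = 1 / x ^ (τ - 1) := by
    rw [show -τ + 1 = -(τ - 1) by ring, Real.rpow_neg hx.le, one_div]
  have h3 : 0 < τ - 1 := by linarith
  rw [h2] at *
  calc ((x + n) ^ (-τ + 1) - 1 / x ^ (τ - 1)) / (-τ + 1)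
      = (1 / x ^ (τ - 1) - (x + n) ^ (-τ + 1)) / (τ - 1) := by
        rw [show -τ + 1 = -(τ - 1) by ring, div_neg, ← neg_div, neg_sub]
    _ ≤ (1 / x ^ (τ - 1)) / (τ - 1) := by
        gcongr
        linarith
    _ = _ := by rw [div_div]

/-- The integer points of maximum norm `j`. -/
noncomputable def shell (d j : ℕ) : Finset (Fin d → ℤ) :=
  (Fintype.piFinset fun _ => Finset.Icc (-(j : ℤ)) j) \
    Fintype.piFinset fun _ => Finset.Icc (-(j : ℤ) + 1) (j - 1)

/-- Bernoulli's inequality for `(1 - 2/(2j+1))^d` bounds the difference of the two cube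
cardinalities. -/
lemma card_shell_le {d j : ℕ} (hd : 1 ≤ d) (hj : 1 ≤ j) :
    ((shell d j).card : ℝ) ≤ 2 * d * (2 * j + 1) ^ (d - 1) := by
  have hsub : (Fintype.piFinset fun _ : Fin d => Finset.Icc (-(j : ℤ) + 1) (j - 1)) ⊆
      Fintype.piFinset fun _ : Fin d => Finset.Icc (-(j : ℤ)) j :=
    Fintype.piFinset_subset _ _ fun _ => Finset.Icc_subset_Icc (by omega) (by omega)
  have hc1 : ((j : ℤ) + 1 - -(j : ℤ)).toNat = 2 * j + 1 := by omega
  have hc2 : ((j : ℤ) - 1 + 1 - (-(j : ℤ) + 1)).toNat = 2 * j - 1 := by omega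
  rw [shell, Finset.card_sdiff_of_subset hsub, Fintype.card_piFinset_const,
    Fintype.card_piFinset_const, Int.card_Icc, Int.card_Icc, hc1, hc2]
  have hle : (2 * j - 1) ^ d ≤ (2 * j + 1) ^ d := Nat.pow_le_pow_left (by omega) d
  rw [Nat.cast_sub hle]
  push_cast [Nat.cast_sub (show 1 ≤ 2 * j by omega)]
  have hj' : (1 : ℝ) ≤ j := by exact_mod_cast hj
  have ha : (0 : ℝ) < 2 * j + 1 := by linarith
  have hB := one_add_mul_le_pow (a := -2 / (2 * (j : ℝ) + 1)) (by
    rw [le_div_iff₀ ha]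
    linarith) d
  have hdiv : 1 + -2 / (2 * (j : ℝ) + 1) = (2 * j - 1) / (2 * j + 1) := by
    field_simp
    ring
  rw [hdiv, div_pow, le_div_iff₀ (by positivity)] at hB
  have hpow : (2 * (j : ℝ) + 1) ^ d = (2 * j + 1) ^ (d - 1) * (2 * j + 1) := by
    rw [← pow_succ, Nat.sub_add_cancel hd]
  have h2 : (1 + d * (-2 / (2 * (j : ℝ) + 1))) * (2 * j + 1) ^ d =
      (2 * j + 1) ^ d - 2 * d * (2 * j + 1) ^ (d - 1) := by
    rw [hpow]
    field_simp
    ring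
  linarith

/-- The maximum norm of an integer point is a natural number, which determines its shell. -/
lemma exists_mem_shell {d : ℕ} (k : Fin d → ℤ) (hk : 0 < ‖k‖) :
    ∃ j : ℕ, (j : ℝ) = ‖k‖ ∧ k ∈ shell d j := by
  set j : ℕ := Finset.univ.sup fun i => (k i).natAbs with hj
  have hle : ∀ i, (k i).natAbs ≤ j := fun i =>
    Finset.le_sup (f := fun i => (k i).natAbs) (Finset.mem_univ i)
  have hcast : ∀ i, (((k i).natAbs : ℕ) : ℝ) = ‖k i‖ := fun i => by
    rw [Int.norm_eq_abs, Nat.cast_natAbs, Int.cast_abs]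
  have hnorm : (j : ℝ) = ‖k‖ := by
    refine le_antisymm ?_ ?_
    · have : j ≤ ⌊‖k‖⌋₊ := Finset.sup_le fun i _ => Nat.le_floor <| by
        rw [hcast]
        exact norm_le_pi_norm k i
      exact (Nat.cast_le.2 this).trans (Nat.floor_le (norm_nonneg _))
    · refine (pi_norm_le_iff_of_nonneg (Nat.cast_nonneg j)).2 fun i => ?_
      rw [← hcast]
      exact_mod_cast hle i
  have hjpos : 0 < j := by
    rw [← hnorm] at hk
    exact_mod_cast hk
  refine ⟨j, hnorm, ?_⟩
  rw [shell, Finset.mem_sdiff, Fintype.mem_piFinset, Fintype.mem_piFinset]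
  refine ⟨fun i => ?_, fun h => ?_⟩
  · rw [Finset.mem_Icc]
    have := hle i
    omega
  · have : j ≤ j - 1 := by
      conv_lhs => rw [hj]
      refine Finset.sup_le fun i _ => ?_
      have := Finset.mem_Icc.1 (h i)
      omega
    omega

/-- Tail bound for lattice sums with polynomial decay. -/
lemma tsum_tail_le {d N : ℕ} {κ t : ℝ} (hd : 1 ≤ d) (ht : d < t) (hκ : 0 ≤ κ) (hN : κ ≤ N) :
    ∑' k : Fin d → ℤ, (if (N : ℝ) < ‖k‖ then ENNReal.ofReal (1 / (1 + ‖k‖ - κ) ^ t) else 0) ≤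
      ENNReal.ofReal (2 ^ d * d * (1 + κ) ^ ((d : ℝ) - 1) /
        ((1 + N - κ) ^ (t - d) * (t - d))) := by
  classical
  set G : ℕ → ℝ≥0∞ := fun j => ENNReal.ofReal (1 / (1 + (j : ℝ) - κ) ^ t) with hG
  have hM : 0 < 1 + N - κ := by linarith
  have h1 : ∀ k : Fin d → ℤ,
      (if (N : ℝ) < ‖k‖ then ENNReal.ofReal (1 / (1 + ‖k‖ - κ) ^ t) else 0) ≤
        ∑' i : ℕ, if k ∈ shell d (N + 1 + i) then G (N + 1 + i) else 0 := by
    intro k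
    split_ifs with hk
    · obtain ⟨j, hj, hmem⟩ := exists_mem_shell k (lt_of_le_of_lt (Nat.cast_nonneg N) hk)
      have hNj : N < j := by
        rw [← hj] at hk
        exact_mod_cast hk
      obtain ⟨i, rfl⟩ : ∃ i, j = N + 1 + i := ⟨j - (N + 1), by omega⟩
      refine le_trans ?_ (ENNReal.le_tsum i)
      rw [if_pos hmem, hG, ← hj]
    · exact zero_le
  have h2 : ∀ j : ℕ, ∑' k : Fin d → ℤ, (if k ∈ shell d j then G j else 0) =
      ((shell d j).card : ℝ≥0∞) * G j := by
    intro j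
    rw [tsum_eq_sum (s := shell d j) fun k hk => if_neg hk, Finset.sum_congr rfl fun k hk => if_pos hk,
      Finset.sum_const, nsmul_eq_mul]
  set C : ℝ := 2 ^ d * d * (1 + κ) ^ ((d : ℝ) - 1) with hC
  have hCnn : 0 ≤ C := by positivity
  have h3 : ∀ i : ℕ, ((shell d (N + 1 + i)).card : ℝ≥0∞) * G (N + 1 + i) ≤
      ENNReal.ofReal C * ENNReal.ofReal (1 / (1 + N - κ + ((i + 1 : ℕ) : ℝ)) ^ (t - d + 1)) := by
    intro i
    rw [← ENNReal.ofReal_natCast, hG, ← ENNReal.ofReal_mul (by positivity),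
      ← ENNReal.ofReal_mul hCnn]
    refine ENNReal.ofReal_le_ofReal ?_
    set j := N + 1 + i with hj
    have hjN : (j : ℝ) = N + 1 + i := by rw [hj]; push_cast; ring
    have hi0 : (0 : ℝ) ≤ i := Nat.cast_nonneg i
    have hpos : 0 < 1 + (j : ℝ) - κ := by rw [hjN]; linarith
    have hbase : 1 + N - κ + ((i + 1 : ℕ) : ℝ) = 1 + (j : ℝ) - κ := by
      rw [hjN]; push_cast; ring
    rw [hbase]
    have hcard := card_shell_le hd (show 1 ≤ j by omega)
    -- `(1+κ)(1+j-κ) = 1 + j + κ(j-κ)`: passing to the shifted base `1+j-κ` costs only the factor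
    -- `1+κ`, which produces the power of `1+κ` in the thresholds.
    have h2j : 2 * (j : ℝ) + 1 ≤ 2 * (1 + κ) * (1 + j - κ) := by
      have : 0 ≤ κ * ((j : ℝ) - κ) := mul_nonneg hκ (by rw [hjN]; linarith)
      nlinarith
    have hd1 : ((d - 1 : ℕ) : ℝ) = (d : ℝ) - 1 := by
      rw [Nat.cast_sub hd, Nat.cast_one]
    have h2d : (2 : ℝ) ^ d = 2 * 2 ^ (d - 1) := by
      rw [← pow_succ', Nat.sub_add_cancel hd]
    calc ((shell d j).card : ℝ) * (1 / (1 + j - κ) ^ t)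
        ≤ (2 * d * (2 * (1 + κ) * (1 + j - κ)) ^ (d - 1)) * (1 / (1 + j - κ) ^ t) := by
          gcongr
          exact hcard.trans (by gcongr)
      _ = C * (1 / (1 + j - κ) ^ (t - d + 1)) := by
          rw [hC, ← hd1, Real.rpow_natCast, mul_pow, mul_pow, h2d,
            show t = (t - d + 1) + ((d - 1 : ℕ) : ℝ) by rw [hd1]; ring, Real.rpow_add hpos,
            Real.rpow_natCast]
          rw [show t - d + 1 + ((d - 1 : ℕ) : ℝ) - d + 1 = t - d + 1 by rw [hd1]; ring]
          field_simp
  calc ∑' k : Fin d → ℤ, (if (N : ℝ) < ‖k‖ then ENNReal.ofReal (1 / (1 + ‖k‖ - κ) ^ t) else 0)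
      ≤ ∑' k : Fin d → ℤ, ∑' i : ℕ,
          (if k ∈ shell d (N + 1 + i) then G (N + 1 + i) else 0) := ENNReal.tsum_le_tsum h1
    _ = ∑' i : ℕ, ((shell d (N + 1 + i)).card : ℝ≥0∞) * G (N + 1 + i) := by
        rw [ENNReal.tsum_comm]
        exact tsum_congr fun i => h2 _
    _ ≤ ∑' i : ℕ, ENNReal.ofReal C *
          ENNReal.ofReal (1 / (1 + N - κ + ((i + 1 : ℕ) : ℝ)) ^ (t - d + 1)) :=
        ENNReal.tsum_le_tsum h3
    _ ≤ ENNReal.ofReal C * ENNReal.ofReal (1 / ((1 + N - κ) ^ (t - d + 1 - 1) *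
          (t - d + 1 - 1))) := by
        rw [ENNReal.tsum_mul_left]
        exact mul_le_mul_right (tsum_add_succ_rpow_le hM (by linarith)) _
    _ = _ := by
        rw [← ENNReal.ofReal_mul hCnn, add_sub_cancel_right, mul_one_div]

lemma tsum_one_add_norm_rpow_lt_top {d : ℕ} {t : ℝ} (hd : 1 ≤ d) (ht : d < t) :
    ∑' k : Fin d → ℤ, ENNReal.ofReal (1 / (1 + ‖k‖) ^ t) < ∞ := by
  classical
  rw [ENNReal.tsum_eq_add_tsum_ite (0 : Fin d → ℤ)]
  refine ENNReal.add_lt_top.2 ⟨ENNReal.ofReal_lt_top, ?_⟩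
  have h := tsum_tail_le (N := 0) (κ := 0) hd ht le_rfl (by simp)
  refine lt_of_le_of_lt (le_trans (ENNReal.tsum_le_tsum fun k => ?_) h) ENNReal.ofReal_lt_top
  by_cases hk : k = 0
  · simp [hk]
  · rw [if_neg hk, if_pos (by simpa using hk), sub_zero]

/-- Passage from integers to one-dimensional integer vectors. -/
lemma tsum_int_eq_tsum_pi (g : ℝ → ℝ≥0∞) (f : ℤ → ℝ≥0∞) (hf : ∀ k : ℤ, f k = g |(k : ℝ)|) :
    ∑' k : ℤ, f k = ∑' k : Fin 1 → ℤ, g ‖k‖ := by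
  rw [← (Equiv.funUnique (Fin 1) ℤ).symm.tsum_eq]
  refine tsum_congr fun k => ?_
  rw [hf]
  congr 1
  rw [← Int.norm_eq_abs]
  exact (pi_norm_const (ι := Fin 1) k).symm

lemma tsum_one_add_abs_rpow_lt_top {t : ℝ} (ht : 1 < t) :
    ∑' k : ℤ, ENNReal.ofReal (1 / (1 + |(k : ℝ)|) ^ t) < ∞ := by
  rw [tsum_int_eq_tsum_pi (fun x => ENNReal.ofReal (1 / (1 + x) ^ t)) _ fun k => rfl]
  exact tsum_one_add_norm_rpow_lt_top le_rfl (by simpa using ht)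

lemma tsum_int_tail_le {N : ℕ} {κ t : ℝ} (ht : 1 < t) (hκ : 0 ≤ κ) (hN : κ ≤ N) :
    ∑' k : ℤ, (if (N : ℝ) < |(k : ℝ)| then
        ENNReal.ofReal (1 / (1 + |(k : ℝ)| - κ) ^ t) else 0) ≤
      ENNReal.ofReal (2 / ((1 + N - κ) ^ (t - 1) * (t - 1))) := by
  rw [tsum_int_eq_tsum_pi (fun x => if (N : ℝ) < x then
        ENNReal.ofReal (1 / (1 + x - κ) ^ t) else 0) _ fun k => rfl]
  refine (tsum_tail_le le_rfl (by simpa using ht) hκ hN).trans_eq ?_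
  simp

/-- The sum over a shifted lattice is at most twice the sum over the lattice. -/
lemma tsum_one_add_abs_sub_rpow_le {t : ℝ} (ht : 0 < t) (x : ℝ) :
    ∑' k : ℤ, ENNReal.ofReal (1 / (1 + |x - k|) ^ t) ≤
      2 * ∑' k : ℤ, ENNReal.ofReal (1 / (1 + |(k : ℝ)|) ^ t) := by
  set W : ℤ → ℝ≥0∞ := fun k => ENNReal.ofReal (1 / (1 + |(k : ℝ)|) ^ t) with hW
  have hx0 := Int.floor_le x
  have hx1 := Int.lt_floor_add_one x
  rw [← (Equiv.subLeft ⌊x⌋).tsum_eq]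
  have h : ∀ j : ℤ, ENNReal.ofReal (1 / (1 + |x - (Equiv.subLeft ⌊x⌋ j : ℤ)|) ^ t) ≤
      W j + W (j + 1) := by
    intro j
    rw [Equiv.subLeft_apply]
    -- The distance is `|x - ⌊x⌋ + j|` with fractional part in `[0,1)`: it is at least `j` for `j ≥
    -- 0` and at least `-(j+1)` for `j < 0`. Each half-line thus uses the unshifted sum at most
    -- once, whence the factor two.
    rcases le_or_gt 0 j with hj | hj
    · refine le_add_right (ENNReal.ofReal_le_ofReal ?_)
      have hj' : (0 : ℝ) ≤ j := by exact_mod_cast hj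
      have hle : |(j : ℝ)| ≤ |x - ((⌊x⌋ - j : ℤ) : ℝ)| := by
        push_cast
        rw [abs_of_nonneg hj']
        exact le_trans (by linarith) (le_abs_self _)
      gcongr
    · refine le_add_left (ENNReal.ofReal_le_ofReal ?_)
      have hj' : (j : ℝ) + 1 ≤ 0 := by exact_mod_cast hj
      have hle : |((j + 1 : ℤ) : ℝ)| ≤ |x - ((⌊x⌋ - j : ℤ) : ℝ)| := by
        push_cast
        rw [abs_of_nonpos hj']
        exact le_trans (by linarith) (neg_le_abs _)
      gcongr
  refine (ENNReal.tsum_le_tsum h).trans ?_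
  rw [ENNReal.tsum_add, two_mul]
  exact add_le_add_right ((Equiv.addRight (1 : ℤ)).tsum_eq W).le _

lemma norm_le_norm_toLp {d : ℕ} (k : Fin d → ℤ) :
    ‖k‖ ≤ ‖(WithLp.toLp 2 (fun i => (k i : ℝ)) : EuclideanSpace ℝ (Fin d))‖ := by
  refine (pi_norm_le_iff_of_nonneg (norm_nonneg _)).2 fun i => ?_
  have := PiLp.norm_apply_le (WithLp.toLp 2 (fun i => (k i : ℝ)) : EuclideanSpace ℝ (Fin d)) i
  rwa [Int.norm_eq_abs, ← Real.norm_eq_abs]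

/-- The Euclidean norm dominates the maximum norm at lattice points. The absence of a factor
depending on `d` matters: rounding each coordinate would cost `2^d`, more than `c^*` allows in
general. -/
lemma tsum_one_add_norm_sub_rpow_le_sup {d : ℕ} {t : ℝ} (ht : 0 < t)
    (y : EuclideanSpace ℝ (Fin d)) :
    ∑' k : Fin d → ℤ, ENNReal.ofReal
        (1 / (1 + ‖y - WithLp.toLp 2 (fun i => (k i : ℝ))‖) ^ t) ≤
      ∑' k : Fin d → ℤ, ENNReal.ofReal (1 / (1 + ‖k‖) ^ t) := by
  refine (tsum_one_add_norm_sub_rpow_le ht y).trans (ENNReal.tsum_le_tsum fun k => ?_)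
  refine ENNReal.ofReal_le_ofReal ?_
  gcongr
  exact norm_le_norm_toLp k

end LatticeSums

end RandomAverageSampling

namespace RandomAverageSampling

/-! ### Hölder's inequality for mixed sequence norms -/

section SequenceHolder

/-- Hölder's inequality for sums. -/
lemma tsum_mul_le_Lp_mul_Lq {κ : Type*} {p q : ℝ} (hpq : p.HolderConjugate q) (f g : κ → ℝ≥0∞) :
    ∑' k, f k * g k ≤ (∑' k, f k ^ p) ^ (1 / p) * (∑' k, g k ^ q) ^ (1 / q) := by
  let _ : MeasurableSpace κ := ⊤
  have h := ENNReal.lintegral_mul_le_Lp_mul_Lq (Measure.count : Measure κ) hpq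
    (f := f) (g := g) measurable_from_top.aemeasurable measurable_from_top.aemeasurable
  simpa only [lintegral_count, Pi.mul_apply] using h

lemma rpow_one_div_rpow (x : ℝ≥0∞) (p q : ℝ) : (x ^ (1 / q)) ^ p = x ^ (p / q) := by
  rw [← ENNReal.rpow_mul]
  congr 1
  ring

/-- Hölder's inequality for mixed sequence norms, against a product weight. -/
lemma tsum_mul_le_seqMixedNorm {ι κ : Type*} {p q p' q' : ℝ} (hp : p.HolderConjugate p')
    (hq : q.HolderConjugate q') (c : ι → κ → ℂ) (a : ι → ℝ≥0∞) (b : κ → ℝ≥0∞) :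
    ∑' k : ι × κ, ‖c k.1 k.2‖ₑ * (a k.1 * b k.2) ≤
      seqMixedNorm p q c * ((∑' i, a i ^ p') ^ (1 / p') * (∑' k, b k ^ q') ^ (1 / q')) := by
  set B := (∑' k, b k ^ q') ^ (1 / q') with hB
  calc ∑' k : ι × κ, ‖c k.1 k.2‖ₑ * (a k.1 * b k.2)
      = ∑' i, ∑' k, ‖c i k‖ₑ * (a i * b k) :=
        ENNReal.tsum_prod (f := fun i k => ‖c i k‖ₑ * (a i * b k))
    _ = ∑' i, a i * ∑' k, ‖c i k‖ₑ * b k := by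
        refine tsum_congr fun i => ?_
        rw [← ENNReal.tsum_mul_left]
        exact tsum_congr fun k => by ring
    _ ≤ ∑' i, a i * ((∑' k, ‖c i k‖ₑ ^ q) ^ (1 / q) * B) :=
        ENNReal.tsum_le_tsum fun i => mul_le_mul_right (tsum_mul_le_Lp_mul_Lq hq _ _) _
    _ = (∑' i, (∑' k, ‖c i k‖ₑ ^ q) ^ (1 / q) * a i) * B := by
        rw [← ENNReal.tsum_mul_right]
        exact tsum_congr fun i => by ring
    _ ≤ ((∑' i, ((∑' k, ‖c i k‖ₑ ^ q) ^ (1 / q)) ^ p) ^ (1 / p) *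
          (∑' i, a i ^ p') ^ (1 / p')) * B :=
        mul_le_mul_left (tsum_mul_le_Lp_mul_Lq hp _ _) _
    _ = _ := by
        simp_rw [rpow_one_div_rpow]
        rw [seqMixedNorm, mul_assoc]

end SequenceHolder

/-! ### Arithmetic of the truncation thresholds -/

section TailArithmetic

/-- Puts the side length of the coefficient box on the same base `1+N-κ` as the tail, so that their
powers can be combined. -/
lemma two_mul_add_one_le {N κ : ℝ} (hκ : 0 ≤ κ) (hN : κ ≤ N) :
    2 * N + 1 ≤ 2 * ((1 + κ) * (1 + N - κ)) := by
  have : 0 ≤ κ * (N - κ) := mul_nonneg hκ (by linarith)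
  nlinarith

lemma rpow_neg_le_rpow_neg {P M e s : ℝ} (hP : 1 ≤ P) (hM : 0 < M) (hMP : M ≤ P) (hs : 0 ≤ s)
    (hse : s ≤ e) : P ^ (-e) ≤ M ^ (-s) :=
  (Real.rpow_le_rpow_of_exponent_le hP (neg_le_neg hse)).trans
    (Real.rpow_le_rpow_of_nonpos hM hMP (by linarith))

lemma firstTail_eq {P σ p' : ℝ} (hP : 0 < P) (hσ : 0 < σ) :
    (2 / (P ^ σ * σ)) ^ (1 / p') = 2 ^ (1 / p') / σ ^ (1 / p') * P ^ (-(σ / p')) := by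
  rw [Real.div_rpow (by norm_num) (by positivity), Real.mul_rpow (by positivity) hσ.le,
    ← Real.rpow_mul hP.le, mul_one_div, Real.rpow_neg hP.le]
  field_simp

lemma secondTail_eq {d : ℕ} {P τ q' κ : ℝ} (hP : 0 < P) (hτ : 0 < τ) (hκ : 0 ≤ κ) :
    (2 ^ d * d * (1 + κ) ^ ((d : ℝ) - 1) / (P ^ τ * τ)) ^ (1 / q') =
      2 ^ ((d : ℝ) / q') * ((d : ℝ) ^ (1 / q') * (1 + κ) ^ (((d : ℝ) - 1) / q') / τ ^ (1 / q')) *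
        P ^ (-(τ / q')) := by
  rw [Real.div_rpow (by positivity) (by positivity), Real.mul_rpow (by positivity) hτ.le,
    ← Real.rpow_mul hP.le, mul_one_div, Real.rpow_neg hP.le,
    Real.mul_rpow (by positivity) (by positivity), Real.mul_rpow (by positivity) (by positivity),
    ← Real.rpow_natCast, ← Real.rpow_mul (by norm_num), ← Real.rpow_mul (by positivity),
    mul_one_div, mul_one_div]
  field_simp

/-- The three tail contributions, in the form in which they enter the truncation threshold. -/
lemma tail_contributions_le {d N : ℕ} {p' q' s₁ s₂ κ₁ κ₂ s : ℝ} (hp' : 0 < p') (hq' : 0 < q')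
    (h₁ : 0 < s₁ * p' - 1) (h₂ : 0 < s₂ * q' - d) (hs : 0 < s)
    (hs₁ : s ≤ s₁ - 1 / p' - d / q') (hs₂ : s ≤ s₂ - 1 / p' - d / q')
    (hκ₁ : 0 ≤ κ₁) (hκ₂ : 0 ≤ κ₂) (hN : max κ₁ κ₂ < N) :
    (2 * (N : ℝ) + 1) ^ (1 / p') * (2 ^ d * d * (1 + κ₂) ^ ((d : ℝ) - 1) /
          ((1 + N - κ₂) ^ (s₂ * q' - d) * (s₂ * q' - d))) ^ (1 / q') +
        (2 / ((1 + N - κ₁) ^ (s₁ * p' - 1) * (s₁ * p' - 1))) ^ (1 / p') *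
          (2 * (N : ℝ) + 1) ^ ((d : ℝ) / q') +
        (2 / ((1 + N - κ₁) ^ (s₁ * p' - 1) * (s₁ * p' - 1))) ^ (1 / p') *
          (2 ^ d * d * (1 + κ₂) ^ ((d : ℝ) - 1) /
            ((1 + N - κ₂) ^ (s₂ * q' - d) * (s₂ * q' - d))) ^ (1 / q') ≤
      2 ^ (1 / p' + d / q') *
        ((d : ℝ) ^ (1 / q') * (1 + κ₂) ^ (((d : ℝ) - 1) / q' + 1 / p') /
            (s₂ * q' - d) ^ (1 / q') +
          (1 + κ₁) ^ ((d : ℝ) / q') / (s₁ * p' - 1) ^ (1 / p') +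
          (d : ℝ) ^ (1 / q') * (1 + κ₂) ^ (((d : ℝ) - 1) / q') /
            ((s₁ * p' - 1) ^ (1 / p') * (s₂ * q' - d) ^ (1 / q'))) *
        (N - max κ₁ κ₂) ^ (-s) := by
  have hN₁ : κ₁ < N := (le_max_left _ _).trans_lt hN
  have hN₂ : κ₂ < N := (le_max_right _ _).trans_lt hN
  have hM : 0 < N - max κ₁ κ₂ := by linarith
  set P₁ : ℝ := 1 + N - κ₁ with hP₁
  set P₂ : ℝ := 1 + N - κ₂ with hP₂
  have hP₁1 : 1 ≤ P₁ := by rw [hP₁]; linarith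
  have hP₂1 : 1 ≤ P₂ := by rw [hP₂]; linarith
  have hP₁0 : 0 < P₁ := by linarith
  have hP₂0 : 0 < P₂ := by linarith
  have hMP₁ : N - max κ₁ κ₂ ≤ P₁ := by rw [hP₁]; linarith [le_max_left κ₁ κ₂]
  have hMP₂ : N - max κ₁ κ₂ ≤ P₂ := by rw [hP₂]; linarith [le_max_right κ₁ κ₂]
  have hN0 : (0 : ℝ) ≤ N := Nat.cast_nonneg N
  have ha : 0 < 1 / p' := by positivity
  have hb : 0 ≤ (d : ℝ) / q' := by positivity
  rw [firstTail_eq hP₁0 h₁, secondTail_eq hP₂0 h₂ hκ₂]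
  have e₁ : (s₁ * p' - 1) / p' = s₁ - 1 / p' := by field_simp
  have e₂ : (s₂ * q' - d) / q' = s₂ - d / q' := by field_simp
  rw [e₁, e₂]
  generalize s₁ * p' - 1 = σ at *
  generalize s₂ * q' - d = τ at *
  have hpow₁ : (2 * (N : ℝ) + 1) ^ ((d : ℝ) / q') ≤
      2 ^ ((d : ℝ) / q') * ((1 + κ₁) ^ ((d : ℝ) / q') * P₁ ^ ((d : ℝ) / q')) := by
    rw [← Real.mul_rpow (by positivity) hP₁0.le, ← Real.mul_rpow (by norm_num) (by positivity)]
    exact Real.rpow_le_rpow (by positivity) (two_mul_add_one_le hκ₁ hN₁.le) hb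
  have hpow₂ : (2 * (N : ℝ) + 1) ^ (1 / p') ≤
      2 ^ (1 / p') * ((1 + κ₂) ^ (1 / p') * P₂ ^ (1 / p')) := by
    rw [← Real.mul_rpow (by positivity) hP₂0.le, ← Real.mul_rpow (by norm_num) (by positivity)]
    exact Real.rpow_le_rpow (by positivity) (two_mul_add_one_le hκ₂ hN₂.le) ha.le
  set M := (N : ℝ) - max κ₁ κ₂ with hMdef
  -- In each contribution the power coming from the box size is subtracted from the decay of the
  -- tail; what is left is at least the surplus `s`, and the bases, which are at least `1`, are then
  -- lowered to `M`.
  have t1 : P₂ ^ (1 / p') * P₂ ^ (-(s₂ - d / q')) ≤ M ^ (-s) := by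
    rw [← Real.rpow_add hP₂0, show 1 / p' + -(s₂ - d / q') = -(s₂ - 1 / p' - d / q') by ring]
    exact rpow_neg_le_rpow_neg hP₂1 hM hMP₂ hs.le hs₂
  have t2 : P₁ ^ (-(s₁ - 1 / p')) * P₁ ^ ((d : ℝ) / q') ≤ M ^ (-s) := by
    rw [← Real.rpow_add hP₁0,
      show -(s₁ - 1 / p') + (d : ℝ) / q' = -(s₁ - 1 / p' - d / q') by ring]
    exact rpow_neg_le_rpow_neg hP₁1 hM hMP₁ hs.le hs₁
  have t3 : P₁ ^ (-(s₁ - 1 / p')) * P₂ ^ (-(s₂ - d / q')) ≤ M ^ (-s) := by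
    have h1 : P₁ ^ (-(s₁ - 1 / p')) ≤ M ^ (-s) :=
      rpow_neg_le_rpow_neg hP₁1 hM hMP₁ hs.le (by linarith)
    have h2 : P₂ ^ (-(s₂ - d / q')) ≤ 1 :=
      Real.rpow_le_one_of_one_le_of_nonpos hP₂1 (by linarith)
    calc _ ≤ M ^ (-s) * 1 := by gcongr
      _ = _ := mul_one _
  have hκ : (1 + κ₂) ^ (((d : ℝ) - 1) / q' + 1 / p') =
      (1 + κ₂) ^ (((d : ℝ) - 1) / q') * (1 + κ₂) ^ (1 / p') := Real.rpow_add (by positivity) _ _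
  have h2pow : (2 : ℝ) ^ (1 / p' + d / q') = 2 ^ (1 / p') * 2 ^ ((d : ℝ) / q') :=
    Real.rpow_add (by norm_num) _ _
  rw [hκ, h2pow]
  set X := (d : ℝ) ^ (1 / q') * (1 + κ₂) ^ (((d : ℝ) - 1) / q') / τ ^ (1 / q') with hX
  have hXnn : 0 ≤ X := by positivity
  calc _ ≤ (2 ^ (1 / p') * ((1 + κ₂) ^ (1 / p') * P₂ ^ (1 / p'))) *
            (2 ^ ((d : ℝ) / q') * X * P₂ ^ (-(s₂ - d / q'))) +
          2 ^ (1 / p') / σ ^ (1 / p') * P₁ ^ (-(s₁ - 1 / p')) *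
            (2 ^ ((d : ℝ) / q') * ((1 + κ₁) ^ ((d : ℝ) / q') * P₁ ^ ((d : ℝ) / q'))) +
          2 ^ (1 / p') / σ ^ (1 / p') * P₁ ^ (-(s₁ - 1 / p')) *
            (2 ^ ((d : ℝ) / q') * X * P₂ ^ (-(s₂ - d / q'))) := by gcongr
    _ = (2 ^ (1 / p') * (1 + κ₂) ^ (1 / p') * 2 ^ ((d : ℝ) / q') * X) *
            (P₂ ^ (1 / p') * P₂ ^ (-(s₂ - d / q'))) +
          (2 ^ (1 / p') / σ ^ (1 / p') * 2 ^ ((d : ℝ) / q') * (1 + κ₁) ^ ((d : ℝ) / q')) *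
            (P₁ ^ (-(s₁ - 1 / p')) * P₁ ^ ((d : ℝ) / q')) +
          (2 ^ (1 / p') / σ ^ (1 / p') * 2 ^ ((d : ℝ) / q') * X) *
            (P₁ ^ (-(s₁ - 1 / p')) * P₂ ^ (-(s₂ - d / q'))) := by ring
    _ ≤ (2 ^ (1 / p') * (1 + κ₂) ^ (1 / p') * 2 ^ ((d : ℝ) / q') * X) * M ^ (-s) +
          (2 ^ (1 / p') / σ ^ (1 / p') * 2 ^ ((d : ℝ) / q') * (1 + κ₁) ^ ((d : ℝ) / q')) *
            M ^ (-s) +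
          (2 ^ (1 / p') / σ ^ (1 / p') * 2 ^ ((d : ℝ) / q') * X) * M ^ (-s) := by gcongr
    _ = _ := by
        rw [hX]
        field_simp

end TailArithmetic

end RandomAverageSampling

namespace RandomAverageSampling

/-! ### Pointwise bounds for shift series -/

section ShiftSeries

/-- The decay bound of the generators is a product of a weight in each variable, which lets Hölder's
inequality act on the two variables separately. -/
noncomputable def firstWeight (s x : ℝ) (k : ℤ) : ℝ≥0∞ := ENNReal.ofReal (1 / (1 + |x - k|) ^ s)

noncomputable def secondWeight {d : ℕ} (s : ℝ) (y : EuclideanSpace ℝ (Fin d))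
    (k : Fin d → ℤ) : ℝ≥0∞ :=
  ENNReal.ofReal (1 / (1 + ‖y - WithLp.toLp 2 (fun i => (k i : ℝ))‖) ^ s)

/-- The summand of `shiftSeries`. -/
noncomputable def shiftTerm {d r : ℕ} (φ : Fin r → Domain d → ℂ)
    (c : Fin r → ℤ → (Fin d → ℤ) → ℂ) (z : Domain d) (k : ℤ × (Fin d → ℤ)) : ℂ :=
  ∑ i, c i k.1 k.2 * φ i (z - latticePoint k)

lemma ofReal_one_div_rpow_rpow {x s t : ℝ} (hx : 0 ≤ x) (ht : 0 ≤ t) :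
    ENNReal.ofReal (1 / (1 + x) ^ s) ^ t = ENNReal.ofReal (1 / (1 + x) ^ (s * t)) := by
  rw [ENNReal.ofReal_rpow_of_nonneg (by positivity) ht, Real.div_rpow zero_le_one (by positivity),
    Real.one_rpow, ← Real.rpow_mul (by positivity)]

variable {d r : ℕ} {p q : ℝ} {φ : Fin r → Domain d → ℂ} {α₁ α₂ ctilde s₁ s₂ : ℝ}

lemma conj_exponent_facts (hp : 1 < p) :
    0 < p / (p - 1) ∧ 1 / (p / (p - 1)) = 1 - 1 / p ∧ 1 / (p / (p - 1)) = (p - 1) / p := by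
  have h0 : 0 < p := by linarith
  have h1 : 0 < p - 1 := by linarith
  refine ⟨by positivity, ?_, ?_⟩ <;> field_simp

/-- Because `d/q ≤ d`, the decay hypothesis gives `s₁ > 1 - 1/p = 1/p'`, which is summability of the
`p'`-th power of the weight. -/
lemma GeneratorAssumption.first_exponent (hΦ : GeneratorAssumption p q φ α₁ α₂ ctilde s₁ s₂)
    (hp : 1 < p) (hq : 1 < q) : 1 < s₁ * (p / (p - 1)) := by
  have h0 : 0 < p := by linarith
  have h1 : 0 < p - 1 := by linarith
  have h2 : (d : ℝ) / q ≤ d := div_le_self (Nat.cast_nonneg d) hq.le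
  have h3 : (p - 1) / p < s₁ := by
    have : (p - 1) / p = 1 - 1 / p := by field_simp
    linarith [hΦ.s₁_gt]
  rw [div_lt_iff₀ h0] at h3
  rw [← mul_div_assoc, lt_div_iff₀ h1]
  linarith

/-- Because `1/p ≤ 1`, the decay hypothesis gives `s₂ > d - d/q = d/q'`. -/
lemma GeneratorAssumption.second_exponent (hΦ : GeneratorAssumption p q φ α₁ α₂ ctilde s₁ s₂)
    (hp : 1 < p) (hq : 1 < q) : (d : ℝ) < s₂ * (q / (q - 1)) := by
  have h0 : 0 < q := by linarith
  have h1 : 0 < q - 1 := by linarith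
  have h2 : 1 / p ≤ 1 := by rw [div_le_one (by linarith)]; exact hp.le
  have h3 : (d : ℝ) * (q - 1) / q < s₂ := by
    have : (d : ℝ) * (q - 1) / q = d - d / q := by field_simp
    linarith [hΦ.s₂_gt]
  rw [div_lt_iff₀ h0] at h3
  rw [← mul_div_assoc, lt_div_iff₀ h1]
  linarith

lemma enorm_shiftTerm_le (hΦ : GeneratorAssumption p q φ α₁ α₂ ctilde s₁ s₂)
    (c : Fin r → ℤ → (Fin d → ℤ) → ℂ) (z : Domain d) (k : ℤ × (Fin d → ℤ)) :
    ‖shiftTerm φ c z k‖ₑ ≤ ENNReal.ofReal ctilde *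
      ∑ i, ‖c i k.1 k.2‖ₑ * (firstWeight s₁ z.1 k.1 * secondWeight s₂ z.2 k.2) := by
  rw [shiftTerm, Finset.mul_sum]
  refine (enorm_sum_le _ _).trans (Finset.sum_le_sum fun i _ => ?_)
  rw [enorm_mul, mul_left_comm]
  refine mul_le_mul_right ?_ _
  rw [firstWeight, secondWeight, ← ENNReal.ofReal_mul (by positivity),
    ← ENNReal.ofReal_mul hΦ.ctilde_pos.le, ← ofReal_norm]
  refine ENNReal.ofReal_le_ofReal ((hΦ.decay i _).trans (le_of_eq ?_))
  simp only [latticePoint, Prod.fst_sub, Prod.snd_sub]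
  field_simp

/-- Mixed Hölder bound for a part of the shift series indexed by a product set. -/
lemma tsum_restrict_shiftTerm_le (hΦ : GeneratorAssumption p q φ α₁ α₂ ctilde s₁ s₂)
    (hp : 1 < p) (hq : 1 < q) (c : Fin r → ℤ → (Fin d → ℤ) → ℂ) (z : Domain d)
    (S : Set ℤ) (S' : Set (Fin d → ℤ)) :
    ∑' k, (S ×ˢ S').indicator (fun k => ‖shiftTerm φ c z k‖ₑ) k ≤
      ENNReal.ofReal ctilde * vecSeqMixedNorm p q c *
        ((∑' k, S.indicator (firstWeight s₁ z.1) k ^ (p / (p - 1))) ^ (1 / (p / (p - 1))) *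
          (∑' k, S'.indicator (secondWeight s₂ z.2) k ^ (q / (q - 1))) ^ (1 / (q / (q - 1)))) := by
  classical
  have hle : ∀ k : ℤ × (Fin d → ℤ), (S ×ˢ S').indicator (fun k => ‖shiftTerm φ c z k‖ₑ) k ≤
      ENNReal.ofReal ctilde * ∑ i, ‖c i k.1 k.2‖ₑ *
        (S.indicator (firstWeight s₁ z.1) k.1 * S'.indicator (secondWeight s₂ z.2) k.2) := by
    intro k
    by_cases hk : k ∈ S ×ˢ S'
    · rw [Set.indicator_of_mem hk, Set.indicator_of_mem hk.1, Set.indicator_of_mem hk.2]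
      exact enorm_shiftTerm_le hΦ c z k
    · rw [Set.indicator_of_notMem hk]
      exact zero_le
  refine (ENNReal.tsum_le_tsum hle).trans ?_
  rw [ENNReal.tsum_mul_left, Summable.tsum_finsetSum fun i _ => ENNReal.summable, mul_assoc,
    vecSeqMixedNorm, Finset.sum_mul]
  refine mul_le_mul_right (Finset.sum_le_sum fun i _ => ?_) _
  exact tsum_mul_le_seqMixedNorm (Real.HolderConjugate.conjExponent hp)
    (Real.HolderConjugate.conjExponent hq) (c i) _ _

/-- The full one-dimensional weight sum. -/
lemma firstWeight_sum_le (hp : 1 < p) (hs : 1 < s₁ * (p / (p - 1))) (x : ℝ) :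
    (∑' k, firstWeight s₁ x k ^ (p / (p - 1))) ^ (1 / (p / (p - 1))) ≤
      ENNReal.ofReal (2 ^ ((p - 1) / p) *
        (∑' k : ℤ, 1 / (1 + |(k : ℝ)|) ^ (s₁ * p / (p - 1))) ^ ((p - 1) / p)) := by
  obtain ⟨h0, -, h1⟩ := conj_exponent_facts hp
  have h2 : 0 ≤ (p - 1) / p := by rw [← h1]; positivity
  have hsum := tsum_one_add_abs_rpow_lt_top hs
  have hsm : Summable fun k : ℤ => 1 / (1 + |(k : ℝ)|) ^ (s₁ * (p / (p - 1))) := by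
    refine (ENNReal.summable_toReal hsum.ne).congr fun k => ?_
    rw [ENNReal.toReal_ofReal (by positivity)]
  have hnn : 0 ≤ ∑' k : ℤ, 1 / (1 + |(k : ℝ)|) ^ (s₁ * (p / (p - 1))) :=
    tsum_nonneg fun k => by positivity
  rw [mul_div_assoc, ← Real.mul_rpow (by norm_num) hnn,
    ← ENNReal.ofReal_rpow_of_nonneg (by positivity) h2, h1]
  refine ENNReal.rpow_le_rpow ?_ h2
  simp_rw [firstWeight, fun k : ℤ => ofReal_one_div_rpow_rpow (s := s₁) (abs_nonneg (x - k)) h0.le]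
  refine (tsum_one_add_abs_sub_rpow_le (by linarith) x).trans_eq ?_
  rw [ENNReal.ofReal_mul (by norm_num), ENNReal.ofReal_ofNat,
    ENNReal.ofReal_tsum_of_nonneg (fun k => by positivity) hsm]

/-- The full `d`-dimensional weight sum. -/
lemma secondWeight_sum_le (hd : 1 ≤ d) (hq : 1 < q) (hs : (d : ℝ) < s₂ * (q / (q - 1)))
    (y : EuclideanSpace ℝ (Fin d)) :
    (∑' k, secondWeight s₂ y k ^ (q / (q - 1))) ^ (1 / (q / (q - 1))) ≤
      ENNReal.ofReal ((∑' k : Fin d → ℤ, 1 / (1 + ‖k‖) ^ (s₂ * q / (q - 1))) ^ ((q - 1) / q)) := by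
  obtain ⟨h0, -, h1⟩ := conj_exponent_facts hq
  have h2 : 0 ≤ (q - 1) / q := by rw [← h1]; positivity
  have hsum := tsum_one_add_norm_rpow_lt_top hd hs
  have hsm : Summable fun k : Fin d → ℤ => 1 / (1 + ‖k‖) ^ (s₂ * (q / (q - 1))) := by
    refine (ENNReal.summable_toReal hsum.ne).congr fun k => ?_
    rw [ENNReal.toReal_ofReal (by positivity)]
  have hnn : 0 ≤ ∑' k : Fin d → ℤ, 1 / (1 + ‖k‖) ^ (s₂ * (q / (q - 1))) :=
    tsum_nonneg fun k => by positivity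
  rw [mul_div_assoc, ← ENNReal.ofReal_rpow_of_nonneg hnn h2, h1]
  refine ENNReal.rpow_le_rpow ?_ h2
  simp_rw [secondWeight, fun k : Fin d → ℤ => ofReal_one_div_rpow_rpow (s := s₂)
    (norm_nonneg (y - WithLp.toLp 2 (fun i => (k i : ℝ)))) h0.le]
  refine (tsum_one_add_norm_sub_rpow_le_sup ?_ y).trans_eq ?_
  · exact lt_of_le_of_lt (Nat.cast_nonneg d) hs
  · rw [ENNReal.ofReal_tsum_of_nonneg (fun k => by positivity) hsm]

lemma one_le_tsum_of_one_le {ι : Type*} {f : ι → ℝ} (hf : Summable f) (hnn : ∀ i, 0 ≤ f i) (i : ι)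
    (hi : f i = 1) : 1 ≤ ∑' i, f i := hi ▸ hf.le_tsum i fun j _ => hnn j

lemma cStar_pos (hΦ : GeneratorAssumption p q φ α₁ α₂ ctilde s₁ s₂) (hd : 1 ≤ d)
    (hp : 1 < p) (hq : 1 < q) : 0 < cStar d p q α₁ ctilde s₁ s₂ := by
  have hα := hΦ.α₁_pos
  have hct := hΦ.ctilde_pos
  have hsm₁ : Summable fun k : ℤ => 1 / (1 + |(k : ℝ)|) ^ (s₁ * p / (p - 1)) := by
    refine (ENNReal.summable_toReal
      (tsum_one_add_abs_rpow_lt_top (hΦ.first_exponent hp hq)).ne).congr fun k => ?_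
    rw [ENNReal.toReal_ofReal (by positivity), mul_div_assoc]
  have hsm₂ : Summable fun k : Fin d → ℤ => 1 / (1 + ‖k‖) ^ (s₂ * q / (q - 1)) := by
    refine (ENNReal.summable_toReal
      (tsum_one_add_norm_rpow_lt_top hd (hΦ.second_exponent hp hq)).ne).congr fun k => ?_
    rw [ENNReal.toReal_ofReal (by positivity), mul_div_assoc]
  have h1 := one_le_tsum_of_one_le hsm₁ (fun k => by positivity) 0 (by simp)
  have h2 := one_le_tsum_of_one_le hsm₂ (fun k => by positivity) 0 (by simp)
  rw [cStar]
  have h3 : 0 < ∑' k : ℤ, 1 / (1 + |(k : ℝ)|) ^ (s₁ * p / (p - 1)) := by linarith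
  have h4 : 0 < ∑' k : Fin d → ℤ, 1 / (1 + ‖k‖) ^ (s₂ * q / (q - 1)) := by linarith
  positivity

/-- The absolute shift series is bounded by `α₁ c^* ‖c‖` everywhere. -/
lemma tsum_enorm_shiftTerm_le (hΦ : GeneratorAssumption p q φ α₁ α₂ ctilde s₁ s₂) (hd : 1 ≤ d)
    (hp : 1 < p) (hq : 1 < q) (c : Fin r → ℤ → (Fin d → ℤ) → ℂ) (z : Domain d) :
    ∑' k, ‖shiftTerm φ c z k‖ₑ ≤
      ENNReal.ofReal (α₁ * cStar d p q α₁ ctilde s₁ s₂) * vecSeqMixedNorm p q c := by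
  have hα := hΦ.α₁_pos
  have hct := hΦ.ctilde_pos
  have h := tsum_restrict_shiftTerm_le hΦ hp hq c z Set.univ Set.univ
  simp only [Set.univ_prod_univ, Set.indicator_univ] at h
  refine h.trans ?_
  rw [mul_right_comm]
  refine mul_le_mul_left ?_ _
  refine (mul_le_mul_right (mul_le_mul' (firstWeight_sum_le hp (hΦ.first_exponent hp hq) z.1)
    (secondWeight_sum_le hd hq (hΦ.second_exponent hp hq) z.2)) _).trans ?_
  have hnn₁ : 0 ≤ ∑' k : ℤ, 1 / (1 + |(k : ℝ)|) ^ (s₁ * p / (p - 1)) :=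
    tsum_nonneg fun k => by positivity
  have hnn₂ : 0 ≤ ∑' k : Fin d → ℤ, 1 / (1 + ‖k‖) ^ (s₂ * q / (q - 1)) :=
    tsum_nonneg fun k => by positivity
  rw [← ENNReal.ofReal_mul (by positivity), ← ENNReal.ofReal_mul hct.le]
  refine ENNReal.ofReal_le_ofReal ?_
  rw [cStar]
  set X := (∑' k : ℤ, 1 / (1 + |(k : ℝ)|) ^ (s₁ * p / (p - 1))) ^ ((p - 1) / p) with hX
  set Y := (∑' k : Fin d → ℤ, 1 / (1 + ‖k‖) ^ (s₂ * q / (q - 1))) ^ ((q - 1) / q) with hY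
  have hX0 : 0 ≤ X := by positivity
  have hY0 : 0 ≤ Y := by positivity
  -- The prefactor of `c^*` is `4/2^{1/p+1/q} = 2^{1/p'+1/q'}`. Only `2^{1/p'}`, from the
  -- one-dimensional shifted sum, is used.
  have h2 : (2 : ℝ) ^ ((p - 1) / p) * 2 ^ ((p + q) / (p * q)) ≤ 4 := by
    rw [← Real.rpow_add (by norm_num)]
    have : (p - 1) / p + (p + q) / (p * q) = 1 + 1 / q := by field_simp; ring
    rw [this]
    calc (2 : ℝ) ^ (1 + 1 / q) ≤ 2 ^ (2 : ℝ) := by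
          refine Real.rpow_le_rpow_of_exponent_le (by norm_num) ?_
          have : 1 / q ≤ 1 := by rw [div_le_one (by linarith)]; exact hq.le
          linarith
      _ = 4 := by norm_num
  have h2pos : (0 : ℝ) < 2 ^ ((p + q) / (p * q)) := by positivity
  calc ctilde * (2 ^ ((p - 1) / p) * X * Y)
      ≤ ctilde * (4 / 2 ^ ((p + q) / (p * q)) * X * Y) := by
        gcongr
        rw [le_div_iff₀ h2pos]
        exact h2
    _ = _ := by field_simp

end ShiftSeries

end RandomAverageSampling

namespace RandomAverageSampling

/-! ### Truncation of the coefficients -/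

section Truncation

/-- The integers of modulus at most `N`. -/
noncomputable def boxOne (N : ℕ) : Finset ℤ := Finset.Icc (-(N : ℤ)) N

/-- The integer vectors of maximum norm at most `N`. -/
noncomputable def boxPi (d N : ℕ) : Finset (Fin d → ℤ) := Fintype.piFinset fun _ => boxOne N

lemma notMem_boxOne {N : ℕ} {k : ℤ} : k ∉ boxOne N ↔ (N : ℝ) < |(k : ℝ)| := by
  rw [boxOne, Finset.mem_Icc, ← abs_le, not_le, ← Int.cast_abs]
  exact_mod_cast Iff.rfl

lemma notMem_boxPi {d N : ℕ} {k : Fin d → ℤ} : k ∉ boxPi d N ↔ (N : ℝ) < ‖k‖ := by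
  rw [← not_iff_not, not_not, not_lt, pi_norm_le_iff_of_nonneg (Nat.cast_nonneg N), boxPi,
    Fintype.mem_piFinset]
  refine forall_congr' fun i => ?_
  rw [← not_iff_not, not_le, Int.norm_eq_abs]
  exact notMem_boxOne

lemma card_boxOne (N : ℕ) : (boxOne N).card = 2 * N + 1 := by
  rw [boxOne, Int.card_Icc]
  omega

lemma card_boxPi (d N : ℕ) : (boxPi d N).card = (2 * N + 1) ^ d := by
  rw [boxPi, Fintype.card_piFinset_const, card_boxOne]

/-- Restriction of coefficients to a finite product set. -/
noncomputable def restrictCoeff {ι κ : Type*} {r : ℕ} (F : Finset ι) (F' : Finset κ)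
    (c : Fin r → ι → κ → ℂ) : Fin r → ι → κ → ℂ :=
  open Classical in fun i j k => if j ∈ F ∧ k ∈ F' then c i j k else 0

lemma seqMixedNorm_mono {ι κ : Type*} {p q : ℝ} (hp : 0 < p) (hq : 0 < q) {c c' : ι → κ → ℂ}
    (h : ∀ j k, ‖c j k‖ₑ ≤ ‖c' j k‖ₑ) : seqMixedNorm p q c ≤ seqMixedNorm p q c' := by
  refine ENNReal.rpow_le_rpow (ENNReal.tsum_le_tsum fun j => ?_) (by positivity)
  refine ENNReal.rpow_le_rpow (ENNReal.tsum_le_tsum fun k => ?_) (by positivity)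
  exact ENNReal.rpow_le_rpow (h j k) hq.le

lemma vecSeqMixedNorm_restrictCoeff_le {d r : ℕ} {p q : ℝ} (hp : 0 < p) (hq : 0 < q)
    (F : Finset ℤ) (F' : Finset (Fin d → ℤ)) (c : Fin r → ℤ → (Fin d → ℤ) → ℂ) :
    vecSeqMixedNorm p q (restrictCoeff F F' c) ≤ vecSeqMixedNorm p q c := by
  refine Finset.sum_le_sum fun i _ => seqMixedNorm_mono hp hq fun j k => ?_
  rw [restrictCoeff]
  split_ifs
  · exact le_rfl
  · simp

lemma abs_le_abs_sub_add {x κ : ℝ} (hx : |x| ≤ κ) (k : ℝ) : |k| - κ ≤ |x - k| := by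
  have := abs_sub_abs_le_abs_sub k x
  rw [abs_sub_comm] at this
  linarith

lemma norm_le_norm_sub_add {d : ℕ} {κ : ℝ} {y : EuclideanSpace ℝ (Fin d)}
    (hy : ∀ i, |y i| ≤ κ) (hκ : 0 ≤ κ) (k : Fin d → ℤ) :
    ‖k‖ - κ ≤ ‖y - WithLp.toLp 2 (fun i => (k i : ℝ))‖ := by
  rw [sub_le_iff_le_add]
  refine (pi_norm_le_iff_of_nonneg (by positivity)).2 fun i => ?_
  have h1 := PiLp.norm_apply_le (y - WithLp.toLp 2 (fun i => (k i : ℝ))) i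
  have h2 := abs_le_abs_sub_add (hy i) (k i)
  rw [PiLp.sub_apply, Real.norm_eq_abs] at h1
  rw [Int.norm_eq_abs]
  linarith

variable {d r : ℕ} {p q : ℝ} {φ : Fin r → Domain d → ℂ} {α₁ α₂ ctilde s₁ s₂ : ℝ}

lemma indicator_rpow {ι : Type*} {t : ℝ} (ht : 0 < t) (S : Set ι) (f : ι → ℝ≥0∞) (k : ι) :
    S.indicator f k ^ t = S.indicator (fun k => f k ^ t) k := by
  by_cases hk : k ∈ S
  · simp [hk]
  · simp [hk, ENNReal.zero_rpow_of_pos ht]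

lemma sum_indicator_finset_le {ι : Type*} {t : ℝ} (ht : 0 < t) (F : Finset ι) (f : ι → ℝ≥0∞)
    (hf : ∀ k, f k ≤ 1) : ∑' k, (F : Set ι).indicator f k ^ t ≤ F.card := by
  rw [tsum_eq_sum (s := F) fun k hk => by
    rw [Set.indicator_of_notMem (by simpa using hk), ENNReal.zero_rpow_of_pos ht]]
  refine (Finset.sum_le_card_nsmul F _ 1 fun k hk => ?_).trans (by simp)
  rw [Set.indicator_of_mem (by simpa using hk)]
  exact ENNReal.rpow_le_one (hf k) ht.le

lemma ofReal_one_div_one_add_rpow_le_one {x s : ℝ} (hx : 0 ≤ x) (hs : 0 ≤ s) :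
    ENNReal.ofReal (1 / (1 + x) ^ s) ≤ 1 := by
  rw [ENNReal.ofReal_le_one, div_le_one (by positivity)]
  exact Real.one_le_rpow (by linarith) hs

/-- No decay is used inside the box: the weights are at most `1` and only the number of integers
counts. -/
lemma firstWeight_box_le {N : ℕ} {t : ℝ} (ht : 0 < t) (hs : 0 ≤ s₁) (x : ℝ) :
    (∑' k, (boxOne N : Set ℤ).indicator (firstWeight s₁ x) k ^ t) ^ (1 / t) ≤
      ENNReal.ofReal ((2 * (N : ℝ) + 1) ^ (1 / t)) := by
  have ht' : 0 ≤ 1 / t := by positivity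
  rw [← ENNReal.ofReal_rpow_of_nonneg (by positivity) ht']
  refine ENNReal.rpow_le_rpow ((sum_indicator_finset_le ht _ _ fun k =>
    ofReal_one_div_one_add_rpow_le_one (abs_nonneg _) hs).trans_eq ?_) ht'
  rw [card_boxOne, ← ENNReal.ofReal_natCast]
  push_cast
  rfl

lemma secondWeight_box_le {N : ℕ} {t : ℝ} (ht : 0 < t) (hs : 0 ≤ s₂)
    (y : EuclideanSpace ℝ (Fin d)) :
    (∑' k, (boxPi d N : Set (Fin d → ℤ)).indicator (secondWeight s₂ y) k ^ t) ^ (1 / t) ≤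
      ENNReal.ofReal ((2 * (N : ℝ) + 1) ^ ((d : ℝ) / t)) := by
  have ht' : 0 ≤ 1 / t := by positivity
  have hpow : (2 * (N : ℝ) + 1) ^ ((d : ℝ) / t) = ((2 * (N : ℝ) + 1) ^ d) ^ (1 / t) := by
    rw [← Real.rpow_natCast, ← Real.rpow_mul (by positivity), mul_one_div]
  rw [hpow, ← ENNReal.ofReal_rpow_of_nonneg (by positivity) ht']
  refine ENNReal.rpow_le_rpow ((sum_indicator_finset_le ht _ _ fun k =>
    ofReal_one_div_one_add_rpow_le_one (norm_nonneg _) hs).trans_eq ?_) ht'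
  rw [card_boxPi, ← ENNReal.ofReal_natCast]
  push_cast
  rfl

lemma firstWeight_tail_le {N : ℕ} {t κ x : ℝ} (ht : 0 < t) (hs : 1 < s₁ * t) (hκ : 0 ≤ κ)
    (hN : κ ≤ N) (hx : |x| ≤ κ) :
    (∑' k, (boxOne N : Set ℤ)ᶜ.indicator (firstWeight s₁ x) k ^ t) ^ (1 / t) ≤
      ENNReal.ofReal ((2 / ((1 + N - κ) ^ (s₁ * t - 1) * (s₁ * t - 1))) ^ (1 / t)) := by
  have ht' : 0 ≤ 1 / t := by positivity
  have hs0 : 0 < s₁ * t := by linarith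
  have hM : 0 < 1 + N - κ := by linarith
  rw [← ENNReal.ofReal_rpow_of_nonneg
    (div_nonneg (by norm_num) (mul_nonneg (by positivity) (by linarith))) ht']
  refine ENNReal.rpow_le_rpow (le_trans (ENNReal.tsum_le_tsum fun k => ?_)
    (tsum_int_tail_le hs hκ hN)) ht'
  rw [indicator_rpow ht]
  by_cases hk : k ∈ boxOne N
  · rw [Set.indicator_of_notMem (by simpa using hk)]
    exact zero_le
  · have hk' := notMem_boxOne.1 hk
    rw [Set.indicator_of_mem (by simpa using hk), if_pos hk', firstWeight,
      ofReal_one_div_rpow_rpow (abs_nonneg _) ht.le]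
    refine ENNReal.ofReal_le_ofReal ?_
    have h1 : 0 < 1 + |(k : ℝ)| - κ := by linarith
    have h2 := abs_le_abs_sub_add hx k
    refine one_div_le_one_div_of_le (by positivity) (Real.rpow_le_rpow h1.le ?_ hs0.le)
    linarith

lemma secondWeight_tail_le {N : ℕ} {t κ : ℝ} {y : EuclideanSpace ℝ (Fin d)} (hd : 1 ≤ d)
    (ht : 0 < t) (hs : (d : ℝ) < s₂ * t) (hκ : 0 ≤ κ) (hN : κ ≤ N) (hy : ∀ i, |y i| ≤ κ) :
    (∑' k, (boxPi d N : Set (Fin d → ℤ))ᶜ.indicator (secondWeight s₂ y) k ^ t) ^ (1 / t) ≤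
      ENNReal.ofReal ((2 ^ d * d * (1 + κ) ^ ((d : ℝ) - 1) /
        ((1 + N - κ) ^ (s₂ * t - d) * (s₂ * t - d))) ^ (1 / t)) := by
  have ht' : 0 ≤ 1 / t := by positivity
  have hs0 : 0 < s₂ * t := lt_of_le_of_lt (Nat.cast_nonneg d) hs
  have hM : 0 < 1 + N - κ := by linarith
  rw [← ENNReal.ofReal_rpow_of_nonneg
    (div_nonneg (by positivity) (mul_nonneg (by positivity) (by linarith))) ht']
  refine ENNReal.rpow_le_rpow (le_trans (ENNReal.tsum_le_tsum fun k => ?_)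
    (tsum_tail_le hd hs hκ hN)) ht'
  rw [indicator_rpow ht]
  by_cases hk : k ∈ boxPi d N
  · rw [Set.indicator_of_notMem (by simpa using hk)]
    exact zero_le
  · have hk' := notMem_boxPi.1 hk
    rw [Set.indicator_of_mem (by simpa using hk), if_pos hk', secondWeight,
      ofReal_one_div_rpow_rpow (norm_nonneg _) ht.le]
    refine ENNReal.ofReal_le_ofReal ?_
    have h1 : 0 < 1 + ‖k‖ - κ := by linarith
    have h2 := norm_le_norm_sub_add hy hκ k
    refine one_div_le_one_div_of_le (by positivity) (Real.rpow_le_rpow h1.le ?_ hs0.le)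
    linarith

lemma GeneratorAssumption.s₁_pos (hΦ : GeneratorAssumption p q φ α₁ α₂ ctilde s₁ s₂)
    (hp : 1 < p) (hq : 1 < q) : 0 < s₁ := by
  have h := hΦ.first_exponent hp hq
  obtain ⟨h0, -, -⟩ := conj_exponent_facts hp
  by_contra! hcon
  nlinarith

lemma GeneratorAssumption.s₂_pos (hΦ : GeneratorAssumption p q φ α₁ α₂ ctilde s₁ s₂)
    (hp : 1 < p) (hq : 1 < q) : 0 < s₂ := by
  have h := hΦ.second_exponent hp hq
  obtain ⟨h0, -, -⟩ := conj_exponent_facts hq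
  have : (0 : ℝ) ≤ d := Nat.cast_nonneg d
  by_contra! hcon
  nlinarith

lemma GeneratorAssumption.surplus_pos (hΦ : GeneratorAssumption p q φ α₁ α₂ ctilde s₁ s₂) :
    0 < surplus d p q s₁ s₂ := by
  have h : (d : ℝ) + 1 - 1 / p - d / q < min s₁ s₂ := lt_min hΦ.s₁_gt hΦ.s₂_gt
  rw [surplus]
  linarith

/-- The bracket in the truncation thresholds. -/
noncomputable def tailBracket (d : ℕ) (p' q' s₁ s₂ κ₁ κ₂ : ℝ) : ℝ :=
  (d : ℝ) ^ (1 / q') * (1 + κ₂) ^ (((d : ℝ) - 1) / q' + 1 / p') / (s₂ * q' - d) ^ (1 / q') +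
    (1 + κ₁) ^ ((d : ℝ) / q') / (s₁ * p' - 1) ^ (1 / p') +
    (d : ℝ) ^ (1 / q') * (1 + κ₂) ^ (((d : ℝ) - 1) / q') /
      ((s₁ * p' - 1) ^ (1 / p') * (s₂ * q' - d) ^ (1 / q'))

/-- The part of the shift series outside the box of size `N` is small on a cuboid. -/
lemma tsum_tail_shiftTerm_le (hΦ : GeneratorAssumption p q φ α₁ α₂ ctilde s₁ s₂) (hd : 1 ≤ d)
    (hp : 1 < p) (hq : 1 < q) (c : Fin r → ℤ → (Fin d → ℤ) → ℂ) {κ₁ κ₂ : ℝ} (hκ₁ : 0 ≤ κ₁)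
    (hκ₂ : 0 ≤ κ₂) {N : ℕ} (hN : max κ₁ κ₂ < N) {z : Domain d} (hz : z ∈ cuboid d κ₁ κ₂) :
    ∑' k, ((boxOne N : Set ℤ) ×ˢ (boxPi d N : Set (Fin d → ℤ)))ᶜ.indicator
        (fun k => ‖shiftTerm φ c z k‖ₑ) k ≤
      ENNReal.ofReal (ctilde * (2 ^ (1 / (p / (p - 1)) + d / (q / (q - 1))) *
        tailBracket d (p / (p - 1)) (q / (q - 1)) s₁ s₂ κ₁ κ₂ *
        (N - max κ₁ κ₂) ^ (-surplus d p q s₁ s₂))) * vecSeqMixedNorm p q c := by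
  have hN₁ : κ₁ ≤ N := ((le_max_left _ _).trans_lt hN).le
  have hN₂ : κ₂ ≤ N := ((le_max_right _ _).trans_lt hN).le
  have h₁ := hΦ.first_exponent hp hq
  have h₂ := hΦ.second_exponent hp hq
  have hs₁ := hΦ.s₁_pos hp hq
  have hs₂ := hΦ.s₂_pos hp hq
  obtain ⟨hp', ep, -⟩ := conj_exponent_facts hp
  obtain ⟨hq', eq, -⟩ := conj_exponent_facts hq
  have eqd : (d : ℝ) / (q / (q - 1)) = d - d / q := by
    rw [div_eq_mul_one_div, eq]
    ring
  have hsur₁ : surplus d p q s₁ s₂ ≤ s₁ - 1 / (p / (p - 1)) - d / (q / (q - 1)) := by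
    rw [surplus, ep, eqd]
    linarith [min_le_left s₁ s₂]
  have hsur₂ : surplus d p q s₁ s₂ ≤ s₂ - 1 / (p / (p - 1)) - d / (q / (q - 1)) := by
    rw [surplus, ep, eqd]
    linarith [min_le_right s₁ s₂]
  have key := tail_contributions_le (d := d) hp' hq' (sub_pos.2 h₁) (sub_pos.2 h₂)
    hΦ.surplus_pos hsur₁ hsur₂ hκ₁ hκ₂ hN
  have a1 := firstWeight_box_le (N := N) hp' hs₁.le z.1
  have a2 := firstWeight_tail_le hp' h₁ hκ₁ hN₁ hz.1
  have b1 := secondWeight_box_le (N := N) hq' hs₂.le z.2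
  have b2 := secondWeight_tail_le hd hq' h₂ hκ₂ hN₂ hz.2
  set X := (2 / ((1 + N - κ₁) ^ (s₁ * (p / (p - 1)) - 1) * (s₁ * (p / (p - 1)) - 1))) ^
    (1 / (p / (p - 1))) with hX
  set Y := (2 ^ d * d * (1 + κ₂) ^ ((d : ℝ) - 1) / ((1 + N - κ₂) ^ (s₂ * (q / (q - 1)) - d) *
    (s₂ * (q / (q - 1)) - d))) ^ (1 / (q / (q - 1))) with hY
  have hX0 : 0 ≤ X := Real.rpow_nonneg (div_nonneg (by norm_num)
    (mul_nonneg (Real.rpow_nonneg (by linarith) _) (by linarith))) _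
  have hY0 : 0 ≤ Y := Real.rpow_nonneg (div_nonneg (by positivity)
    (mul_nonneg (Real.rpow_nonneg (by linarith) _) (by linarith))) _
  set S : Set ℤ := (boxOne N : Set ℤ) with hS
  set S' : Set (Fin d → ℤ) := (boxPi d N : Set (Fin d → ℤ)) with hS'
  set f := fun k => ‖shiftTerm φ c z k‖ₑ with hf
  -- The complement of a product is a union of three products, each with at least one tail factor.
  -- They give the three summands of the bracket.
  have hsplit : ∀ k, (S ×ˢ S')ᶜ.indicator f k ≤ (S ×ˢ S'ᶜ).indicator f k +
      (Sᶜ ×ˢ S').indicator f k + (Sᶜ ×ˢ S'ᶜ).indicator f k := by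
    intro k
    by_cases h1 : k.1 ∈ S <;> by_cases h2 : k.2 ∈ S' <;>
      simp [Set.indicator, h1, h2]
  have e1 := tsum_restrict_shiftTerm_le hΦ hp hq c z S S'ᶜ
  have e2 := tsum_restrict_shiftTerm_le hΦ hp hq c z Sᶜ S'
  have e3 := tsum_restrict_shiftTerm_le hΦ hp hq c z Sᶜ S'ᶜ
  set V := vecSeqMixedNorm p q c with hV
  have hN0 : (0 : ℝ) ≤ 2 * N + 1 := by positivity
  calc ∑' k, (S ×ˢ S')ᶜ.indicator f k
      ≤ ∑' k, (S ×ˢ S'ᶜ).indicator f k + ∑' k, (Sᶜ ×ˢ S').indicator f k +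
          ∑' k, (Sᶜ ×ˢ S'ᶜ).indicator f k := by
        rw [← ENNReal.tsum_add, ← ENNReal.tsum_add]
        exact ENNReal.tsum_le_tsum hsplit
    _ ≤ ENNReal.ofReal ctilde * V * (ENNReal.ofReal ((2 * N + 1) ^ (1 / (p / (p - 1)))) *
            ENNReal.ofReal Y) +
          ENNReal.ofReal ctilde * V * (ENNReal.ofReal X *
            ENNReal.ofReal ((2 * N + 1) ^ ((d : ℝ) / (q / (q - 1))))) +
          ENNReal.ofReal ctilde * V * (ENNReal.ofReal X * ENNReal.ofReal Y) := by
        refine add_le_add (add_le_add (e1.trans ?_) (e2.trans ?_)) (e3.trans ?_)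
        · exact mul_le_mul_right (mul_le_mul' a1 b2) _
        · exact mul_le_mul_right (mul_le_mul' a2 b1) _
        · exact mul_le_mul_right (mul_le_mul' a2 b2) _
    _ = ENNReal.ofReal (ctilde * ((2 * N + 1) ^ (1 / (p / (p - 1))) * Y +
          X * (2 * N + 1) ^ ((d : ℝ) / (q / (q - 1))) + X * Y)) * V := by
        rw [ENNReal.ofReal_mul hΦ.ctilde_pos.le, ENNReal.ofReal_add (by positivity) (by positivity),
          ENNReal.ofReal_add (by positivity) (by positivity), ENNReal.ofReal_mul (by positivity),
          ENNReal.ofReal_mul hX0, ENNReal.ofReal_mul hX0]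
        ring
    _ ≤ _ := by
        refine mul_le_mul_left (ENNReal.ofReal_le_ofReal ?_) _
        exact mul_le_mul_of_nonneg_left key hΦ.ctilde_pos.le

/-- Beyond the threshold `approxN₂`, the truncation constant is at most `α₁ ε₂`. -/
lemma truncation_const_le_of_approxN₂_le (hΦ : GeneratorAssumption p q φ α₁ α₂ ctilde s₁ s₂)
    (hd : 1 ≤ d) (hp : 1 < p) (hq : 1 < q) {κ₁ κ₂ ε₂ : ℝ} (hκ₁ : 0 ≤ κ₁) (hκ₂ : 0 ≤ κ₂)
    (hε₂ : 0 < ε₂) {N : ℕ} (hN : approxN₂ d p q α₁ ctilde s₁ s₂ κ₁ κ₂ ε₂ ≤ N) :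
    max κ₁ κ₂ < N ∧
      ctilde * (2 ^ (1 / (p / (p - 1)) + d / (q / (q - 1))) *
        tailBracket d (p / (p - 1)) (q / (q - 1)) s₁ s₂ κ₁ κ₂ *
        (N - max κ₁ κ₂) ^ (-surplus d p q s₁ s₂)) ≤ α₁ * ε₂ := by
  have h₁ := sub_pos.2 (hΦ.first_exponent hp hq)
  have h₂ := sub_pos.2 (hΦ.second_exponent hp hq)
  have hs := hΦ.surplus_pos
  have hα := hΦ.α₁_pos
  have hct := hΦ.ctilde_pos
  have hd0 : (0 : ℝ) < d := by exact_mod_cast hd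
  have hbr : 0 < tailBracket d (p / (p - 1)) (q / (q - 1)) s₁ s₂ κ₁ κ₂ := by
    rw [tailBracket]
    positivity
  set s := surplus d p q s₁ s₂ with hsdef
  -- The threshold is `max κ₁ κ₂ + Q^{1/s}`, so exceeding it means `Q ≤ (N - max κ₁ κ₂)^s`.
  set Q : ℝ := ctilde * 2 ^ (1 / (p / (p - 1)) + d / (q / (q - 1))) *
    tailBracket d (p / (p - 1)) (q / (q - 1)) s₁ s₂ κ₁ κ₂ / (α₁ * ε₂) with hQ
  have hQpos : 0 < Q := by positivity
  have happ : approxN₂ d p q α₁ ctilde s₁ s₂ κ₁ κ₂ ε₂ = max κ₁ κ₂ + Q ^ (1 / s) := by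
    rw [approxN₂, hQ, tailBracket]
    congr 2
    field_simp
  rw [happ] at hN
  have hQs : 0 < Q ^ (1 / s) := by positivity
  have hM : 0 < (N : ℝ) - max κ₁ κ₂ := by linarith
  refine ⟨by linarith, ?_⟩
  have hQM : Q ≤ ((N : ℝ) - max κ₁ κ₂) ^ s := by
    calc Q = (Q ^ (1 / s)) ^ s := by
          rw [← Real.rpow_mul hQpos.le, one_div_mul_cancel hs.ne', Real.rpow_one]
      _ ≤ _ := Real.rpow_le_rpow hQs.le (by linarith) hs.le
  calc ctilde * (2 ^ (1 / (p / (p - 1)) + d / (q / (q - 1))) *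
        tailBracket d (p / (p - 1)) (q / (q - 1)) s₁ s₂ κ₁ κ₂ *
        (N - max κ₁ κ₂) ^ (-s))
      = (α₁ * ε₂) * (Q / (N - max κ₁ κ₂) ^ s) := by
        rw [Real.rpow_neg hM.le, hQ]
        field_simp
    _ ≤ (α₁ * ε₂) * 1 := by
        gcongr
        rw [div_le_one (by positivity)]
        exact hQM
    _ = _ := mul_one _

/-- The threshold for the mixed norm is the uniform one for a smaller error. -/
lemma approxN₁_eq_approxN₂ (hp : 1 < p) (hq : 1 < q) {κ₁ κ₂ ε₁ : ℝ} (hκ₁ : 0 < κ₁) (hκ₂ : 0 < κ₂) :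
    approxN₁ d p q α₁ ctilde s₁ s₂ κ₁ κ₂ ε₁ = approxN₂ d p q α₁ ctilde s₁ s₂ κ₁ κ₂
      (ε₁ / ((2 * κ₁) ^ (1 / p) * (2 * κ₂) ^ ((d : ℝ) / q))) := by
  obtain ⟨-, ep, -⟩ := conj_exponent_facts hp
  obtain ⟨-, eq, -⟩ := conj_exponent_facts hq
  have eqd : (d : ℝ) / (q / (q - 1)) = d - d / q := by
    rw [div_eq_mul_one_div, eq]
    ring
  -- The exponents add up as `1/p' + 1/p + d/q' + d/q = d + 1`.
  have h2 : (2 : ℝ) ^ (d + 1) =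
      2 ^ (1 / (p / (p - 1)) + d / (q / (q - 1))) * (2 ^ (1 / p) * 2 ^ ((d : ℝ) / q)) := by
    rw [← Real.rpow_add (by norm_num), ← Real.rpow_add (by norm_num), ep, eqd,
      ← Real.rpow_natCast]
    congr 1
    push_cast
    ring
  rw [approxN₁, approxN₂]
  rw [h2, Real.mul_rpow (by norm_num) hκ₁.le, Real.mul_rpow (by norm_num) hκ₂.le]
  generalize (2 : ℝ) ^ (1 / (p / (p - 1)) + d / (q / (q - 1))) = u
  have e : ∀ x y : ℝ, x / (α₁ * (ε₁ / y)) = x * y / (α₁ * ε₁) := by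
    intro x y
    rw [mul_div_assoc', div_div_eq_mul_div]
  congr 2
  rw [div_mul_eq_div_div _ (α₁ * _), div_mul_eq_div_div _ (α₁ * _), mul_assoc (α₁ * _),
    div_mul_eq_div_div _ (α₁ * _), div_mul_eq_div_div _ (α₁ * _), div_mul_eq_div_div _ (α₁ * _),
    mul_assoc (α₁ * (ε₁ / _)), div_mul_eq_div_div _ (α₁ * (ε₁ / _)), e, e, e]
  ring

end Truncation

end RandomAverageSampling

namespace RandomAverageSampling

/-! ### Convergence, continuity and truncation error of shift series -/

section ShiftSeriesAnalysis

variable {d r : ℕ} {p q : ℝ} {φ : Fin r → Domain d → ℂ} {α₁ α₂ ctilde s₁ s₂ : ℝ}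

lemma shiftSeries_eq_tsum (c : Fin r → ℤ → (Fin d → ℤ) → ℂ) (z : Domain d) :
    shiftSeries φ c z = ∑' k, shiftTerm φ c z k := rfl

lemma enorm_shiftSeries_le (hΦ : GeneratorAssumption p q φ α₁ α₂ ctilde s₁ s₂) (hd : 1 ≤ d)
    (hp : 1 < p) (hq : 1 < q) (c : Fin r → ℤ → (Fin d → ℤ) → ℂ) (z : Domain d) :
    ‖shiftSeries φ c z‖ₑ ≤
      ENNReal.ofReal (α₁ * cStar d p q α₁ ctilde s₁ s₂) * vecSeqMixedNorm p q c :=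
  (enorm_tsum_le_tsum_enorm).trans (tsum_enorm_shiftTerm_le hΦ hd hp hq c z)

lemma summable_shiftTerm (hΦ : GeneratorAssumption p q φ α₁ α₂ ctilde s₁ s₂) (hd : 1 ≤ d)
    (hp : 1 < p) (hq : 1 < q) {c : Fin r → ℤ → (Fin d → ℤ) → ℂ}
    (hc : vecSeqMixedNorm p q c < ∞) (z : Domain d) : Summable (shiftTerm φ c z) :=
  Summable.of_enorm ((tsum_enorm_shiftTerm_le hΦ hd hp hq c z).trans_lt
    (ENNReal.mul_lt_top ENNReal.ofReal_lt_top hc)).ne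

lemma shiftSeries_sub (hΦ : GeneratorAssumption p q φ α₁ α₂ ctilde s₁ s₂) (hd : 1 ≤ d)
    (hp : 1 < p) (hq : 1 < q) {c c' : Fin r → ℤ → (Fin d → ℤ) → ℂ}
    (hc : vecSeqMixedNorm p q c < ∞) (hc' : vecSeqMixedNorm p q c' < ∞) (z : Domain d) :
    shiftSeries φ (c - c') z = shiftSeries φ c z - shiftSeries φ c' z := by
  rw [shiftSeries_eq_tsum, shiftSeries_eq_tsum, shiftSeries_eq_tsum,
    ← (summable_shiftTerm hΦ hd hp hq hc z).tsum_sub (summable_shiftTerm hΦ hd hp hq hc' z)]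
  refine tsum_congr fun k => ?_
  simp only [shiftTerm, ← Finset.sum_sub_distrib, Pi.sub_apply, sub_mul]

lemma shiftSeries_smul (a : ℂ) (c : Fin r → ℤ → (Fin d → ℤ) → ℂ) (z : Domain d) :
    shiftSeries φ (a • c) z = a * shiftSeries φ c z := by
  rw [shiftSeries_eq_tsum, shiftSeries_eq_tsum, ← tsum_mul_left]
  refine tsum_congr fun k => ?_
  simp only [shiftTerm, Finset.mul_sum, Pi.smul_apply, smul_eq_mul, mul_assoc]

/-- Up to a constant, the weights may be evaluated at the origin. -/
lemma ofReal_weight_le {x x₀ R s : ℝ} (hx : 0 ≤ x) (hx₀ : 0 ≤ x₀) (hR : 0 ≤ R) (hs : 0 ≤ s)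
    (h : x₀ ≤ x + R) :
    ENNReal.ofReal (1 / (1 + x) ^ s) ≤
      ENNReal.ofReal ((1 + R) ^ s) * ENNReal.ofReal (1 / (1 + x₀) ^ s) := by
  rw [← ENNReal.ofReal_mul (by positivity)]
  refine ENNReal.ofReal_le_ofReal ?_
  rw [mul_one_div, div_le_div_iff₀ (by positivity) (by positivity), one_mul,
    ← Real.mul_rpow (by positivity) (by positivity)]
  exact Real.rpow_le_rpow (by positivity) (by nlinarith) hs

lemma firstWeight_le {x R s : ℝ} (hs : 0 ≤ s) (hx : |x| ≤ R) (k : ℤ) :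
    firstWeight s x k ≤ ENNReal.ofReal ((1 + R) ^ s) * firstWeight s 0 k := by
  refine ofReal_weight_le (abs_nonneg _) (abs_nonneg _) ((abs_nonneg x).trans hx) hs ?_
  rw [zero_sub, abs_neg]
  linarith [abs_le_abs_sub_add hx (k : ℝ)]

lemma secondWeight_le {R s : ℝ} {y : EuclideanSpace ℝ (Fin d)} (hs : 0 ≤ s) (hy : ‖y‖ ≤ R)
    (k : Fin d → ℤ) :
    secondWeight s y k ≤ ENNReal.ofReal ((1 + R) ^ s) * secondWeight s 0 k := by
  refine ofReal_weight_le (norm_nonneg _) (norm_nonneg _) ((norm_nonneg y).trans hy) hs ?_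
  rw [zero_sub, norm_neg]
  have := norm_sub_norm_le (WithLp.toLp 2 (fun i => (k i : ℝ)) : EuclideanSpace ℝ (Fin d)) y
  rw [norm_sub_rev] at this
  linarith

lemma tsum_weighted_lt_top (hΦ : GeneratorAssumption p q φ α₁ α₂ ctilde s₁ s₂) (hd : 1 ≤ d)
    (hp : 1 < p) (hq : 1 < q) {c : Fin r → ℤ → (Fin d → ℤ) → ℂ}
    (hc : vecSeqMixedNorm p q c < ∞) :
    ∑' k : ℤ × (Fin d → ℤ), ∑ i, ‖c i k.1 k.2‖ₑ *
      (firstWeight s₁ 0 k.1 * secondWeight s₂ 0 k.2) < ∞ := by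
  rw [Summable.tsum_finsetSum fun i _ => ENNReal.summable]
  have h1 := firstWeight_sum_le hp (hΦ.first_exponent hp hq) 0
  have h2 := secondWeight_sum_le hd hq (hΦ.second_exponent hp hq) 0
  refine ENNReal.sum_lt_top.2 fun i _ => ?_
  refine (tsum_mul_le_seqMixedNorm (Real.HolderConjugate.conjExponent hp)
    (Real.HolderConjugate.conjExponent hq) (c i) _ _).trans_lt ?_
  refine ENNReal.mul_lt_top ?_ (ENNReal.mul_lt_top ?_ ?_)
  · exact (ENNReal.sum_lt_top.1 hc) i (Finset.mem_univ i)
  · exact h1.trans_lt ENNReal.ofReal_lt_top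
  · exact h2.trans_lt ENNReal.ofReal_lt_top

lemma continuous_shiftSeries (hΦ : GeneratorAssumption p q φ α₁ α₂ ctilde s₁ s₂) (hd : 1 ≤ d)
    (hp : 1 < p) (hq : 1 < q) {c : Fin r → ℤ → (Fin d → ℤ) → ℂ}
    (hc : vecSeqMixedNorm p q c < ∞) : Continuous (shiftSeries φ c) := by
  have hs₁ := hΦ.s₁_pos hp hq
  have hs₂ := hΦ.s₂_pos hp hq
  rw [continuous_iff_continuousAt]
  intro z₀
  -- Weierstrass test on the unit ball around `z₀`: there the weights are at most a constant times
  -- the weights at the origin, whose weighted coefficient sum is finite.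
  set R : ℝ := ‖z₀‖ + 1 with hR
  set K : ℝ≥0∞ := ENNReal.ofReal ctilde *
    (ENNReal.ofReal ((1 + R) ^ s₁) * ENNReal.ofReal ((1 + R) ^ s₂)) with hK
  have hKtop : K < ∞ := ENNReal.mul_lt_top ENNReal.ofReal_lt_top
    (ENNReal.mul_lt_top ENNReal.ofReal_lt_top ENNReal.ofReal_lt_top)
  set U : ℤ × (Fin d → ℤ) → ℝ≥0∞ := fun k => K * ∑ i, ‖c i k.1 k.2‖ₑ *
    (firstWeight s₁ 0 k.1 * secondWeight s₂ 0 k.2) with hU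
  have hUsum : ∑' k, U k < ∞ := by
    rw [hU, ENNReal.tsum_mul_left]
    exact ENNReal.mul_lt_top hKtop (tsum_weighted_lt_top hΦ hd hp hq hc)
  have hbound : ∀ k, ∀ z ∈ Metric.ball z₀ 1, ‖shiftTerm φ c z k‖ ≤ (U k).toReal := by
    intro k z hz
    have hzR : ‖z‖ ≤ R := by
      have h1 := norm_sub_norm_le z z₀
      have h2 : ‖z - z₀‖ < 1 := by rwa [Metric.mem_ball, dist_eq_norm] at hz
      linarith
    have hz1 : |z.1| ≤ R := (norm_fst_le z).trans hzR
    have hz2 : ‖z.2‖ ≤ R := (norm_snd_le z).trans hzR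
    rw [← toReal_enorm]
    refine ENNReal.toReal_mono (ne_of_lt (lt_of_le_of_lt (ENNReal.le_tsum k) hUsum))
      ((enorm_shiftTerm_le hΦ c z k).trans ?_)
    rw [hU, hK]
    simp only
    rw [mul_assoc]
    refine mul_le_mul_right ?_ _
    rw [Finset.mul_sum]
    refine Finset.sum_le_sum fun i _ => ?_
    refine (mul_le_mul_right (mul_le_mul' (firstWeight_le hs₁.le hz1 k.1)
      (secondWeight_le hs₂.le hz2 k.2)) _).trans_eq ?_
    ring
  have hcont : ContinuousOn (shiftSeries φ c) (Metric.ball z₀ 1) := by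
    refine continuousOn_tsum (f := fun k z => shiftTerm φ c z k) (fun k => ?_)
      (ENNReal.summable_toReal hUsum.ne) hbound
    refine Continuous.continuousOn ?_
    refine continuous_finsetSum _ fun i _ => continuous_const.mul ?_
    exact (hΦ.continuous i).comp (continuous_id.sub continuous_const)
  exact hcont.continuousAt (Metric.ball_mem_nhds z₀ one_pos)

/-- Truncation error of the shift series on a cuboid. -/
lemma enorm_shiftSeries_sub_restrict_le (hΦ : GeneratorAssumption p q φ α₁ α₂ ctilde s₁ s₂)
    (hd : 1 ≤ d) (hp : 1 < p) (hq : 1 < q) {c : Fin r → ℤ → (Fin d → ℤ) → ℂ}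
    (hc : vecSeqMixedNorm p q c < ∞) {κ₁ κ₂ ε₂ : ℝ} (hκ₁ : 0 ≤ κ₁) (hκ₂ : 0 ≤ κ₂)
    (hε₂ : 0 < ε₂) {N : ℕ} (hN : approxN₂ d p q α₁ ctilde s₁ s₂ κ₁ κ₂ ε₂ ≤ N)
    {z : Domain d} (hz : z ∈ cuboid d κ₁ κ₂) :
    ‖shiftSeries φ c z - shiftSeries φ (restrictCoeff (boxOne N) (boxPi d N) c) z‖ₑ ≤
      ENNReal.ofReal (α₁ * ε₂) * vecSeqMixedNorm p q c := by
  classical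
  obtain ⟨hmax, hconst⟩ := truncation_const_le_of_approxN₂_le hΦ hd hp hq hκ₁ hκ₂ hε₂ hN
  have hp0 : 0 < p := by linarith
  have hq0 : 0 < q := by linarith
  rw [← shiftSeries_sub hΦ hd hp hq hc
    ((vecSeqMixedNorm_restrictCoeff_le hp0 hq0 _ _ c).trans_lt hc)]
  have h := tsum_tail_shiftTerm_le hΦ hd hp hq c hκ₁ hκ₂ hmax hz
  refine (enorm_tsum_le_tsum_enorm).trans (le_trans (ENNReal.tsum_le_tsum fun k => ?_)
    (h.trans (mul_le_mul_left (ENNReal.ofReal_le_ofReal hconst) _)))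
  by_cases hk : k.1 ∈ boxOne N ∧ k.2 ∈ boxPi d N
  · simp [restrictCoeff, hk.1, hk.2]
  · rw [Set.indicator_of_mem (by simpa [Set.mem_prod] using hk), shiftTerm]
    simp [restrictCoeff, hk]

end ShiftSeriesAnalysis

end RandomAverageSampling

namespace RandomAverageSampling

/-! ### Iterated norms -/

section IteratedNorm

variable {X Y : Type*} [MeasurableSpace X] [MeasurableSpace Y] {μ : Measure X} {ν : Measure Y}
  {p q p' q' : ℝ}

/-- The iterated norm `‖x ↦ ‖f(x,·)‖_{L^q(ν)}‖_{L^p(μ)}` of a function with values in `[0,∞]`. -/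
noncomputable def iteratedNorm (p q : ℝ) (μ : Measure X) (ν : Measure Y)
    (f : X → Y → ℝ≥0∞) : ℝ≥0∞ :=
  (∫⁻ x, ((∫⁻ y, f x y ^ q ∂ν) ^ (1 / q)) ^ p ∂μ) ^ (1 / p)

lemma iteratedNorm_mono (hp : 0 < p) (hq : 0 < q) {f g : X → Y → ℝ≥0∞}
    (h : ∀ x y, f x y ≤ g x y) : iteratedNorm p q μ ν f ≤ iteratedNorm p q μ ν g := by
  unfold iteratedNorm
  gcongr
  exact h _ _

lemma measurable_inner_norm [SFinite ν] {f : X → Y → ℝ≥0∞} (hf : Measurable (Function.uncurry f)) :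
    Measurable fun x => (∫⁻ y, f x y ^ q ∂ν) ^ (1 / q) :=
  (Measurable.lintegral_prod_right' (hf.pow_const q)).pow_const _

lemma iteratedNorm_add_le [SFinite ν] (hp : 1 ≤ p) (hq : 1 ≤ q) {f g : X → Y → ℝ≥0∞}
    (hf : Measurable (Function.uncurry f)) (hg : Measurable (Function.uncurry g)) :
    iteratedNorm p q μ ν (f + g) ≤ iteratedNorm p q μ ν f + iteratedNorm p q μ ν g := by
  unfold iteratedNorm
  refine le_trans ?_ (ENNReal.lintegral_Lp_add_le (measurable_inner_norm hf).aemeasurable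
    (measurable_inner_norm hg).aemeasurable hp)
  refine ENNReal.rpow_le_rpow (lintegral_mono fun x => ENNReal.rpow_le_rpow ?_ (by positivity))
    (by positivity)
  exact ENNReal.lintegral_Lp_add_le (hf.comp measurable_prodMk_left).aemeasurable
    (hg.comp measurable_prodMk_left).aemeasurable hq

lemma lintegral_le_Lp_mul (hp : p.HolderConjugate p') {f : X → ℝ≥0∞} (hf : Measurable f) :
    ∫⁻ x, f x ∂μ ≤ (∫⁻ x, f x ^ p ∂μ) ^ (1 / p) * μ Set.univ ^ (1 / p') := by
  have := ENNReal.lintegral_mul_le_Lp_mul_Lq μ hp hf.aemeasurable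
    (aemeasurable_const (b := (1 : ℝ≥0∞)))
  simpa using this

lemma lintegral_lintegral_le_iteratedNorm [SFinite ν] (hp : p.HolderConjugate p')
    (hq : q.HolderConjugate q') {f : X → Y → ℝ≥0∞} (hf : Measurable (Function.uncurry f)) :
    ∫⁻ x, ∫⁻ y, f x y ∂ν ∂μ ≤
      μ Set.univ ^ (1 / p') * ν Set.univ ^ (1 / q') * iteratedNorm p q μ ν f := by
  calc ∫⁻ x, ∫⁻ y, f x y ∂ν ∂μ
      ≤ ∫⁻ x, (∫⁻ y, f x y ^ q ∂ν) ^ (1 / q) * ν Set.univ ^ (1 / q') ∂μ :=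
        lintegral_mono fun x => lintegral_le_Lp_mul hq (hf.comp measurable_prodMk_left)
    _ = (∫⁻ x, (∫⁻ y, f x y ^ q ∂ν) ^ (1 / q) ∂μ) * ν Set.univ ^ (1 / q') :=
        lintegral_mul_const _ (measurable_inner_norm hf)
    _ ≤ iteratedNorm p q μ ν f * μ Set.univ ^ (1 / p') * ν Set.univ ^ (1 / q') :=
        mul_le_mul_left (lintegral_le_Lp_mul hp (measurable_inner_norm hf)) _
    _ = _ := by ring

lemma iteratedNorm_const (hp : 0 < p) (hq : 0 < q) (η : ℝ≥0∞) :
    iteratedNorm p q μ ν (fun _ _ => η) =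
      η * (μ Set.univ ^ (1 / p) * ν Set.univ ^ (1 / q)) := by
  unfold iteratedNorm
  rw [lintegral_const, lintegral_const, ENNReal.mul_rpow_of_nonneg _ _ (by positivity),
    ENNReal.mul_rpow_of_nonneg _ _ (by positivity), ← ENNReal.rpow_mul, ← ENNReal.rpow_mul,
    mul_one_div_cancel hp.ne', mul_one_div_cancel hq.ne', ENNReal.rpow_one, ENNReal.rpow_one]
  ring

/-- A bounded function with a large iterated norm has a large integral. -/
lemma iteratedNorm_rpow_le [SFinite ν] (hp : 1 < p) (hq : 1 < q)
    {f : X → Y → ℝ≥0∞} (hf : Measurable (Function.uncurry f)) {M : ℝ≥0∞} (hM : ∀ x y, f x y ≤ M) :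
    iteratedNorm p q μ ν f ^ (p * q) ≤
      M ^ (p * q - 1) * (μ Set.univ ^ (q - 1) * ν Set.univ ^ (p - 1)) *
        ∫⁻ x, ∫⁻ y, f x y ∂ν ∂μ := by
  have hp0 : 0 < p := by linarith
  have hq0 : 0 < q := by linarith
  set a := μ Set.univ with ha
  set b := ν Set.univ with hb
  set h : X → ℝ≥0∞ := fun x => ∫⁻ y, f x y ∂ν with hh
  have hhm : Measurable h := Measurable.lintegral_prod_right' hf
  have split : ∀ (x : ℝ≥0∞) {s : ℝ}, 1 ≤ s → x ^ s = x * x ^ (s - 1) := by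
    intro x s hs
    conv_lhs => rw [show s = 1 + (s - 1) by ring]
    rw [ENNReal.rpow_add_of_nonneg _ _ zero_le_one (by linarith), ENNReal.rpow_one]
  have hhM : ∀ x, h x ≤ M * b := fun x =>
    (lintegral_mono (hM x)).trans_eq (by rw [lintegral_const])
  have hI : ∫⁻ x, h x ∂μ ≤ M * b * a :=
    (lintegral_mono hhM).trans_eq (by rw [lintegral_const])
  -- From `f^q ≤ M^{q-1} f` in the inner integral.
  have h1 : ∀ x, ((∫⁻ y, f x y ^ q ∂ν) ^ (1 / q)) ^ p ≤
      M ^ ((q - 1) * (p / q)) * h x ^ (p / q) := by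
    intro x
    rw [rpow_one_div_rpow, ENNReal.rpow_mul, ← ENNReal.mul_rpow_of_nonneg _ _ (by positivity)]
    refine ENNReal.rpow_le_rpow ?_ (by positivity)
    have hfx : Measurable (f x) := hf.comp measurable_prodMk_left
    simp only [hh]
    rw [← lintegral_const_mul _ hfx]
    refine lintegral_mono fun y => ?_
    rw [split _ hq.le, mul_comm]
    gcongr
    exact hM x y
  have h2 : iteratedNorm p q μ ν f ^ (p * q) ≤
      M ^ ((q - 1) * p) * (∫⁻ x, h x ^ (p / q) ∂μ) ^ q := by
    have : iteratedNorm p q μ ν f ^ (p * q) =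
        (∫⁻ x, ((∫⁻ y, f x y ^ q ∂ν) ^ (1 / q)) ^ p ∂μ) ^ q := by
      rw [iteratedNorm, ← ENNReal.rpow_mul]
      congr 1
      field_simp
    rw [this, show (q - 1) * p = (q - 1) * (p / q) * q by field_simp, ENNReal.rpow_mul M,
      ← ENNReal.mul_rpow_of_nonneg _ _ hq0.le]
    refine ENNReal.rpow_le_rpow ?_ hq0.le
    rw [← lintegral_const_mul _ (hhm.pow_const _)]
    exact lintegral_mono h1
  have h3 : (∫⁻ x, h x ^ (p / q) ∂μ) ^ q ≤
      M ^ (p - 1) * (a ^ (q - 1) * b ^ (p - 1)) * ∫⁻ x, h x ∂μ := by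
    -- For `q ≤ p` the power `p/q` is at least `1` and the bound `h ≤ M b` is interpolated again.
    -- For `p < q` the power is less than `1` and Hölder's inequality in `x` replaces this. Surplus
    -- powers of `∫ h` are estimated by `M b a`, and both cases end with the same constant.
    rcases le_or_gt q p with hqp | hpq
    · have h4 : ∫⁻ x, h x ^ (p / q) ∂μ ≤ (M * b) ^ (p / q - 1) * ∫⁻ x, h x ∂μ := by
        rw [← lintegral_const_mul _ hhm]
        refine lintegral_mono fun x => ?_
        have : 1 ≤ p / q := by rwa [one_le_div hq0]
        rw [split _ this, mul_comm]
        gcongr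
        exact hhM x
      calc (∫⁻ x, h x ^ (p / q) ∂μ) ^ q
          ≤ ((M * b) ^ (p / q - 1) * ∫⁻ x, h x ∂μ) ^ q := by gcongr
        _ = (M * b) ^ (p - q) * (∫⁻ x, h x ∂μ) ^ q := by
            rw [ENNReal.mul_rpow_of_nonneg _ _ hq0.le, ← ENNReal.rpow_mul]
            congr 2
            field_simp
        _ ≤ (M * b) ^ (p - q) * ((∫⁻ x, h x ∂μ) * (M * b * a) ^ (q - 1)) := by
            rw [split _ hq.le]
            gcongr
        _ = ((M * b) ^ (p - q) * (M * b) ^ (q - 1)) * a ^ (q - 1) * ∫⁻ x, h x ∂μ := by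
            rw [ENNReal.mul_rpow_of_nonneg _ a (by linarith)]
            ring
        _ = _ := by
            rw [← ENNReal.rpow_add_of_nonneg _ _ (by linarith) (by linarith),
              show p - q + (q - 1) = p - 1 by ring, ENNReal.mul_rpow_of_nonneg _ _ (by linarith)]
            ring
    · have hqp : 1 < q / p := by rwa [one_lt_div hp0]
      have h4 := lintegral_le_Lp_mul (μ := μ) (Real.HolderConjugate.conjExponent hqp)
        (hhm.pow_const (p / q))
      have h5 : ∀ x, (h x ^ (p / q)) ^ (q / p) = h x := by
        intro x
        rw [← ENNReal.rpow_mul, show p / q * (q / p) = 1 by field_simp, ENNReal.rpow_one]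
      have h6 : 1 / Real.conjExponent (q / p) = 1 - p / q := by
        rw [Real.conjExponent]
        field_simp
      simp only [h5, h6, one_div_div] at h4
      calc (∫⁻ x, h x ^ (p / q) ∂μ) ^ q
          ≤ ((∫⁻ x, h x ∂μ) ^ (p / q) * a ^ (1 - p / q)) ^ q := by gcongr
        _ = (∫⁻ x, h x ∂μ) ^ p * a ^ (q - p) := by
            rw [ENNReal.mul_rpow_of_nonneg _ _ hq0.le, ← ENNReal.rpow_mul, ← ENNReal.rpow_mul]
            congr 2 <;> field_simp
        _ ≤ ((∫⁻ x, h x ∂μ) * (M * b * a) ^ (p - 1)) * a ^ (q - p) := by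
            rw [split _ hp.le]
            gcongr
        _ = (M * b) ^ (p - 1) * (a ^ (p - 1) * a ^ (q - p)) * ∫⁻ x, h x ∂μ := by
            rw [ENNReal.mul_rpow_of_nonneg _ a (by linarith)]
            ring
        _ = _ := by
            rw [← ENNReal.rpow_add_of_nonneg _ _ (by linarith) (by linarith),
              show p - 1 + (q - p) = q - 1 by ring, ENNReal.mul_rpow_of_nonneg _ _ (by linarith)]
            ring
  refine h2.trans ((mul_le_mul_right h3 _).trans_eq ?_)
  rw [← mul_assoc, ← mul_assoc, ← ENNReal.rpow_add_of_nonneg _ _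
    (mul_nonneg (by linarith) hp0.le) (by linarith),
    show (q - 1) * p + (p - 1) = p * q - 1 by ring]

end IteratedNorm

/-! ### Mixed norms of finite arrays -/

section FiniteArrays

variable {p q : ℝ}

lemma seqMixedNorm_eq_iteratedNorm {ι κ : Type*} [MeasurableSpace ι] [MeasurableSpace κ]
    [MeasurableSingletonClass ι] [MeasurableSingletonClass κ] (p q : ℝ) (a : ι → κ → ℂ) :
    seqMixedNorm p q a =
      iteratedNorm p q Measure.count Measure.count fun i k => ‖a i k‖ₑ := by
  simp only [seqMixedNorm, iteratedNorm, lintegral_count, rpow_one_div_rpow]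

lemma tsum_rpow_le_rpow_tsum {ι : Type*} (hq : 1 ≤ q) (a : ι → ℝ≥0∞) :
    ∑' i, a i ^ q ≤ (∑' i, a i) ^ q := by
  have split : ∀ x : ℝ≥0∞, x ^ q = x * x ^ (q - 1) := by
    intro x
    conv_lhs => rw [show q = 1 + (q - 1) by ring]
    rw [ENNReal.rpow_add_of_nonneg _ _ zero_le_one (by linarith), ENNReal.rpow_one]
  rw [split, ← ENNReal.tsum_mul_right]
  refine ENNReal.tsum_le_tsum fun i => ?_
  rw [split]
  gcongr
  exact ENNReal.le_tsum i

/-- `l^1` embeds contractively in every `l^p`, applied to both indices. Its use on the main term is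
the reason for the factor `nm`, rather than `n^{1/p} m^{1/q}`, in `B`. -/
lemma seqMixedNorm_le_tsum {ι κ : Type*} (hp : 1 ≤ p) (hq : 1 ≤ q) (a : ι → κ → ℂ) :
    seqMixedNorm p q a ≤ ∑' i, ∑' k, ‖a i k‖ₑ := by
  unfold seqMixedNorm
  have hp0 : 0 < p := by linarith
  calc (∑' i, (∑' k, ‖a i k‖ₑ ^ q) ^ (p / q)) ^ (1 / p)
      ≤ (∑' i, (∑' k, ‖a i k‖ₑ) ^ p) ^ (1 / p) := by
        gcongr with i
        rw [← rpow_one_div_rpow]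
        gcongr
        refine (ENNReal.rpow_le_rpow (tsum_rpow_le_rpow_tsum hq _) (by positivity)).trans_eq ?_
        rw [← ENNReal.rpow_mul, mul_one_div_cancel (by linarith), ENNReal.rpow_one]
    _ ≤ ((∑' i, ∑' k, ‖a i k‖ₑ) ^ p) ^ (1 / p) := by
        gcongr
        exact tsum_rpow_le_rpow_tsum hp _
    _ = _ := by rw [← ENNReal.rpow_mul, mul_one_div_cancel hp0.ne', ENNReal.rpow_one]

lemma seqMixedNorm_add_le {n m : ℕ} (hp : 1 ≤ p) (hq : 1 ≤ q) (a b : Fin n → Fin m → ℂ) :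
    seqMixedNorm p q (a + b) ≤ seqMixedNorm p q a + seqMixedNorm p q b := by
  simp only [seqMixedNorm_eq_iteratedNorm]
  refine (iteratedNorm_mono (by linarith) (by linarith)
    (g := (fun i k => ‖a i k‖ₑ) + fun i k => ‖b i k‖ₑ) fun i k => enorm_add_le _ _).trans
    (iteratedNorm_add_le hp hq ?_ ?_) <;> exact measurable_of_countable _

lemma seqMixedNorm_le_of_le {n m : ℕ} (hp : 0 < p) (hq : 0 < q) {a : Fin n → Fin m → ℂ}
    {η : ℝ≥0∞} (h : ∀ i k, ‖a i k‖ₑ ≤ η) :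
    seqMixedNorm p q a ≤ η * ((n : ℝ≥0∞) ^ (1 / p) * (m : ℝ≥0∞) ^ (1 / q)) := by
  rw [seqMixedNorm_eq_iteratedNorm]
  refine (iteratedNorm_mono hp hq h).trans_eq ?_
  rw [iteratedNorm_const hp hq]
  simp

lemma tsum_le_seqMixedNorm {n m : ℕ} (hp : 1 < p) (hq : 1 < q) (a : Fin n → Fin m → ℂ) :
    ∑ i, ∑ k, ‖a i k‖ₑ ≤
      (n : ℝ≥0∞) ^ (1 - 1 / p) * (m : ℝ≥0∞) ^ (1 - 1 / q) * seqMixedNorm p q a := by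
  rw [seqMixedNorm_eq_iteratedNorm]
  have h := lintegral_lintegral_le_iteratedNorm (μ := (Measure.count : Measure (Fin n)))
    (ν := (Measure.count : Measure (Fin m))) (Real.HolderConjugate.conjExponent hp)
    (Real.HolderConjugate.conjExponent hq) (f := fun i k => ‖a i k‖ₑ) (measurable_of_countable _)
  simpa [lintegral_count, Real.conjExponent, -one_div, (conj_exponent_facts hp).2.1,
    (conj_exponent_facts hq).2.1] using h

end FiniteArrays

end RandomAverageSampling

namespace RandomAverageSampling

/-! ### Mixed norms on the cuboid -/

section Cuboid

variable {d : ℕ} {p q K₁ K₂ : ℝ}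

/-- The cube `[-K, K]^d`. -/
def cube (d : ℕ) (K : ℝ) : Set (EuclideanSpace ℝ (Fin d)) := {y | ∀ i, |y i| ≤ K}

lemma cuboid_eq_prod (d : ℕ) (K₁ K₂ : ℝ) :
    cuboid d K₁ K₂ = Set.Icc (-K₁) K₁ ×ˢ cube d K₂ := by
  ext z
  simp [cuboid, cube, abs_le]

lemma measurableSet_cube (d : ℕ) (K : ℝ) : MeasurableSet (cube d K) := by
  have : cube d K = ⋂ i, {y : EuclideanSpace ℝ (Fin d) | |y i| ≤ K} := by
    ext y; simp [cube]
  rw [this]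
  exact MeasurableSet.iInter fun i => measurableSet_le (by fun_prop) measurable_const

lemma measurableSet_cuboid (d : ℕ) (K₁ K₂ : ℝ) : MeasurableSet (cuboid d K₁ K₂) := by
  rw [cuboid_eq_prod]
  exact measurableSet_Icc.prod (measurableSet_cube d K₂)

lemma volume_cube (d : ℕ) (K : ℝ) : volume (cube d K) = ENNReal.ofReal (2 * K) ^ d := by
  have h : cube d K = (WithLp.ofLp : EuclideanSpace ℝ (Fin d) → (Fin d → ℝ)) ⁻¹'
      Set.Icc (fun _ => -K) (fun _ => K) := by
    ext y
    simp [cube, abs_le, Pi.le_def, forall_and]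
  rw [h, (PiLp.volume_preserving_ofLp (Fin d)).measure_preimage
    measurableSet_Icc.nullMeasurableSet, Real.volume_Icc_pi]
  simp [two_mul]

lemma volume_interval (K : ℝ) : volume (Set.Icc (-K) K) = ENNReal.ofReal (2 * K) := by
  rw [Real.volume_Icc]
  ring_nf

/-- The reason why the truncation thresholds are evaluated at `2K₁` and `2K₂`. -/
lemma add_mem_cuboid {z t : Domain d} (hz : z ∈ cuboid d K₁ K₂) (ht : z - t ∈ cuboid d K₁ K₂) :
    t ∈ cuboid d (2 * K₁) (2 * K₂) := by
  have key : ∀ {a b K : ℝ}, |a| ≤ K → |a - b| ≤ K → |b| ≤ 2 * K := by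
    intro a b K h1 h2
    have h3 := abs_sub a (a - b)
    rw [sub_sub_cancel] at h3
    linarith
  exact ⟨key hz.1 ht.1, fun i => key (hz.2 i) (ht.2 i)⟩

lemma mixedNorm_eq_iteratedNorm (p q : ℝ) (f : Domain d → ℂ) :
    mixedNorm p q f = iteratedNorm p q volume volume fun x y => ‖f (x, y)‖ₑ := by
  simp only [mixedNorm, iteratedNorm, rpow_one_div_rpow]

lemma mixedNormOn_cuboid (hp : 0 < p) (hq : 0 < q) (K₁ K₂ : ℝ) (f : Domain d → ℂ) :
    mixedNormOn p q (cuboid d K₁ K₂) f =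
      iteratedNorm p q (volume.restrict (Set.Icc (-K₁) K₁)) (volume.restrict (cube d K₂))
        fun x y => ‖f (x, y)‖ₑ := by
  rw [mixedNormOn, mixedNorm_eq_iteratedNorm, iteratedNorm, iteratedNorm,
    ← lintegral_indicator measurableSet_Icc]
  congr 1
  refine lintegral_congr fun x => ?_
  by_cases hx : x ∈ Set.Icc (-K₁) K₁
  · rw [Set.indicator_of_mem hx, ← lintegral_indicator (measurableSet_cube d K₂)]
    congr 2
    refine lintegral_congr fun y => ?_
    by_cases hy : y ∈ cube d K₂
    · rw [Set.indicator_of_mem hy, Set.indicator_of_mem]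
      rw [cuboid_eq_prod]; exact ⟨hx, hy⟩
    · rw [Set.indicator_of_notMem hy, Set.indicator_of_notMem]
      · simp [hq]
      · rw [cuboid_eq_prod]; exact fun h => hy h.2
  · rw [Set.indicator_of_notMem hx]
    have : ∀ y, (cuboid d K₁ K₂).indicator f (x, y) = 0 := fun y => by
      rw [Set.indicator_of_notMem]
      rw [cuboid_eq_prod]; exact fun h => hx h.1
    simp [this, hp, hq]

lemma mixedNorm_congr_ae {f g : Domain d → ℂ} (h : f =ᵐ[volume] g) :
    mixedNorm p q f = mixedNorm p q g := by
  rw [Measure.volume_eq_prod] at h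
  unfold mixedNorm
  congr 1
  refine lintegral_congr_ae ?_
  filter_upwards [Measure.ae_ae_of_ae_prod h] with x hx
  congr 1
  refine lintegral_congr_ae ?_
  filter_upwards [hx] with y hy
  rw [hy]

lemma mixedNorm_translate (f : Domain d → ℂ) (t : Domain d) :
    mixedNorm p q (fun z => f (z - t)) = mixedNorm p q f := by
  unfold mixedNorm
  congr 1
  rw [← lintegral_sub_right_eq_self
    (fun x => (∫⁻ y, ‖f (x, y)‖ₑ ^ q) ^ (p / q)) t.1]
  refine lintegral_congr fun x => ?_
  rw [← lintegral_sub_right_eq_self (fun y => ‖f (x - t.1, y)‖ₑ ^ q) t.2]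
  rfl

lemma mixedNormOn_le (hp : 0 < p) (hq : 0 < q) (C : Set (Domain d)) (f : Domain d → ℂ) :
    mixedNormOn p q C f ≤ mixedNorm p q f := by
  unfold mixedNormOn mixedNorm
  gcongr
  exact enorm_indicator_le_enorm_self _ _

lemma setLIntegral_cuboid {g : Domain d → ℝ≥0∞} (hg : Measurable g) :
    ∫⁻ z in cuboid d K₁ K₂, g z =
      ∫⁻ x in Set.Icc (-K₁) K₁, ∫⁻ y in cube d K₂, g (x, y) := by
  rw [cuboid_eq_prod, Measure.volume_eq_prod, ← Measure.prod_restrict,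
    lintegral_prod _ hg.aemeasurable]

/-- The constant `(2K₁)^{1/p'} (2K₂)^{d/q'}` of the embedding of `L^{p,q}` into `L^1` on the
cuboid. -/
noncomputable def embeddingConst (d : ℕ) (p q K₁ K₂ : ℝ) : ℝ :=
  (2 * K₁) ^ (1 - 1 / p) * (2 * K₂) ^ ((d : ℝ) * (1 - 1 / q))

lemma ofReal_two_mul_pow_rpow (hK₂ : 0 < K₂) (t : ℝ) :
    (ENNReal.ofReal (2 * K₂) ^ d) ^ t = ENNReal.ofReal ((2 * K₂) ^ ((d : ℝ) * t)) := by
  rw [← ENNReal.rpow_natCast, ← ENNReal.rpow_mul, ENNReal.ofReal_rpow_of_pos (by positivity)]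

lemma setLIntegral_cuboid_le (hp : 1 < p) (hq : 1 < q) (hK₁ : 0 < K₁) (hK₂ : 0 < K₂)
    {f : Domain d → ℂ} (hf : Measurable f) :
    ∫⁻ z in cuboid d K₁ K₂, ‖f z‖ₑ ≤
      ENNReal.ofReal (embeddingConst d p q K₁ K₂) * mixedNorm p q f := by
  have hp' := (conj_exponent_facts hp).2.1
  have hq' := (conj_exponent_facts hq).2.1
  have h1p : 0 ≤ 1 - 1 / p := by rw [← hp']; exact one_div_nonneg.2 (conj_exponent_facts hp).1.le
  have h1q : 0 ≤ 1 - 1 / q := by rw [← hq']; exact one_div_nonneg.2 (conj_exponent_facts hq).1.le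
  rw [setLIntegral_cuboid hf.enorm]
  refine (lintegral_lintegral_le_iteratedNorm (Real.HolderConjugate.conjExponent hp)
    (Real.HolderConjugate.conjExponent hq) (f := fun x y => ‖f (x, y)‖ₑ) hf.enorm).trans ?_
  rw [← mixedNormOn_cuboid (by linarith) (by linarith)]
  refine mul_le_mul' (le_of_eq ?_) (mixedNormOn_le (by linarith) (by linarith) _ _)
  rw [Measure.restrict_apply_univ, Measure.restrict_apply_univ, volume_interval, volume_cube,
    Real.conjExponent, Real.conjExponent, hp', hq', ofReal_two_mul_pow_rpow hK₂,
    ENNReal.ofReal_rpow_of_pos (by positivity), embeddingConst,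
    ENNReal.ofReal_mul (by positivity)]

lemma mixedNormOn_le_of_le (hp : 0 < p) (hq : 0 < q) (hK₁ : 0 < K₁) (hK₂ : 0 < K₂)
    {f : Domain d → ℂ} {η : ℝ≥0∞} (h : ∀ z ∈ cuboid d K₁ K₂, ‖f z‖ₑ ≤ η) :
    mixedNormOn p q (cuboid d K₁ K₂) f ≤
      η * ENNReal.ofReal ((2 * K₁) ^ (1 / p) * (2 * K₂) ^ ((d : ℝ) / q)) := by
  have h1 : mixedNormOn p q (cuboid d K₁ K₂) f =
      mixedNormOn p q (cuboid d K₁ K₂) ((cuboid d K₁ K₂).indicator f) := by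
    rw [mixedNormOn, mixedNormOn, Set.indicator_indicator, Set.inter_self]
  rw [h1, mixedNormOn_cuboid hp hq]
  refine (iteratedNorm_mono hp hq (g := fun _ _ => η) fun x y => ?_).trans_eq ?_
  · by_cases hz : ((x, y) : Domain d) ∈ cuboid d K₁ K₂
    · rw [Set.indicator_of_mem hz]; exact h _ hz
    · rw [Set.indicator_of_notMem hz]; simp
  · rw [iteratedNorm_const hp hq, Measure.restrict_apply_univ, Measure.restrict_apply_univ,
      volume_interval, volume_cube, ofReal_two_mul_pow_rpow hK₂,
      ENNReal.ofReal_rpow_of_pos (by positivity), ← ENNReal.ofReal_mul (by positivity),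
      mul_one_div]

lemma mixedNormOn_add_le (hp : 1 ≤ p) (hq : 1 ≤ q) {f g : Domain d → ℂ} (hf : Measurable f)
    (hg : Measurable g) :
    mixedNormOn p q (cuboid d K₁ K₂) (f + g) ≤
      mixedNormOn p q (cuboid d K₁ K₂) f + mixedNormOn p q (cuboid d K₁ K₂) g := by
  simp only [mixedNormOn_cuboid (p := p) (q := q) (by linarith) (by linarith)]
  exact (iteratedNorm_mono (by linarith) (by linarith)
    (g := (fun x y => ‖f (x, y)‖ₑ) + fun x y => ‖g (x, y)‖ₑ) fun x y => enorm_add_le _ _).trans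
    (iteratedNorm_add_le hp hq hf.enorm hg.enorm)

lemma mixedNormOn_rpow_le (hp : 1 < p) (hq : 1 < q) (hK₁ : 0 < K₁) (hK₂ : 0 < K₂)
    {f : Domain d → ℂ} (hf : Measurable f) {M : ℝ≥0∞} (hM : ∀ z, ‖f z‖ₑ ≤ M) :
    mixedNormOn p q (cuboid d K₁ K₂) f ^ (p * q) ≤
      M ^ (p * q - 1) * ENNReal.ofReal (volFactor d p q K₁ K₂) *
        ∫⁻ z in cuboid d K₁ K₂, ‖f z‖ₑ := by
  rw [mixedNormOn_cuboid (by linarith) (by linarith), setLIntegral_cuboid hf.enorm]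
  refine (iteratedNorm_rpow_le hp hq hf.enorm fun x y => hM (x, y)).trans_eq ?_
  rw [Measure.restrict_apply_univ, Measure.restrict_apply_univ, volume_interval, volume_cube,
    ofReal_two_mul_pow_rpow hK₂, ENNReal.ofReal_rpow_of_pos (by positivity),
    ← ENNReal.ofReal_mul (by positivity), volFactor]

end Cuboid

/-! ### Averages against `ψ` -/

section Average

instance (d : ℕ) : (volume : Measure (Domain d)).IsAddHaarMeasure :=
  inferInstanceAs ((volume : Measure ℝ).prod
    (volume : Measure (EuclideanSpace ℝ (Fin d)))).IsAddHaarMeasure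

variable {d : ℕ} {p q K₁ K₂ : ℝ} {F F' ψ : Domain d → ℂ}

lemma average_apply (f ψ : Domain d → ℂ) (z : Domain d) :
    average f ψ z = ∫ t, f t * ψ (z - t) := rfl

lemma average_congr_ae {f g : Domain d → ℂ} (h : f =ᵐ[volume] g) (z : Domain d) :
    average f ψ z = average g ψ z := by
  rw [average_apply, average_apply]
  refine integral_congr_ae ?_
  filter_upwards [h] with t ht
  rw [ht]

lemma AveragingAssumption.mixedNormOn_eq (hψ : AveragingAssumption (cuboid d K₁ K₂) ψ) :
    mixedNormOn 1 1 (cuboid d K₁ K₂) ψ = ∫⁻ z, ‖ψ z‖ₑ := by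
  have h : (cuboid d K₁ K₂).indicator ψ =ᵐ[volume] ψ := by
    filter_upwards [hψ.support] with z hz
    by_cases hz' : z ∈ cuboid d K₁ K₂
    · rw [Set.indicator_of_mem hz']
    · rw [Set.indicator_of_notMem hz', hz hz']
  have hm := hψ.integrable.aestronglyMeasurable.enorm
  rw [mixedNormOn, mixedNorm_congr_ae h, mixedNorm]
  rw [Measure.volume_eq_prod] at hm ⊢
  rw [lintegral_prod _ hm]
  simp

lemma AveragingAssumption.mixedNormOn_lt_top (hψ : AveragingAssumption (cuboid d K₁ K₂) ψ) :
    mixedNormOn 1 1 (cuboid d K₁ K₂) ψ < ∞ := by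
  rw [hψ.mixedNormOn_eq]
  exact hψ.integrable.2

/-- Only the points `t` with `z - t` in the support contribute, so a bound for `F` near `z`
suffices; this localizes the truncation error. -/
lemma AveragingAssumption.enorm_average_le_of_mem {C : Set (Domain d)}
    (hψ : AveragingAssumption C ψ) {z : Domain d} {η : ℝ≥0∞}
    (hF : ∀ t, z - t ∈ C → ‖F t‖ₑ ≤ η) :
    ‖average F ψ z‖ₑ ≤ η * ∫⁻ t, ‖ψ t‖ₑ := by
  rw [average_apply]
  refine (enorm_integral_le_lintegral_enorm _).trans ?_
  have hm : AEMeasurable (fun t => ‖ψ (z - t)‖ₑ) :=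
    (hψ.integrable.comp_sub_left z).aestronglyMeasurable.enorm
  rw [← lintegral_sub_left_eq_self (fun t => ‖ψ t‖ₑ) z, ← lintegral_const_mul'' _ hm]
  refine lintegral_mono_ae ?_
  have h := (Measure.measurePreserving_sub_left (volume : Measure (Domain d))
    z).quasiMeasurePreserving.ae hψ.support
  filter_upwards [h] with t ht
  rw [enorm_mul]
  by_cases hz : z - t ∈ C
  · gcongr
    exact hF t hz
  · simp [ht hz]

lemma average_sub_of_bounded (hψ : Integrable ψ) (hF : Continuous F) (hF' : Continuous F')
    {M M' : ℝ} (hM : ∀ t, ‖F t‖ ≤ M) (hM' : ∀ t, ‖F' t‖ ≤ M') (z : Domain d) :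
    average (fun t => F t - F' t) ψ z = average F ψ z - average F' ψ z := by
  simp only [average_apply, sub_mul]
  exact integral_sub
    ((hψ.comp_sub_left z).bdd_mul hF.aestronglyMeasurable (Filter.Eventually.of_forall hM))
    ((hψ.comp_sub_left z).bdd_mul hF'.aestronglyMeasurable (Filter.Eventually.of_forall hM'))

lemma continuous_average (hψ : Integrable ψ) (hF : Continuous F) {M : ℝ}
    (hM : ∀ t, ‖F t‖ ≤ M) : Continuous (average F ψ) :=
  BddAbove.continuous_convolution_left_of_integrable _
    ⟨M, by rintro _ ⟨t, rfl⟩; exact hM t⟩ hF hψ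

lemma average_const_mul (a : ℂ) (F ψ : Domain d → ℂ) (z : Domain d) :
    average (fun t => a * F t) ψ z = a * average F ψ z := by
  simp only [average_apply, mul_assoc]
  exact integral_const_mul _ _

/-- Averaging is bounded from `L^{p,q}` to `L^1` of the cuboid. -/
lemma setLIntegral_average_le (hp : 1 < p) (hq : 1 < q) (hK₁ : 0 < K₁) (hK₂ : 0 < K₂)
    (hψ : Integrable ψ) (hF : Continuous F) :
    ∫⁻ z in cuboid d K₁ K₂, ‖average F ψ z‖ₑ ≤
      ENNReal.ofReal (embeddingConst d p q K₁ K₂) * mixedNorm p q F * ∫⁻ t, ‖ψ t‖ₑ := by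
  have hm : AEMeasurable (Function.uncurry fun z t => ‖F (z - t)‖ₑ * ‖ψ t‖ₑ)
      ((volume.restrict (cuboid d K₁ K₂)).prod volume) := by
    refine AEMeasurable.mul ?_ hψ.aestronglyMeasurable.enorm.comp_snd
    exact (hF.comp (continuous_fst.sub continuous_snd)).measurable.enorm.aemeasurable
  calc ∫⁻ z in cuboid d K₁ K₂, ‖average F ψ z‖ₑ
      ≤ ∫⁻ z in cuboid d K₁ K₂, ∫⁻ t, ‖F (z - t)‖ₑ * ‖ψ t‖ₑ := by
        refine lintegral_mono fun z => ?_
        rw [average_apply]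
        refine (enorm_integral_le_lintegral_enorm _).trans_eq ?_
        rw [← lintegral_sub_left_eq_self (fun t => ‖F (z - t)‖ₑ * ‖ψ t‖ₑ) z]
        simp only [enorm_mul, sub_sub_cancel]
    _ = ∫⁻ t, ∫⁻ z in cuboid d K₁ K₂, ‖F (z - t)‖ₑ * ‖ψ t‖ₑ := lintegral_lintegral_swap hm
    _ ≤ ∫⁻ t, ENNReal.ofReal (embeddingConst d p q K₁ K₂) * mixedNorm p q F * ‖ψ t‖ₑ := by
        refine lintegral_mono fun t => ?_
        have hFt : Measurable fun z => F (z - t) :=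
          (hF.comp (continuous_id.sub continuous_const)).measurable
        rw [lintegral_mul_const _ hFt.enorm, ← mixedNorm_translate F t]
        gcongr
        exact setLIntegral_cuboid_le hp hq hK₁ hK₂ hFt
    _ = _ := lintegral_const_mul'' _ hψ.aestronglyMeasurable.enorm

end Average

end RandomAverageSampling

namespace RandomAverageSampling

/-! ### The finite-dimensional coefficient space -/

section CoefficientSpace

variable {d r N : ℕ} {s t : ℝ≥0∞}

lemma enorm_piLp_eq {ι : Type*} [Fintype ι] {β : ι → Type*} [∀ i, NormedAddCommGroup (β i)]
    {p : ℝ} (hp : 0 < p) [Fact (1 ≤ ENNReal.ofReal p)] (f : PiLp (ENNReal.ofReal p) β) :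
    ‖f‖ₑ = (∑ i, ‖f i‖ₑ ^ p) ^ (1 / p) := by
  have hp' : 0 < (ENNReal.ofReal p).toReal := by rwa [ENNReal.toReal_ofReal hp.le]
  rw [← ofReal_norm, PiLp.norm_eq_sum hp', ENNReal.toReal_ofReal hp.le,
    ← ENNReal.ofReal_rpow_of_nonneg (Finset.sum_nonneg fun i _ => by positivity) (by positivity),
    ENNReal.ofReal_sum_of_nonneg fun i _ => by positivity]
  congr 1
  refine Finset.sum_congr rfl fun i _ => ?_
  rw [← ENNReal.ofReal_rpow_of_nonneg (norm_nonneg _) hp.le, ofReal_norm]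

lemma finrank_piLp_const {ι V : Type*} [Fintype ι] [NormedAddCommGroup V] [NormedSpace ℝ V]
    [FiniteDimensional ℝ V] (t : ℝ≥0∞) :
    Module.finrank ℝ (PiLp t fun _ : ι => V) = Fintype.card ι * Module.finrank ℝ V := by
  rw [(WithLp.linearEquiv t ℝ (ι → V)).finrank_eq, Module.finrank_pi_fintype]
  simp

/-- The `r`-tuples of coefficient arrays supported on the box of size `N`, normed as a subspace
of `(l^{p,q})^r`. -/
abbrev CoeffSpace (d r N : ℕ) (s t : ℝ≥0∞) : Type :=
  PiLp 1 fun _ : Fin r => PiLp s fun _ : boxOne N => PiLp t fun _ : boxPi d N => ℂ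

/-- The factor `2` comes from complex coefficients viewed over `ℝ`; it doubles the exponent in the
covering numbers. -/
lemma finrank_coeffSpace (d r N : ℕ) (s t : ℝ≥0∞) [Fact (1 ≤ s)] [Fact (1 ≤ t)] :
    Module.finrank ℝ (CoeffSpace d r N s t) = 2 * (r * (2 * N + 1) ^ (d + 1)) := by
  rw [finrank_piLp_const, finrank_piLp_const, finrank_piLp_const]
  simp only [Fintype.card_fin, Fintype.card_coe, card_boxOne, card_boxPi, Complex.finrank_real_complex]
  ring

open Classical in
/-- Extension of the coefficients by zero. -/
noncomputable def CoeffSpace.extend (e : CoeffSpace d r N s t) :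
    Fin r → ℤ → (Fin d → ℤ) → ℂ :=
  fun i j k => if h : j ∈ boxOne N ∧ k ∈ boxPi d N then e i ⟨j, h.1⟩ ⟨k, h.2⟩ else 0

lemma CoeffSpace.extend_sub [Fact (1 ≤ s)] [Fact (1 ≤ t)] (e e' : CoeffSpace d r N s t) :
    (e - e').extend = e.extend - e'.extend := by
  funext i j k
  simp only [CoeffSpace.extend, Pi.sub_apply]
  split_ifs <;> simp

lemma CoeffSpace.extend_smul [Fact (1 ≤ s)] [Fact (1 ≤ t)] (a : ℝ) (e : CoeffSpace d r N s t) :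
    (a • e).extend = (a : ℂ) • e.extend := by
  funext i j k
  simp only [CoeffSpace.extend, Pi.smul_apply]
  split_ifs <;> simp

/-- The restriction of coefficients to the box. -/
noncomputable def CoeffSpace.restrict (c : Fin r → ℤ → (Fin d → ℤ) → ℂ) :
    CoeffSpace d r N s t :=
  WithLp.toLp 1 fun i => WithLp.toLp s fun j => WithLp.toLp t fun k => c i j k

lemma CoeffSpace.extend_restrict (c : Fin r → ℤ → (Fin d → ℤ) → ℂ) :
    (CoeffSpace.restrict c : CoeffSpace d r N s t).extend =
      restrictCoeff (boxOne N) (boxPi d N) c := by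
  funext i j k
  simp only [CoeffSpace.extend, restrictCoeff, CoeffSpace.restrict]
  split_ifs <;> simp_all

lemma tsum_eq_sum_coe {ι M : Type*} [AddCommMonoid M] [TopologicalSpace M] (F : Finset ι)
    {g : ι → M} {h : F → M} (h0 : ∀ j ∉ F, g j = 0) (h1 : ∀ j : F, g j = h j) :
    ∑' j, g j = ∑ j, h j := by
  rw [tsum_eq_sum h0, ← Finset.sum_coe_sort]
  exact Finset.sum_congr rfl fun j _ => h1 j

/-- Extension by zero is an isometry, so the nets are taken in the norm to which the stability
bounds refer. -/
lemma CoeffSpace.vecSeqMixedNorm_extend {p q : ℝ} (hp : 0 < p) (hq : 0 < q)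
    [Fact (1 ≤ ENNReal.ofReal p)] [Fact (1 ≤ ENNReal.ofReal q)]
    (e : CoeffSpace d r N (ENNReal.ofReal p) (ENNReal.ofReal q)) :
    vecSeqMixedNorm p q e.extend = ‖e‖ₑ := by
  have h1 : ‖e‖ₑ = ∑ i, ‖e i‖ₑ := by
    rw [← ofReal_norm, PiLp.norm_eq_of_L1, ENNReal.ofReal_sum_of_nonneg fun i _ => norm_nonneg _]
    simp only [ofReal_norm]
  rw [h1, vecSeqMixedNorm]
  refine Finset.sum_congr rfl fun i _ => ?_
  rw [enorm_piLp_eq hp, seqMixedNorm]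
  congr 1
  refine tsum_eq_sum_coe _ (fun j hj => ?_) fun j => ?_
  · simp [CoeffSpace.extend, hj, hp, hq]
  · rw [enorm_piLp_eq hq, rpow_one_div_rpow]
    congr 1
    refine tsum_eq_sum_coe _ (fun k hk => ?_) fun k => ?_
    · simp [CoeffSpace.extend, hk, hq]
    · simp [CoeffSpace.extend]

end CoefficientSpace

end RandomAverageSampling

namespace RandomAverageSampling

/-! ### Averages of shift series and their truncation -/

section AverageOfSeries

variable {d r : ℕ} {p q : ℝ} {φ : Fin r → Domain d → ℂ} {α₁ α₂ ctilde s₁ s₂ K₁ K₂ : ℝ}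
  {ψ : Domain d → ℂ} {c c' : Fin r → ℤ → (Fin d → ℤ) → ℂ}

lemma norm_shiftSeries_le (hΦ : GeneratorAssumption p q φ α₁ α₂ ctilde s₁ s₂) (hd : 1 ≤ d)
    (hp : 1 < p) (hq : 1 < q) (hc : vecSeqMixedNorm p q c < ∞) (z : Domain d) :
    ‖shiftSeries φ c z‖ ≤
      (ENNReal.ofReal (α₁ * cStar d p q α₁ ctilde s₁ s₂) * vecSeqMixedNorm p q c).toReal := by
  rw [← toReal_enorm]
  exact ENNReal.toReal_mono (ENNReal.mul_lt_top ENNReal.ofReal_lt_top hc).ne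
    (enorm_shiftSeries_le hΦ hd hp hq c z)

lemma continuous_average_shiftSeries (hΦ : GeneratorAssumption p q φ α₁ α₂ ctilde s₁ s₂)
    (hd : 1 ≤ d) (hp : 1 < p) (hq : 1 < q) (hψ : Integrable ψ)
    (hc : vecSeqMixedNorm p q c < ∞) : Continuous (average (shiftSeries φ c) ψ) :=
  continuous_average hψ (continuous_shiftSeries hΦ hd hp hq hc)
    (norm_shiftSeries_le hΦ hd hp hq hc)

lemma average_shiftSeries_sub (hΦ : GeneratorAssumption p q φ α₁ α₂ ctilde s₁ s₂)
    (hd : 1 ≤ d) (hp : 1 < p) (hq : 1 < q) (hψ : Integrable ψ)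
    (hc : vecSeqMixedNorm p q c < ∞) (hc' : vecSeqMixedNorm p q c' < ∞) (z : Domain d) :
    average (shiftSeries φ (c - c')) ψ z =
      average (shiftSeries φ c) ψ z - average (shiftSeries φ c') ψ z := by
  rw [← average_sub_of_bounded hψ (continuous_shiftSeries hΦ hd hp hq hc)
    (continuous_shiftSeries hΦ hd hp hq hc') (norm_shiftSeries_le hΦ hd hp hq hc)
    (norm_shiftSeries_le hΦ hd hp hq hc')]
  congr 1
  funext t
  exact shiftSeries_sub hΦ hd hp hq hc hc' t

lemma average_shiftSeries_smul (a : ℂ) (c : Fin r → ℤ → (Fin d → ℤ) → ℂ) (z : Domain d) :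
    average (shiftSeries φ (a • c)) ψ z = a * average (shiftSeries φ c) ψ z := by
  rw [← average_const_mul]
  congr 1
  funext t
  exact shiftSeries_smul a c t

lemma enorm_average_shiftSeries_le (hΦ : GeneratorAssumption p q φ α₁ α₂ ctilde s₁ s₂)
    (hd : 1 ≤ d) (hp : 1 < p) (hq : 1 < q) {C : Set (Domain d)} (hψ : AveragingAssumption C ψ)
    (c : Fin r → ℤ → (Fin d → ℤ) → ℂ) (z : Domain d) :
    ‖average (shiftSeries φ c) ψ z‖ₑ ≤
      ENNReal.ofReal (α₁ * cStar d p q α₁ ctilde s₁ s₂) * vecSeqMixedNorm p q c *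
        ∫⁻ t, ‖ψ t‖ₑ :=
  hψ.enorm_average_le_of_mem fun t _ => enorm_shiftSeries_le hΦ hd hp hq c t

/-- Truncating the coefficients hardly changes the averages on the cuboid. -/
lemma enorm_average_sub_restrict_le (hΦ : GeneratorAssumption p q φ α₁ α₂ ctilde s₁ s₂)
    (hd : 1 ≤ d) (hp : 1 < p) (hq : 1 < q) (hK₁ : 0 < K₁) (hK₂ : 0 < K₂)
    (hψ : AveragingAssumption (cuboid d K₁ K₂) ψ) (hc : vecSeqMixedNorm p q c < ∞) {η : ℝ}
    (hη : 0 < η) {N : ℕ} (hN : approxN₂ d p q α₁ ctilde s₁ s₂ (2 * K₁) (2 * K₂) η ≤ N)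
    {z : Domain d} (hz : z ∈ cuboid d K₁ K₂) :
    ‖average (shiftSeries φ c) ψ z -
        average (shiftSeries φ (restrictCoeff (boxOne N) (boxPi d N) c)) ψ z‖ₑ ≤
      ENNReal.ofReal η * mixedNorm p q (shiftSeries φ c) * ∫⁻ t, ‖ψ t‖ₑ := by
  have hc' : vecSeqMixedNorm p q (restrictCoeff (boxOne N) (boxPi d N) c) < ∞ :=
    (vecSeqMixedNorm_restrictCoeff_le (by linarith) (by linarith) _ _ c).trans_lt hc
  rw [← average_sub_of_bounded hψ.integrable (continuous_shiftSeries hΦ hd hp hq hc)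
    (continuous_shiftSeries hΦ hd hp hq hc') (norm_shiftSeries_le hΦ hd hp hq hc)
    (norm_shiftSeries_le hΦ hd hp hq hc')]
  refine hψ.enorm_average_le_of_mem fun t ht => ?_
  refine (enorm_shiftSeries_sub_restrict_le hΦ hd hp hq hc (by positivity) (by positivity) hη hN
    (add_mem_cuboid hz ht)).trans ?_
  rw [mul_comm α₁, ENNReal.ofReal_mul hη.le, mul_assoc]
  gcongr
  exact hΦ.lower c hc

/-- The truncated averages retain most of the mixed norm on the cuboid. -/
lemma mixedNormOn_truncated_average_ge (hΦ : GeneratorAssumption p q φ α₁ α₂ ctilde s₁ s₂)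
    (hd : 1 ≤ d) (hp : 1 < p) (hq : 1 < q) (hK₁ : 0 < K₁) (hK₂ : 0 < K₂)
    (hψ : AveragingAssumption (cuboid d K₁ K₂) ψ) (hc : vecSeqMixedNorm p q c < ∞) {δ ε : ℝ}
    (hε : 0 < ε) (hδε : ε < 1 - δ) {N : ℕ}
    (hN : approxN₁ d p q α₁ ctilde s₁ s₂ (2 * K₁) (2 * K₂) ε ≤ N)
    (h : ENNReal.ofReal (1 - δ) * (∫⁻ t, ‖ψ t‖ₑ) * mixedNorm p q (shiftSeries φ c) ≤
      mixedNormOn p q (cuboid d K₁ K₂) (average (shiftSeries φ c) ψ)) :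
    ENNReal.ofReal (1 - δ - ε) * (∫⁻ t, ‖ψ t‖ₑ) * mixedNorm p q (shiftSeries φ c) ≤
      mixedNormOn p q (cuboid d K₁ K₂)
        (average (shiftSeries φ (restrictCoeff (boxOne N) (boxPi d N) c)) ψ) := by
  have hp0 : 0 < p := by linarith
  have hq0 : 0 < q := by linarith
  have hc' : vecSeqMixedNorm p q (restrictCoeff (boxOne N) (boxPi d N) c) < ∞ :=
    (vecSeqMixedNorm_restrictCoeff_le hp0 hq0 _ _ c).trans_lt hc
  set g := average (shiftSeries φ c) ψ with hg
  set g' := average (shiftSeries φ (restrictCoeff (boxOne N) (boxPi d N) c)) ψ with hg'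
  have hgm : Measurable g :=
    (continuous_average_shiftSeries hΦ hd hp hq hψ.integrable hc).measurable
  have hgm' : Measurable g' :=
    (continuous_average_shiftSeries hΦ hd hp hq hψ.integrable hc').measurable
  -- `N₁` is `N₂` at accuracy `ε / V`. The uniform error is integrated over the cuboid, whose factor
  -- has `2K₁` and `2K₂` in place of `4K₁` and `4K₂` and is thus at most `V`.
  set V : ℝ := (2 * (2 * K₁)) ^ (1 / p) * (2 * (2 * K₂)) ^ ((d : ℝ) / q) with hV
  have hV0 : 0 < V := by positivity
  rw [approxN₁_eq_approxN₂ hp hq (by positivity) (by positivity)] at hN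
  have h1 : mixedNormOn p q (cuboid d K₁ K₂) (g - g') ≤
      ENNReal.ofReal ε * (∫⁻ t, ‖ψ t‖ₑ) * mixedNorm p q (shiftSeries φ c) := by
    refine (mixedNormOn_le_of_le hp0 hq0 hK₁ hK₂ fun z hz =>
      enorm_average_sub_restrict_le hΦ hd hp hq hK₁ hK₂ hψ hc (div_pos hε hV0) hN hz).trans ?_
    have h2 : ENNReal.ofReal (ε / V) *
        ENNReal.ofReal ((2 * K₁) ^ (1 / p) * (2 * K₂) ^ ((d : ℝ) / q)) ≤ ENNReal.ofReal ε := by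
      rw [← ENNReal.ofReal_mul (by positivity)]
      refine ENNReal.ofReal_le_ofReal ?_
      rw [div_mul_eq_mul_div, div_le_iff₀ hV0]
      refine mul_le_mul_of_nonneg_left ?_ hε.le
      refine mul_le_mul (Real.rpow_le_rpow (by positivity) (by linarith) (by positivity))
        (Real.rpow_le_rpow (by positivity) (by linarith) (by positivity)) (by positivity)
        (by positivity)
    calc _ = (ENNReal.ofReal (ε / V) *
          ENNReal.ofReal ((2 * K₁) ^ (1 / p) * (2 * K₂) ^ ((d : ℝ) / q))) *
            ((∫⁻ t, ‖ψ t‖ₑ) * mixedNorm p q (shiftSeries φ c)) := by ring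
      _ ≤ _ := (mul_le_mul_left h2 _).trans_eq (by ring)
  have h3 : mixedNormOn p q (cuboid d K₁ K₂) g ≤
      mixedNormOn p q (cuboid d K₁ K₂) g' + mixedNormOn p q (cuboid d K₁ K₂) (g - g') := by
    have := mixedNormOn_add_le (K₁ := K₁) (K₂ := K₂) hp.le hq.le hgm' (hgm.sub hgm')
    rwa [add_sub_cancel] at this
  -- Finiteness permits cancelling the error term in `[0,∞]`.
  have hfin : ENNReal.ofReal ε * (∫⁻ t, ‖ψ t‖ₑ) * mixedNorm p q (shiftSeries φ c) ≠ ∞ := by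
    refine (ENNReal.mul_lt_top (ENNReal.mul_lt_top ENNReal.ofReal_lt_top hψ.integrable.2) ?_).ne
    exact (hΦ.upper c hc).trans_lt (ENNReal.mul_lt_top ENNReal.ofReal_lt_top hc)
  refine (ENNReal.add_le_add_iff_right hfin).1 ?_
  refine le_trans (le_of_eq ?_) (h.trans (h3.trans (add_le_add le_rfl h1)))
  rw [← add_mul, ← add_mul, ← ENNReal.ofReal_add (by linarith) hε.le]
  congr 3
  ring

end AverageOfSeries

/-! ### Integrals against the sampling density -/

section DensityLaw

variable {d : ℕ} {K₁ K₂ C₁ C₂ : ℝ} {ρ : Domain d → ℝ}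

lemma DensityAssumption.isProbabilityMeasure {C : Set (Domain d)}
    (hρ : DensityAssumption C ρ C₁ C₂) : IsProbabilityMeasure (densityLaw C ρ) := by
  constructor
  rw [densityLaw, withDensity_apply _ MeasurableSet.univ, Measure.restrict_univ, hρ.total]

lemma DensityAssumption.lintegral_densityLaw {C : Set (Domain d)}
    (hρ : DensityAssumption C ρ C₁ C₂) {g : Domain d → ℝ≥0∞} (hg : Measurable g) :
    ∫⁻ z, g z ∂densityLaw C ρ = ∫⁻ z in C, ENNReal.ofReal (ρ z) * g z := by
  rw [densityLaw, lintegral_withDensity_eq_lintegral_mul₀ hρ.aemeasurable.ennreal_ofReal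
    hg.aemeasurable]
  rfl

lemma DensityAssumption.le_lintegral {C : Set (Domain d)} (hC : MeasurableSet C)
    (hρ : DensityAssumption C ρ C₁ C₂) {g : Domain d → ℝ≥0∞} (hg : Measurable g) :
    ENNReal.ofReal C₁ * ∫⁻ z in C, g z ≤ ∫⁻ z, g z ∂densityLaw C ρ := by
  rw [hρ.lintegral_densityLaw hg, ← lintegral_const_mul _ hg]
  refine setLIntegral_mono' hC fun z hz => ?_
  gcongr
  exact hρ.lower z hz

lemma DensityAssumption.lintegral_le {C : Set (Domain d)} (hC : MeasurableSet C)
    (hρ : DensityAssumption C ρ C₁ C₂) {g : Domain d → ℝ≥0∞} (hg : Measurable g) :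
    ∫⁻ z, g z ∂densityLaw C ρ ≤ ENNReal.ofReal C₂ * ∫⁻ z in C, g z := by
  rw [hρ.lintegral_densityLaw hg, ← lintegral_const_mul _ hg]
  refine setLIntegral_mono' hC fun z hz => ?_
  gcongr
  exact hρ.upper z hz

lemma densityLaw_compl {C : Set (Domain d)} (hC : MeasurableSet C) (ρ : Domain d → ℝ) :
    densityLaw C ρ Cᶜ = 0 := by
  refine withDensity_absolutelyContinuous _ _ ?_
  rw [Measure.restrict_apply hC.compl, Set.compl_inter_self, measure_empty]

end DensityLaw

end RandomAverageSampling

namespace RandomAverageSampling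

/-! ### Expectation of the truncated averages -/

section Expectation

variable {d r : ℕ} {p q : ℝ} {φ : Fin r → Domain d → ℂ} {α₁ α₂ ctilde s₁ s₂ K₁ K₂ : ℝ}
  {ψ : Domain d → ℂ} {c : Fin r → ℤ → (Fin d → ℤ) → ℂ} {ρ : Domain d → ℝ} {C₁ C₂ L : ℝ}

lemma mixedNorm_shiftSeries_lt_top (hΦ : GeneratorAssumption p q φ α₁ α₂ ctilde s₁ s₂)
    (hc : vecSeqMixedNorm p q c < ∞) : mixedNorm p q (shiftSeries φ c) < ∞ :=
  (hΦ.upper c hc).trans_lt (ENNReal.mul_lt_top ENNReal.ofReal_lt_top hc)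

/-- Truncation does not increase the coefficient norm; going from the norm of the signal to its
coefficients and back costs `α₂/α₁`. -/
lemma setLIntegral_average_restrict_le (hΦ : GeneratorAssumption p q φ α₁ α₂ ctilde s₁ s₂)
    (hd : 1 ≤ d) (hp : 1 < p) (hq : 1 < q) (hK₁ : 0 < K₁) (hK₂ : 0 < K₂)
    (hψ : Integrable ψ) (hL : ∫⁻ t, ‖ψ t‖ₑ = ENNReal.ofReal L)
    (hc : vecSeqMixedNorm p q c < ∞) (N : ℕ) :
    ∫⁻ z in cuboid d K₁ K₂,
        ‖average (shiftSeries φ (restrictCoeff (boxOne N) (boxPi d N) c)) ψ z‖ₑ ≤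
      ENNReal.ofReal (embeddingConst d p q K₁ K₂ * (α₂ / α₁) * L *
        (mixedNorm p q (shiftSeries φ c)).toReal) := by
  have hα₁ := hΦ.α₁_pos
  have hα₂ := hΦ.α₂_pos
  have hle := vecSeqMixedNorm_restrictCoeff_le (p := p) (q := q) (by linarith) (by linarith)
    (boxOne N) (boxPi d N) c
  have hc' := hle.trans_lt hc
  have h1 : mixedNorm p q (shiftSeries φ (restrictCoeff (boxOne N) (boxPi d N) c)) ≤
      ENNReal.ofReal (α₂ / α₁) * mixedNorm p q (shiftSeries φ c) := by
    refine (hΦ.upper _ hc').trans ?_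
    calc ENNReal.ofReal α₂ * vecSeqMixedNorm p q (restrictCoeff (boxOne N) (boxPi d N) c)
        ≤ ENNReal.ofReal (α₂ / α₁ * α₁) * vecSeqMixedNorm p q c := by
          rw [div_mul_cancel₀ _ hα₁.ne']
          gcongr
      _ ≤ _ := by
          rw [ENNReal.ofReal_mul (by positivity), mul_assoc]
          gcongr
          exact hΦ.lower c hc
  have hemb : 0 ≤ embeddingConst d p q K₁ K₂ := by unfold embeddingConst; positivity
  refine (setLIntegral_average_le hp hq hK₁ hK₂ hψ (continuous_shiftSeries hΦ hd hp hq hc')).trans ?_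
  rw [ENNReal.ofReal_mul' ENNReal.toReal_nonneg, mul_right_comm _ _ L,
    ENNReal.ofReal_mul' (by positivity), ENNReal.ofReal_mul hemb,
    ENNReal.ofReal_toReal (mixedNorm_shiftSeries_lt_top hΦ hc).ne, hL]
  calc _ ≤ ENNReal.ofReal (embeddingConst d p q K₁ K₂) *
        (ENNReal.ofReal (α₂ / α₁) * mixedNorm p q (shiftSeries φ c)) * ENNReal.ofReal L := by
        gcongr
    _ = _ := by ring

/-- The expected modulus of the truncated averages is at most a multiple of the norm. -/
lemma expectation_average_le (hΦ : GeneratorAssumption p q φ α₁ α₂ ctilde s₁ s₂)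
    (hd : 1 ≤ d) (hp : 1 < p) (hq : 1 < q) (hK₁ : 0 < K₁) (hK₂ : 0 < K₂)
    (hψ : Integrable ψ) (hL : ∫⁻ t, ‖ψ t‖ₑ = ENNReal.ofReal L) (hL0 : 0 < L)
    (hρ : DensityAssumption (cuboid d K₁ K₂) ρ C₁ C₂)
    (hc : vecSeqMixedNorm p q c < ∞) (N : ℕ) :
    ∫ z, ‖average (shiftSeries φ (restrictCoeff (boxOne N) (boxPi d N) c)) ψ z‖
        ∂densityLaw (cuboid d K₁ K₂) ρ ≤
      C₂ * (embeddingConst d p q K₁ K₂ * (α₂ / α₁) * L *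
        (mixedNorm p q (shiftSeries φ c)).toReal) := by
  have hα₁ := hΦ.α₁_pos
  have hα₂ := hΦ.α₂_pos
  have hC₂ := hρ.upper_pos
  have hc' : vecSeqMixedNorm p q (restrictCoeff (boxOne N) (boxPi d N) c) < ∞ :=
    (vecSeqMixedNorm_restrictCoeff_le (by linarith) (by linarith) _ _ c).trans_lt hc
  have hg := continuous_average_shiftSeries hΦ hd hp hq hψ hc'
  have hemb : 0 ≤ embeddingConst d p q K₁ K₂ := by unfold embeddingConst; positivity
  rw [integral_norm_eq_lintegral_enorm hg.aestronglyMeasurable]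
  refine ENNReal.toReal_le_of_le_ofReal (by positivity) ?_
  refine (hρ.lintegral_le (measurableSet_cuboid d K₁ K₂) hg.measurable.enorm).trans ?_
  rw [ENNReal.ofReal_mul hC₂.le]
  gcongr
  exact setLIntegral_average_restrict_le hΦ hd hp hq hK₁ hK₂ hψ hL hc N

/-- The expected modulus of the truncated averages is at least a multiple of the norm. -/
lemma le_expectation_average (hΦ : GeneratorAssumption p q φ α₁ α₂ ctilde s₁ s₂)
    (hd : 1 ≤ d) (hp : 1 < p) (hq : 1 < q) (hK₁ : 0 < K₁) (hK₂ : 0 < K₂)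
    (hψ : AveragingAssumption (cuboid d K₁ K₂) ψ) (hL : ∫⁻ t, ‖ψ t‖ₑ = ENNReal.ofReal L)
    (hL0 : 0 < L) (hρ : DensityAssumption (cuboid d K₁ K₂) ρ C₁ C₂)
    (hc : vecSeqMixedNorm p q c < ∞) {δ ε : ℝ}
    (hε : 0 < ε) (hδε : ε < 1 - δ) {N : ℕ}
    (hN : approxN₁ d p q α₁ ctilde s₁ s₂ (2 * K₁) (2 * K₂) ε ≤ N)
    (h : ENNReal.ofReal (1 - δ) * (∫⁻ t, ‖ψ t‖ₑ) * mixedNorm p q (shiftSeries φ c) ≤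
      mixedNormOn p q (cuboid d K₁ K₂) (average (shiftSeries φ c) ψ)) :
    C₁ * (cStar d p q α₁ ctilde s₁ s₂ * L) ^ (1 - p * q) * ((1 - δ - ε) * L) ^ (p * q) /
          volFactor d p q K₁ K₂ * (mixedNorm p q (shiftSeries φ c)).toReal ≤
      ∫ z, ‖average (shiftSeries φ (restrictCoeff (boxOne N) (boxPi d N) c)) ψ z‖
        ∂densityLaw (cuboid d K₁ K₂) ρ := by
  have hα₁ := hΦ.α₁_pos
  have hα₂ := hΦ.α₂_pos
  have hC₁ := hρ.lower_pos
  have hcs : 0 < cStar d p q α₁ ctilde s₁ s₂ := cStar_pos hΦ hd hp hq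
  set cs := cStar d p q α₁ ctilde s₁ s₂ with hcs_def
  have hP : 0 < volFactor d p q K₁ K₂ := by unfold volFactor; positivity
  set W := volFactor d p q K₁ K₂ with hW
  have hpq : 1 < p * q := by nlinarith
  have hle := vecSeqMixedNorm_restrictCoeff_le (p := p) (q := q) (by linarith) (by linarith)
    (boxOne N) (boxPi d N) c
  have hc' := hle.trans_lt hc
  have hg := continuous_average_shiftSeries hΦ hd hp hq hψ.integrable hc'
  have hJ := setLIntegral_average_restrict_le hΦ hd hp hq hK₁ hK₂ hψ.integrable hL hc N
  have hge := mixedNormOn_truncated_average_ge hΦ hd hp hq hK₁ hK₂ hψ hc hε hδε hN h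
  set g := average (shiftSeries φ (restrictCoeff (boxOne N) (boxPi d N) c)) ψ with hg_def
  have hμ := mixedNorm_shiftSeries_lt_top hΦ hc
  have hlow := hΦ.lower c hc
  have hμm : mixedNorm p q (shiftSeries φ c) =
      ENNReal.ofReal (mixedNorm p q (shiftSeries φ c)).toReal := (ENNReal.ofReal_toReal hμ.ne).symm
  have hm0 : 0 ≤ (mixedNorm p q (shiftSeries φ c)).toReal := ENNReal.toReal_nonneg
  set m := (mixedNorm p q (shiftSeries φ c)).toReal with hm
  rw [hμm, hL] at hge
  rw [hμm] at hlow
  set J := ∫⁻ z in cuboid d K₁ K₂, ‖g z‖ₑ with hJdef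
  have hJtop : J ≠ ∞ := (hJ.trans_lt ENNReal.ofReal_lt_top).ne
  have hE : C₁ * J.toReal ≤ ∫ z, ‖g z‖ ∂densityLaw (cuboid d K₁ K₂) ρ := by
    rw [integral_norm_eq_lintegral_enorm hg.aestronglyMeasurable]
    have h1 := hρ.le_lintegral (measurableSet_cuboid d K₁ K₂) hg.measurable.enorm
    have h2 := hρ.lintegral_le (measurableSet_cuboid d K₁ K₂) hg.measurable.enorm
    have := ENNReal.toReal_mono
      (h2.trans_lt (ENNReal.mul_lt_top ENNReal.ofReal_lt_top hJtop.lt_top)).ne h1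
    rwa [ENNReal.toReal_mul, ENNReal.toReal_ofReal hC₁.le] at this
  refine le_trans ?_ hE
  -- A power of `m` is cancelled at the end, so `m = 0` is separated.
  rcases hm0.eq_or_lt with hm0' | hmpos
  · rw [← hm0', mul_zero]
    positivity
  have hM : ∀ z, ‖g z‖ₑ ≤ ENNReal.ofReal (cs * m * L) := by
    intro z
    refine (enorm_average_shiftSeries_le hΦ hd hp hq hψ _ z).trans ?_
    rw [hL, mul_comm α₁, ENNReal.ofReal_mul hcs.le, ENNReal.ofReal_mul (by positivity),
      ENNReal.ofReal_mul hcs.le, mul_assoc (ENNReal.ofReal _)]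
    gcongr
    exact (mul_le_mul_right hle _).trans hlow
  have hω : 0 < (1 - δ - ε) * L := mul_pos (by linarith) hL0
  -- The lower bound for the truncated mixed norm is fed into the interpolation inequality with the
  -- uniform bound `c^* m L`. Dividing by powers of `m` and `c^* L` leaves a bound linear in `m`.
  have key : (((1 - δ - ε) * L) * m) ^ (p * q) ≤ (cs * m * L) ^ (p * q - 1) * W * J.toReal := by
    have h1 := (ENNReal.rpow_le_rpow hge (z := p * q) (by linarith)).trans
      (mixedNormOn_rpow_le hp hq hK₁ hK₂ hg.measurable hM)
    rw [← ENNReal.ofReal_mul (by linarith), ← ENNReal.ofReal_mul hω.le,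
      ENNReal.ofReal_rpow_of_pos (by positivity), ENNReal.ofReal_rpow_of_pos (by positivity),
      ← ENNReal.ofReal_mul (by positivity), ← hJdef, ← hW, ← ENNReal.ofReal_toReal hJtop,
      ← ENNReal.ofReal_mul (by positivity)] at h1
    exact (ENNReal.ofReal_le_ofReal_iff (by positivity)).1 h1
  rw [mul_assoc C₁, mul_div_assoc, mul_assoc C₁]
  refine mul_le_mul_of_nonneg_left ?_ hC₁.le
  have hX : (cs * L) ^ (1 - p * q) = ((cs * L) ^ (p * q - 1))⁻¹ := by
    rw [← Real.rpow_neg (by positivity)]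
    congr 1
    ring
  have hm1 : m ^ (p * q) = m ^ (p * q - 1) * m := by
    rw [← Real.rpow_add_one hmpos.ne']
    congr 1
    ring
  rw [Real.mul_rpow hω.le hm0, mul_right_comm cs, Real.mul_rpow (by positivity) hm0, hm1] at key
  have hmp : 0 < m ^ (p * q - 1) := by positivity
  have hcp : 0 < (cs * L) ^ (p * q - 1) := by positivity
  rw [hX, div_mul_eq_mul_div, div_le_iff₀ hP, inv_mul_eq_div, div_mul_eq_mul_div,
    div_le_iff₀ hcp]
  refine le_of_mul_le_mul_left ?_ hmp
  linarith [key]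

end Expectation

end RandomAverageSampling

namespace RandomAverageSampling

/-! ### The constants in normalized form -/

section Constants

variable {d r N n m : ℕ} {p q K₁ K₂ γ C₁ c L ω : ℝ}

/-- The deviation relative to `c^* L`. -/
noncomputable def relDeviation (d : ℕ) (p q K₁ K₂ γ C₁ c L ω : ℝ) : ℝ :=
  γ * C₁ * (ω / (c * L)) ^ (p * q) / volFactor d p q K₁ K₂

lemma volFactor_pos (hK₁ : 0 < K₁) (hK₂ : 0 < K₂) : 0 < volFactor d p q K₁ K₂ := by
  unfold volFactor; positivity

lemma volFactor_inv (hK₁ : 0 < K₁) (hK₂ : 0 < K₂) :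
    (2 * K₁) ^ (1 - q) * (2 * K₂) ^ ((d : ℝ) * (1 - p)) = (volFactor d p q K₁ K₂)⁻¹ := by
  rw [volFactor, mul_inv, ← Real.rpow_neg (by positivity), ← Real.rpow_neg (by positivity)]
  congr 2 <;> ring

lemma relDeviation_pos (hK₁ : 0 < K₁) (hK₂ : 0 < K₂) (hγ : 0 < γ) (hC₁ : 0 < C₁) (hc : 0 < c)
    (hL : 0 < L) (hω : 0 < ω) : 0 < relDeviation d p q K₁ K₂ γ C₁ c L ω := by
  have := volFactor_pos (d := d) (p := p) (q := q) hK₁ hK₂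
  unfold relDeviation
  positivity

lemma deviation_eq (hc : 0 < c) (hL : 0 < L) (hω : 0 < ω) :
    deviation d p q K₁ K₂ γ C₁ c L ω = relDeviation d p q K₁ K₂ γ C₁ c L ω * (c * L) := by
  have hcL : 0 < c * L := by positivity
  rw [deviation, relDeviation, Real.div_rpow hω.le hcL.le, Real.rpow_sub hcL, Real.rpow_one]
  field_simp

/-- Here `relDeviation` is `G/P`, and all powers of `P` cancel. The rate then depends on one
parameter only, as the chaining estimate requires. -/
lemma rateβ₁_eq (hK₁ : 0 < K₁) (hK₂ : 0 < K₂) (hγ : 0 < γ) (hC₁ : 0 < C₁) (hc : 0 < c)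
    (hL : 0 < L) (hω : 0 < ω) :
    rateβ₁ d p q K₁ K₂ γ C₁ c L ω =
      3 / 4 * relDeviation d p q K₁ K₂ γ C₁ c L ω ^ 2 /
        (6 + relDeviation d p q K₁ K₂ γ C₁ c L ω) := by
  have hP := volFactor_pos (d := d) (p := p) (q := q) hK₁ hK₂
  rw [rateβ₁, volFactor_inv hK₁ hK₂, relDeviation]
  set g := (ω / (c * L)) ^ (p * q) with hg
  have hg0 : 0 < g := by positivity
  have h3 : √3 ^ 2 = (3 : ℝ) := Real.sq_sqrt (by norm_num)
  have e : (√3 / 2 * γ * C₁ * g) ^ 2 = 3 / 4 * (γ * C₁ * g) ^ 2 := by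
    rw [show (√3 / 2 * γ * C₁ * g) ^ 2 = √3 ^ 2 / 4 * (γ * C₁ * g) ^ 2 by ring, h3]
  rw [e]
  field_simp

lemma rateβ₂_eq (hK₁ : 0 < K₁) (hK₂ : 0 < K₂) (hγ : 0 < γ) (hC₁ : 0 < C₁) (hc : 0 < c)
    (hL : 0 < L) (hω : 0 < ω) :
    rateβ₂ d p q K₁ K₂ γ C₁ c L ω =
      (relDeviation d p q K₁ K₂ γ C₁ c L ω * c) ^ 2 /
        (18 * √2 * (81 + 2 * (relDeviation d p q K₁ K₂ γ C₁ c L ω * c))) := by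
  have hP := volFactor_pos (d := d) (p := p) (q := q) hK₁ hK₂
  rw [rateβ₂, volFactor_inv hK₁ hK₂, relDeviation]
  set g := (ω / (c * L)) ^ (p * q) with hg
  have hg0 : 0 < g := by positivity
  field_simp

/-- Since `Λ = θ c^* L`, the factor `L` cancels, and the threshold takes the form needed in
`chaining_bound_le`. -/
lemma threshold_lt (hK₁ : 0 < K₁) (hK₂ : 0 < K₂) (hγ : 0 < γ) (hC₁ : 0 < C₁) (hc : 0 < c)
    (hL : 0 < L) (hω : 0 < ω) {T : ℝ}
    (hT : sampleThreshold d r N p q K₁ K₂ γ C₁ c L ω < T) :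
    54 * √2 * Real.log 2 * (r * (2 * N + 1) ^ (d + 1) : ℕ) *
        (2 * (relDeviation d p q K₁ K₂ γ C₁ c L ω * c) + 81) <
      T * (relDeviation d p q K₁ K₂ γ C₁ c L ω * c) ^ 2 := by
  have hθ := relDeviation_pos (d := d) (p := p) (q := q) hK₁ hK₂ hγ hC₁ hc hL hω
  rw [sampleThreshold, deviation_eq hc hL hω] at hT
  set θ := relDeviation d p q K₁ K₂ γ C₁ c L ω
  rw [← div_lt_iff₀ (by positivity)]
  refine lt_of_eq_of_lt ?_ hT
  push_cast
  field_simp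

lemma sampleThreshold_nonneg (hK₁ : 0 < K₁) (hK₂ : 0 < K₂) (hγ : 0 < γ) (hC₁ : 0 < C₁)
    (hc : 0 < c) (hL : 0 < L) (hω : 0 < ω) :
    0 ≤ sampleThreshold d r N p q K₁ K₂ γ C₁ c L ω := by
  have hθ := relDeviation_pos (d := d) (p := p) (q := q) hK₁ hK₂ hγ hC₁ hc hL hω
  have := Real.log_nonneg (show (1 : ℝ) ≤ 2 by norm_num)
  rw [sampleThreshold, deviation_eq hc hL hω]
  positivity

lemma constA₁_eq (hc : 0 < c) :
    constA₁ d r N c = 2 * (1 + 4 * c) ^ (r * (2 * N + 1) ^ (d + 1)) := by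
  have h : (r : ℝ) * (2 * (N : ℝ) + 1) ^ (d + 1) = ((r * (2 * N + 1) ^ (d + 1) : ℕ) : ℝ) := by
    push_cast; rfl
  rw [constA₁, h, mul_comm _ (Real.log _), Real.exp_mul, Real.exp_log (by positivity),
    Real.rpow_natCast, add_comm 1]

lemma constA₂_eq (c : ℝ) :
    constA₂ d r N c = 4 * ((2 * c + 1 / 4) * (c + 1 / 4)) ^ (r * (2 * N + 1) ^ (d + 1)) /
      (3 * Real.log 2 ^ 2 * (r * (2 * N + 1) ^ (d + 1) : ℕ)) := by
  rw [constA₂]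
  push_cast
  congr 1
  ring

lemma constA₂_nonneg (hc : 0 < c) : 0 ≤ constA₂ d r N c := by
  unfold constA₂; positivity

end Constants

/-! ### The event of uniformly small deviation -/

section DeviationEvent

variable {d r N : ℕ} {p q : ℝ} {φ : Fin r → Domain d → ℂ} {α₁ α₂ ctilde s₁ s₂ K₁ K₂ : ℝ}
  {ψ : Domain d → ℂ}

/-- The modulus of the averages of the shift series with coefficients in the box. -/
noncomputable def averageModulus (φ : Fin r → Domain d → ℂ) (ψ : Domain d → ℂ) {s t : ℝ≥0∞}
    (e : CoeffSpace d r N s t) (z : Domain d) : ℝ :=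
  ‖average (shiftSeries φ e.extend) ψ z‖

variable [Fact (1 ≤ ENNReal.ofReal p)] [Fact (1 ≤ ENNReal.ofReal q)]

lemma vecSeqMixedNorm_extend_lt_top (hp : 0 < p) (hq : 0 < q)
    (e : CoeffSpace d r N (ENNReal.ofReal p) (ENNReal.ofReal q)) :
    vecSeqMixedNorm p q e.extend < ∞ := by
  rw [CoeffSpace.vecSeqMixedNorm_extend hp hq]
  exact enorm_lt_top

lemma measurable_averageModulus (hΦ : GeneratorAssumption p q φ α₁ α₂ ctilde s₁ s₂)
    (hd : 1 ≤ d) (hp : 1 < p) (hq : 1 < q) (hψ : Integrable ψ)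
    (e : CoeffSpace d r N (ENNReal.ofReal p) (ENNReal.ofReal q)) :
    Measurable (averageModulus φ ψ e) :=
  (continuous_average_shiftSeries hΦ hd hp hq hψ
    (vecSeqMixedNorm_extend_lt_top (by linarith) (by linarith) e)).norm.measurable

lemma averageModulus_smul (a : ℝ) (e : CoeffSpace d r N (ENNReal.ofReal p) (ENNReal.ofReal q))
    (z : Domain d) : averageModulus φ ψ (a • e) z = |a| * averageModulus φ ψ e z := by
  rw [averageModulus, CoeffSpace.extend_smul, average_shiftSeries_smul, norm_mul,
    Complex.norm_real, Real.norm_eq_abs]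
  rfl

/-- By the reverse triangle inequality and linearity, the Lipschitz constant is the uniform bound
for averages with coefficients of norm one. Hence `b = α₁ c^* L` in the chaining, and `b θ = α₁ Λ`.
-/
lemma averageModulus_lipschitz (hΦ : GeneratorAssumption p q φ α₁ α₂ ctilde s₁ s₂)
    (hd : 1 ≤ d) (hp : 1 < p) (hq : 1 < q) {C : Set (Domain d)} (hψ : AveragingAssumption C ψ)
    {L : ℝ} (hL0 : 0 < L) (hL : ∫⁻ t, ‖ψ t‖ₑ = ENNReal.ofReal L)
    (e e' : CoeffSpace d r N (ENNReal.ofReal p) (ENNReal.ofReal q)) (z : Domain d) :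
    |averageModulus φ ψ e z - averageModulus φ ψ e' z| ≤
      α₁ * cStar d p q α₁ ctilde s₁ s₂ * L * ‖e - e'‖ := by
  have hp0 : 0 < p := by linarith
  have hq0 : 0 < q := by linarith
  have hcs := cStar_pos hΦ hd hp hq
  have hα₁ := hΦ.α₁_pos
  refine (abs_norm_sub_norm_le _ _).trans ?_
  rw [← average_shiftSeries_sub hΦ hd hp hq hψ.integrable
    (vecSeqMixedNorm_extend_lt_top hp0 hq0 e) (vecSeqMixedNorm_extend_lt_top hp0 hq0 e'),
    ← CoeffSpace.extend_sub, ← toReal_enorm]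
  refine ENNReal.toReal_le_of_le_ofReal (by positivity) ?_
  refine (enorm_average_shiftSeries_le hΦ hd hp hq hψ _ z).trans_eq ?_
  rw [CoeffSpace.vecSeqMixedNorm_extend hp0 hq0, hL, ← ofReal_norm, mul_right_comm,
    ← ENNReal.ofReal_mul (by positivity), ← ENNReal.ofReal_mul (by positivity)]

lemma centredSum_const_mul {S Ω ι : Type*} [MeasurableSpace S] [Fintype ι]
    (ν : Measure S) (X : ι → Ω → S) (h : S → ℝ) (a : ℝ) (w : Ω) :
    centredSum ν X (fun s => a * h s) w = a * centredSum ν X h w := by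
  simp only [centredSum, integral_const_mul, ← mul_sub, Finset.mul_sum]

/-- On an event of large probability, the empirical means of the moduli of all truncated averages
are close to their expectations. -/
theorem exists_uniform_deviation_event (hd : 1 ≤ d) (hr : 1 ≤ r) (hp : 1 < p) (hq : 1 < q)
    (hK₁ : 0 < K₁) (hK₂ : 0 < K₂) (hΦ : GeneratorAssumption p q φ α₁ α₂ ctilde s₁ s₂)
    {C : Set (Domain d)} (hψ : AveragingAssumption C ψ) {ν : Measure (Domain d)}
    [IsProbabilityMeasure ν] {Ω ι : Type*} [MeasurableSpace Ω] {P : Measure Ω}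
    [IsProbabilityMeasure P] [Fintype ι] [Nonempty ι] {X : ι → Ω → Domain d}
    (hX : iIndepFun X P) (hlaw : ∀ i, HasLaw (X i) ν P) {γ C₁ L ω : ℝ} (hγ : 0 < γ)
    (hC₁ : 0 < C₁) (hL0 : 0 < L) (hω : 0 < ω) (hL : ∫⁻ t, ‖ψ t‖ₑ = ENNReal.ofReal L)
    {c : ℝ} (hc : c = cStar d p q α₁ ctilde s₁ s₂)
    (hT : sampleThreshold d r N p q K₁ K₂ γ C₁ c L ω < Fintype.card ι)
    (hY : constA₁ d r N c *
      Real.exp (-(Fintype.card ι * rateβ₁ d p q K₁ K₂ γ C₁ c L ω)) ≤ 1) :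
    ∃ A : Set Ω, MeasurableSet A ∧
      P Aᶜ ≤ ENNReal.ofReal
        (constA₁ d r N c * Real.exp (-(Fintype.card ι * rateβ₁ d p q K₁ K₂ γ C₁ c L ω)) +
          constA₂ d r N c * Real.exp (-(Fintype.card ι * rateβ₂ d p q K₁ K₂ γ C₁ c L ω))) ∧
      ∀ w ∈ A, ∀ e : CoeffSpace d r N (ENNReal.ofReal p) (ENNReal.ofReal q),
        |centredSum ν X (averageModulus φ ψ e) w| ≤
          Fintype.card ι * deviation d p q K₁ K₂ γ C₁ c L ω * (α₁ * ‖e‖) := by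
  have hcpos : 0 < c := hc ▸ cStar_pos hΦ hd hp hq
  have hα₁ := hΦ.α₁_pos
  have hθ := relDeviation_pos (d := d) (p := p) (q := q) hK₁ hK₂ hγ hC₁ hcpos hL0 hω
  have hthr := threshold_lt hK₁ hK₂ hγ hC₁ hcpos hL0 hω hT
  rw [rateβ₁_eq hK₁ hK₂ hγ hC₁ hcpos hL0 hω, constA₁_eq hcpos] at hY ⊢
  rw [rateβ₂_eq hK₁ hK₂ hγ hC₁ hcpos hL0 hω, constA₂_eq, deviation_eq hcpos hL0 hω]
  set θ := relDeviation d p q K₁ K₂ γ C₁ c L ω with hθdef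
  set D := r * (2 * N + 1) ^ (d + 1) with hD
  have hD1 : 1 ≤ D := Nat.mul_pos hr (by positivity)
  have hT0 : (0 : ℝ) < Fintype.card ι := by exact_mod_cast Fintype.card_pos
  have hzero : ∀ z, averageModulus φ ψ
      (0 : CoeffSpace d r N (ENNReal.ofReal p) (ENNReal.ofReal q)) z = 0 := fun z => by
    have := averageModulus_smul (φ := φ) (ψ := ψ) 0
      (0 : CoeffSpace d r N (ENNReal.ofReal p) (ENNReal.ofReal q)) z
    rwa [smul_zero, abs_zero, zero_mul] at this
  obtain ⟨A, hA, hPA, hdev⟩ := uniform_deviation_unitBall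
    (E := CoeffSpace d r N (ENNReal.ofReal p) (ENNReal.ofReal q)) (ν := ν) (P := P) hX hlaw
    (G := averageModulus φ ψ) (measurable_averageModulus hΦ hd hp hq hψ.integrable)
    (b := α₁ * c * L) (by positivity) hcpos hθ hzero (fun e z => norm_nonneg _)
    (fun e e' z => hc ▸ averageModulus_lipschitz hΦ hd hp hq hψ hL0 hL e e' z)
  refine ⟨A, hA, ?_, fun w hw e => ?_⟩
  · refine hPA.trans ?_
    rw [finrank_coeffSpace]
    have hpos : 0 ≤ (1 + 4 * c) ^ D *
        Real.exp (-(Fintype.card ι * (3 / 4 * θ ^ 2 / (6 + θ)))) := by positivity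
    refine (chaining_bound_le hcpos hθ hT0 hD1 hthr (by linarith)).trans_eq ?_
    rw [mul_assoc 2]
  -- Homogeneity extends the bound from the unit ball to all coefficients.
  · rcases eq_or_ne e 0 with rfl | he
    · have h0 : centredSum ν X (averageModulus φ ψ
          (0 : CoeffSpace d r N (ENNReal.ofReal p) (ENNReal.ofReal q))) w = 0 := by
        simp [centredSum, hzero]
      rw [h0, abs_zero]
      positivity
    · have hne : 0 < ‖e‖ := norm_pos_iff.2 he
      have h1 : averageModulus φ ψ e = fun z => ‖e‖ * averageModulus φ ψ (‖e‖⁻¹ • e) z := by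
        funext z
        rw [averageModulus_smul, abs_of_pos (inv_pos.2 hne), mul_inv_cancel_left₀ hne.ne']
      rw [h1, centredSum_const_mul, abs_mul, abs_norm]
      have h2 := hdev w hw (‖e‖⁻¹ • e)
        (by rw [norm_smul, norm_inv, norm_norm, inv_mul_cancel₀ hne.ne'])
      refine (mul_le_mul_of_nonneg_left h2 hne.le).trans_eq ?_
      ring

end DeviationEvent

end RandomAverageSampling

namespace RandomAverageSampling

/-! ### From sums of moduli to mixed norms of samples -/

section SamplingInequality

variable {n m : ℕ} {p q : ℝ}

lemma natCast_rpow_mul_split (hn : 0 < n) (hm : 0 < m) :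
    ((n : ℝ) ^ (1 - 1 / p) * (m : ℝ) ^ (1 - 1 / q)) * ((n : ℝ) ^ (1 / p) * (m : ℝ) ^ (1 / q)) =
      (n : ℝ) * m := by
  have hn' : (0 : ℝ) < n := by exact_mod_cast hn
  have hm' : (0 : ℝ) < m := by exact_mod_cast hm
  rw [mul_mul_mul_comm, ← Real.rpow_add hn', ← Real.rpow_add hm']
  simp

lemma ofReal_natCast_rpow_mul (hn : 0 < n) (hm : 0 < m) (s t : ℝ) :
    (n : ℝ≥0∞) ^ s * (m : ℝ≥0∞) ^ t = ENNReal.ofReal ((n : ℝ) ^ s * (m : ℝ) ^ t) := by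
  have hn' : (0 : ℝ) < n := by exact_mod_cast hn
  have hm' : (0 : ℝ) < m := by exact_mod_cast hm
  rw [ENNReal.ofReal_mul (by positivity), ← ENNReal.ofReal_rpow_of_pos hn',
    ← ENNReal.ofReal_rpow_of_pos hm', ENNReal.ofReal_natCast, ENNReal.ofReal_natCast]

lemma sum_enorm_eq_ofReal (a : Fin n → Fin m → ℂ) :
    ∑ j, ∑ k, ‖a j k‖ₑ = ENNReal.ofReal (∑ j, ∑ k, ‖a j k‖) := by
  rw [ENNReal.ofReal_sum_of_nonneg fun j _ => Finset.sum_nonneg fun k _ => norm_nonneg _]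
  refine Finset.sum_congr rfl fun j _ => ?_
  rw [ENNReal.ofReal_sum_of_nonneg fun k _ => norm_nonneg _]
  simp only [ofReal_norm]

/-- Lower bound of the mixed norm of a finite array by the sum of the moduli of a nearby one. -/
lemma le_seqMixedNorm_of_sum (hp : 1 < p) (hq : 1 < q) (hn : 0 < n) (hm : 0 < m)
    {a b : Fin n → Fin m → ℂ} {η S : ℝ} (hab : ∀ j k, ‖a j k - b j k‖ ≤ η)
    (hS : n * m * S ≤ ∑ j, ∑ k, ‖b j k‖) :
    ENNReal.ofReal ((n : ℝ) ^ (1 / p) * (m : ℝ) ^ (1 / q) * (S - η)) ≤ seqMixedNorm p q a := by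
  have hn' : (0 : ℝ) < n := by exact_mod_cast hn
  have hm' : (0 : ℝ) < m := by exact_mod_cast hm
  have h1 : ∑ j, ∑ k, ‖b j k‖ ≤ ∑ j, ∑ k, ‖a j k‖ + n * m * η := by
    have : ∑ j, ∑ k, ‖b j k‖ ≤ ∑ j, ∑ k, (‖a j k‖ + η) := by
      refine Finset.sum_le_sum fun j _ => Finset.sum_le_sum fun k _ => ?_
      have h2 := norm_sub_norm_le (b j k) (a j k)
      rw [norm_sub_rev] at h2
      linarith [hab j k]
    refine this.trans_eq ?_
    simp only [Finset.sum_add_distrib, Finset.sum_const, Finset.card_univ, Fintype.card_fin,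
      nsmul_eq_mul]
    ring
  have h3 := tsum_le_seqMixedNorm hp hq a
  rw [sum_enorm_eq_ofReal, ofReal_natCast_rpow_mul hn hm] at h3
  set u : ℝ := (n : ℝ) ^ (1 - 1 / p) * (m : ℝ) ^ (1 - 1 / q) with hu
  have hu0 : 0 < u := by positivity
  have hsplit := natCast_rpow_mul_split (p := p) (q := q) hn hm
  rw [← hu] at hsplit
  have h4 : ENNReal.ofReal (u * ((n : ℝ) ^ (1 / p) * (m : ℝ) ^ (1 / q) * (S - η))) ≤
      ENNReal.ofReal u * seqMixedNorm p q a := by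
    refine le_trans (ENNReal.ofReal_le_ofReal ?_) h3
    rw [← mul_assoc, hsplit]
    linarith
  rw [ENNReal.ofReal_mul hu0.le] at h4
  exact (ENNReal.mul_le_mul_iff_right (ENNReal.ofReal_pos.2 hu0).ne' ENNReal.ofReal_ne_top).1 h4

/-- Upper bound of the mixed norm of a finite array by the sum of the moduli of a nearby one. -/
lemma seqMixedNorm_le_of_sum (hp : 1 < p) (hq : 1 < q) (hn : 0 < n) (hm : 0 < m)
    {a b : Fin n → Fin m → ℂ} {η S : ℝ} (hη : 0 ≤ η) (hab : ∀ j k, ‖a j k - b j k‖ ≤ η)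
    (hS : ∑ j, ∑ k, ‖b j k‖ ≤ n * m * S) :
    seqMixedNorm p q a ≤
      ENNReal.ofReal (n * m * S + (n : ℝ) ^ (1 / p) * (m : ℝ) ^ (1 / q) * η) := by
  have h0 : (0 : ℝ) ≤ ∑ j, ∑ k, ‖b j k‖ :=
    Finset.sum_nonneg fun j _ => Finset.sum_nonneg fun k _ => norm_nonneg _
  have h1 := seqMixedNorm_add_le hp.le hq.le b (a - b)
  rw [add_sub_cancel] at h1
  have h2 : seqMixedNorm p q b ≤ ENNReal.ofReal (n * m * S) := by
    refine (seqMixedNorm_le_tsum hp.le hq.le b).trans ?_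
    simp only [tsum_fintype]
    rw [sum_enorm_eq_ofReal]
    exact ENNReal.ofReal_le_ofReal hS
  have h3 : seqMixedNorm p q (a - b) ≤
      ENNReal.ofReal ((n : ℝ) ^ (1 / p) * (m : ℝ) ^ (1 / q) * η) := by
    refine (seqMixedNorm_le_of_le (by linarith) (by linarith) (η := ENNReal.ofReal η)
      fun j k => ?_).trans_eq ?_
    · rw [← ofReal_norm]
      exact ENNReal.ofReal_le_ofReal (hab j k)
    · rw [ofReal_natCast_rpow_mul hn hm, ← ENNReal.ofReal_mul hη, mul_comm]
  refine h1.trans ((add_le_add h2 h3).trans_eq ?_)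
  rw [← ENNReal.ofReal_add (h0.trans hS) (by positivity)]

end SamplingInequality

/-! ### Comparison with `A` and `B` -/

section ConstantsComparison

variable {d n m : ℕ} {p q K₁ K₂ δ ε γ α₁ α₂ C₁ C₂ c L : ℝ}

lemma deviation_eq_mul (hc : 0 < c) (hL : 0 < L) (hδε : ε < 1 - δ) :
    deviation d p q K₁ K₂ γ C₁ c L ((1 - δ - ε) * L) =
      γ * (C₁ * c ^ (1 - p * q) * L * (1 - δ - ε) ^ (p * q) / volFactor d p q K₁ K₂) := by
  have h1 : L ^ (1 - p * q) * L ^ (p * q) = L := by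
    rw [← Real.rpow_add hL]; simp
  rw [deviation, Real.mul_rpow hc.le hL.le, Real.mul_rpow (by linarith) hL.le]
  calc _ = γ * (C₁ * c ^ (1 - p * q) * (L ^ (1 - p * q) * L ^ (p * q)) *
        (1 - δ - ε) ^ (p * q) / volFactor d p q K₁ K₂) := by ring
    _ = _ := by rw [h1]

/-- The argument yields `(1-γ)(1-δ-ε)^{pq} - ε`. The stated constant has one more factor `1-δ-ε ≤ 1`
in the first term and is therefore weaker. -/
lemma lowerConst_le (hK₁ : 0 < K₁) (hK₂ : 0 < K₂) (hc : 0 < c) (hL : 0 < L) (hC₁ : 0 < C₁)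
    (hδ : 0 < δ) (hε : 0 < ε) (hδε : ε < 1 - δ) (hγ : γ ≤ 1) :
    lowerConst d n m p q K₁ K₂ δ ε γ C₁ c L ≤
      (n : ℝ) ^ (1 / p) * (m : ℝ) ^ (1 / q) *
        (C₁ * c ^ (1 - p * q) * L * (1 - δ - ε) ^ (p * q) / volFactor d p q K₁ K₂ -
          deviation d p q K₁ K₂ γ C₁ c L ((1 - δ - ε) * L) -
          ε * C₁ * c ^ (1 - p * q) / volFactor d p q K₁ K₂ * L) := by
  have hP := volFactor_pos (d := d) (p := p) (q := q) hK₁ hK₂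
  have hb : 0 < 1 - δ - ε := by linarith
  rw [deviation_eq_mul hc hL hδε, lowerConst, mul_assoc, mul_comm (_ / _)]
  refine mul_le_mul_of_nonneg_left ?_ (by positivity)
  rw [Real.rpow_add hb, Real.rpow_one]
  calc _ = C₁ * c ^ (1 - p * q) * L / volFactor d p q K₁ K₂ *
        ((1 - γ) * (1 - δ - ε) ^ (p * q) * (1 - δ - ε) - ε) := by ring
    _ ≤ C₁ * c ^ (1 - p * q) * L / volFactor d p q K₁ K₂ *
        ((1 - γ) * (1 - δ - ε) ^ (p * q) * 1 - ε) := by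
        have : 0 ≤ 1 - γ := by linarith
        gcongr
        linarith
    _ = _ := by ring

lemma upperConst_eq (hK₁ : 0 < K₁) (hK₂ : 0 < K₂) (hc : 0 < c) (hL : 0 < L)
    (hp : 0 < p) (hq : 0 < q) (hδε : ε < 1 - δ) :
    upperConst d n m p q K₁ K₂ δ ε γ α₁ α₂ C₁ C₂ c L =
      n * m * (C₂ * (embeddingConst d p q K₁ K₂ * (α₂ / α₁) * L) +
        α₂ / α₁ * deviation d p q K₁ K₂ γ C₁ c L ((1 - δ - ε) * L)) +
      (n : ℝ) ^ (1 / p) * (m : ℝ) ^ (1 / q) *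
        (ε * C₁ * c ^ (1 - p * q) / volFactor d p q K₁ K₂ * L) := by
  have h1 : embeddingConst d p q K₁ K₂ =
      ((2 * K₁) ^ ((1 - p) / p) * (2 * K₂) ^ ((d : ℝ) * ((1 - q) / q)))⁻¹ := by
    rw [embeddingConst, mul_inv, ← Real.rpow_neg (by positivity), ← Real.rpow_neg (by positivity)]
    congr 2 <;> field_simp <;> ring
  rw [deviation_eq_mul hc hL hδε, upperConst, h1]
  ring

end ConstantsComparison

end RandomAverageSampling

namespace RandomAverageSampling

/-! ### The sampling inequality on the event -/

section SamplingOnEvent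

variable {d r N n m : ℕ} {p q : ℝ} {φ : Fin r → Domain d → ℂ} {α₁ α₂ ctilde s₁ s₂ K₁ K₂ : ℝ}
  {ψ : Domain d → ℂ} {ρ : Domain d → ℝ} {C₁ C₂ δ ε γ c L : ℝ}

/-- If the empirical means of the truncated averages at the points `z` are close to their
expectations, then the sampling inequality holds at these points. -/
lemma sampling_inequality_of_deviation [Fact (1 ≤ ENNReal.ofReal p)]
    [Fact (1 ≤ ENNReal.ofReal q)] (hd : 1 ≤ d) (hp : 1 < p) (hq : 1 < q)
    (hK₁ : 0 < K₁) (hK₂ : 0 < K₂) (hΦ : GeneratorAssumption p q φ α₁ α₂ ctilde s₁ s₂)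
    (hψ : AveragingAssumption (cuboid d K₁ K₂) ψ)
    (hρ : DensityAssumption (cuboid d K₁ K₂) ρ C₁ C₂) (hδ : 0 < δ) (hε : 0 < ε)
    (hδε : ε < 1 - δ) (hγ₀ : 0 < γ) (hγ₁ : γ ≤ 1) (hL0 : 0 < L)
    (hL : mixedNormOn 1 1 (cuboid d K₁ K₂) ψ = ENNReal.ofReal L)
    (hc : c = cStar d p q α₁ ctilde s₁ s₂)
    (hN₁ : approxN₁ d p q α₁ ctilde s₁ s₂ (2 * K₁) (2 * K₂) ε ≤ N)
    (hN₂ : approxN₂ d p q α₁ ctilde s₁ s₂ (2 * K₁) (2 * K₂)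
      (ε * C₁ * c ^ (1 - p * q) / volFactor d p q K₁ K₂) ≤ N)
    (hn : 0 < n) (hm : 0 < m) {z : Fin n → Fin m → Domain d}
    (hz : ∀ j k, z j k ∈ cuboid d K₁ K₂)
    (hdev : ∀ e : CoeffSpace d r N (ENNReal.ofReal p) (ENNReal.ofReal q),
      |(∑ j, ∑ k, averageModulus φ ψ e (z j k)) -
          n * m * ∫ x, averageModulus φ ψ e x ∂densityLaw (cuboid d K₁ K₂) ρ| ≤
        n * m * deviation d p q K₁ K₂ γ C₁ c L ((1 - δ - ε) * L) * (α₁ * ‖e‖))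
    {f : Domain d → ℂ} (hf : f ∈ averageConcentrated p q φ ψ δ (cuboid d K₁ K₂)) :
    ENNReal.ofReal (lowerConst d n m p q K₁ K₂ δ ε γ C₁ c L) * mixedNorm p q f
        ≤ seqMixedNorm p q (fun j k => average f ψ (z j k)) ∧
      seqMixedNorm p q (fun j k => average f ψ (z j k))
        ≤ ENNReal.ofReal (upperConst d n m p q K₁ K₂ δ ε γ α₁ α₂ C₁ C₂ c L)
          * mixedNorm p q f := by
  have hp0 : 0 < p := by linarith
  have hq0 : 0 < q := by linarith
  have hn' : (0 : ℝ) < n := by exact_mod_cast hn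
  have hm' : (0 : ℝ) < m := by exact_mod_cast hm
  have hα₁ := hΦ.α₁_pos
  have hα₂ := hΦ.α₂_pos
  have hC₁ := hρ.lower_pos
  have hc0 : 0 < c := hc ▸ cStar_pos hΦ hd hp hq
  have hP := volFactor_pos (d := d) (p := p) (q := q) hK₁ hK₂
  obtain ⟨⟨⟨a, ha, hfa⟩, -⟩, hconc⟩ := hf
  have hLψ : ∫⁻ t, ‖ψ t‖ₑ = ENNReal.ofReal L := by rw [← hψ.mixedNormOn_eq, hL]
  have havg : ∀ x, average f ψ x = average (shiftSeries φ a) ψ x := average_congr_ae hfa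
  rw [mixedNorm_congr_ae hfa, show average f ψ = average (shiftSeries φ a) ψ from funext havg,
    hψ.mixedNormOn_eq] at hconc
  simp only [havg, mixedNorm_congr_ae hfa]
  set Λ := deviation d p q K₁ K₂ γ C₁ c L ((1 - δ - ε) * L) with hΛ
  set η := ε * C₁ * c ^ (1 - p * q) / volFactor d p q K₁ K₂ with hη
  have hη0 : 0 < η := by positivity
  have hΛ0 : 0 ≤ Λ := by
    have : 0 < 1 - δ - ε := by linarith
    rw [hΛ, deviation_eq_mul hc0 hL0 hδε]
    positivity
  -- The deviation bound is uniform in `e`, so it may be applied to the truncated coefficients of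
  -- any signal.
  set e : CoeffSpace d r N (ENNReal.ofReal p) (ENNReal.ofReal q) := CoeffSpace.restrict a with he
  have hext : e.extend = restrictCoeff (boxOne N) (boxPi d N) a := CoeffSpace.extend_restrict a
  have hμ := mixedNorm_shiftSeries_lt_top hΦ ha
  have hup := expectation_average_le hΦ hd hp hq hK₁ hK₂ hψ.integrable hLψ hL0 hρ ha N
  have hlow := le_expectation_average hΦ hd hp hq hK₁ hK₂ hψ hLψ hL0 hρ ha hε hδε hN₁ hconc
  have herr : ∀ j k, ‖average (shiftSeries φ a) ψ (z j k) -
      average (shiftSeries φ e.extend) ψ (z j k)‖ ≤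
        η * L * (mixedNorm p q (shiftSeries φ a)).toReal := by
    intro j k
    rw [hext, ← toReal_enorm]
    refine (ENNReal.toReal_mono ?_ (enorm_average_sub_restrict_le hΦ hd hp hq hK₁ hK₂ hψ ha hη0
      hN₂ (hz j k))).trans_eq ?_
    · rw [hLψ]
      exact ENNReal.mul_ne_top (ENNReal.mul_ne_top ENNReal.ofReal_ne_top hμ.ne)
        ENNReal.ofReal_ne_top
    · rw [hLψ, ENNReal.toReal_mul, ENNReal.toReal_mul, ENNReal.toReal_ofReal hη0.le,
        ENNReal.toReal_ofReal hL0.le]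
      ring
  have hαe : α₁ * ‖e‖ ≤ (mixedNorm p q (shiftSeries φ a)).toReal := by
    have h1 : ENNReal.ofReal (α₁ * ‖e‖) ≤ mixedNorm p q (shiftSeries φ a) := by
      rw [ENNReal.ofReal_mul hα₁.le, ofReal_norm, ← CoeffSpace.vecSeqMixedNorm_extend hp0 hq0,
        hext]
      refine le_trans ?_ (hΦ.lower a ha)
      gcongr
      exact vecSeqMixedNorm_restrictCoeff_le hp0 hq0 _ _ a
    exact (ENNReal.ofReal_le_iff_le_toReal hμ.ne).1 h1
  -- The two stability bounds force `α₂/α₁ ≥ 1` for a nonzero signal; this is the slack in the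
  -- `γ`-term of `B`.
  have hα : (mixedNorm p q (shiftSeries φ a)).toReal ≤
      α₂ / α₁ * (mixedNorm p q (shiftSeries φ a)).toReal := by
    have h1 := ENNReal.toReal_mono hμ.ne (hΦ.lower a ha)
    have h2 := ENNReal.toReal_mono (ENNReal.mul_ne_top ENNReal.ofReal_ne_top ha.ne) (hΦ.upper a ha)
    rw [ENNReal.toReal_mul, ENNReal.toReal_ofReal hα₁.le] at h1
    rw [ENNReal.toReal_mul, ENNReal.toReal_ofReal hα₂.le] at h2
    rw [div_mul_eq_mul_div, le_div_iff₀ hα₁]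
    nlinarith
  have hμm : mixedNorm p q (shiftSeries φ a) =
      ENNReal.ofReal (mixedNorm p q (shiftSeries φ a)).toReal := (ENNReal.ofReal_toReal hμ.ne).symm
  have hm0 : 0 ≤ (mixedNorm p q (shiftSeries φ a)).toReal := ENNReal.toReal_nonneg
  set M := (mixedNorm p q (shiftSeries φ a)).toReal with hM
  rw [hμm]
  have hdev' := abs_le.1 ((hdev e).trans
    (mul_le_mul_of_nonneg_left hαe (mul_nonneg (by positivity) hΛ0)))
  simp only [averageModulus, hext] at hdev'
  rw [hext] at herr
  rw [← hc] at hlow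
  set E := ∫ x, ‖average (shiftSeries φ (restrictCoeff (boxOne N) (boxPi d N) a)) ψ x‖
    ∂densityLaw (cuboid d K₁ K₂) ρ with hE
  have hlow' : C₁ * c ^ (1 - p * q) * L * (1 - δ - ε) ^ (p * q) / volFactor d p q K₁ K₂ * M ≤ E := by
    have h1 : C₁ * (c * L) ^ (1 - p * q) * ((1 - δ - ε) * L) ^ (p * q) / volFactor d p q K₁ K₂ =
        C₁ * c ^ (1 - p * q) * L * (1 - δ - ε) ^ (p * q) / volFactor d p q K₁ K₂ := by
      have h2 := deviation_eq_mul (d := d) (p := p) (q := q) (K₁ := K₁) (K₂ := K₂) (γ := 1)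
        (C₁ := C₁) hc0 hL0 hδε
      rwa [deviation, one_mul, one_mul] at h2
    rwa [h1] at hlow
  constructor
  · rw [← ENNReal.ofReal_mul' hm0]
    refine le_trans (ENNReal.ofReal_le_ofReal ?_) (le_seqMixedNorm_of_sum hp hq hn hm herr
      (S := E - Λ * M) ?_)
    · refine (mul_le_mul_of_nonneg_right (lowerConst_le hK₁ hK₂ hc0 hL0 hC₁ hδ hε hδε hγ₁)
        hm0).trans ?_
      rw [mul_assoc]
      refine mul_le_mul_of_nonneg_left ?_ (by positivity)
      rw [← hΛ, ← hη]
      linarith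
    · linarith [hdev'.1]
  · rw [← ENNReal.ofReal_mul' hm0]
    refine (seqMixedNorm_le_of_sum hp hq hn hm (by positivity) herr
      (S := E + Λ * M) (by linarith [hdev'.2])).trans (ENNReal.ofReal_le_ofReal ?_)
    rw [upperConst_eq hK₁ hK₂ hc0 hL0 hp0 hq0 hδε, ← hΛ, ← hη]
    have h1 : Λ * M ≤ α₂ / α₁ * Λ * M := by
      calc Λ * M ≤ Λ * (α₂ / α₁ * M) := mul_le_mul_of_nonneg_left hα hΛ0
        _ = _ := by ring
    have h2 : E + Λ * M ≤
        (C₂ * (embeddingConst d p q K₁ K₂ * (α₂ / α₁) * L) + α₂ / α₁ * Λ) * M := by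
      rw [add_mul]
      refine add_le_add (hup.trans_eq (by ring)) h1
    have h3 := mul_le_mul_of_nonneg_left h2 (show (0 : ℝ) ≤ n * m by positivity)
    linarith

end SamplingOnEvent

end RandomAverageSampling

/-! ### The sampling theorem -/

open RandomAverageSampling in
theorem theorem3p3
    {d r : ℕ} (hd : 1 ≤ d) (hr : 1 ≤ r)
    {p q : ℝ} (hp : 1 < p) (hq : 1 < q)
    {K₁ K₂ : ℝ} (hK₁ : 0 < K₁) (hK₂ : 0 < K₂)
    (φ : Fin r → Domain d → ℂ) (α₁ α₂ ctilde s₁ s₂ : ℝ)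
    (hΦ : GeneratorAssumption p q φ α₁ α₂ ctilde s₁ s₂)
    (ψ : Domain d → ℂ) (hψ : AveragingAssumption (cuboid d K₁ K₂) ψ)
    (hψ_pos : 0 < mixedNormOn 1 1 (cuboid d K₁ K₂) ψ)
    (ρ : Domain d → ℝ) (C₁ C₂ : ℝ) (hρ : DensityAssumption (cuboid d K₁ K₂) ρ C₁ C₂)
    {Ω : Type*} [MeasurableSpace Ω] (P : Measure Ω) [IsProbabilityMeasure P]
    (Z : ℕ → ℕ → Ω → Domain d)
    (hZ_indep : iIndepFun (fun jk : ℕ × ℕ => Z jk.1 jk.2) P)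
    (hZ_law : ∀ j k, HasLaw (Z j k) (densityLaw (cuboid d K₁ K₂) ρ) P)
    {δ ε γ : ℝ} (hδ₀ : 0 < δ) (hδ₁ : δ < 1) (hε₀ : 0 < ε) (hε₁ : ε < 1 - δ)
    (hγ₀ : 0 < γ) (hγ₁ : γ < 1 - ε / (1 - δ - ε) ^ (1 + p * q))
    (L c ω : ℝ)
    (hL : L = (mixedNormOn 1 1 (cuboid d K₁ K₂) ψ).toReal)
    (hc : c = cStar d p q α₁ ctilde s₁ s₂)
    (hω : ω = (1 - δ - ε) * L)
    (N n m : ℕ)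
    (hN : max (approxN₁ d p q α₁ ctilde s₁ s₂ (2 * K₁) (2 * K₂) ε)
        (approxN₂ d p q α₁ ctilde s₁ s₂ (2 * K₁) (2 * K₂)
          (ε * C₁ * c ^ (1 - p * q) / volFactor d p q K₁ K₂)) ≤ (N : ℝ))
    (hnm : sampleThreshold d r N p q K₁ K₂ γ C₁ c L ω < (n : ℝ) * m) :
    ∃ E : Set Ω, MeasurableSet E ∧
      1 - constA₁ d r N c * Real.exp (-(n * m * rateβ₁ d p q K₁ K₂ γ C₁ c L ω))
          - constA₂ d r N c * Real.exp (-(n * m * rateβ₂ d p q K₁ K₂ γ C₁ c L ω))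
        ≤ P.real E ∧
      ∀ w ∈ E, ∀ f ∈ averageConcentrated p q φ ψ δ (cuboid d K₁ K₂),
        ENNReal.ofReal (lowerConst d n m p q K₁ K₂ δ ε γ C₁ c L) * mixedNorm p q f
          ≤ seqMixedNorm p q (fun (j : Fin n) (k : Fin m) => average f ψ (Z j k w)) ∧
        seqMixedNorm p q (fun (j : Fin n) (k : Fin m) => average f ψ (Z j k w))
          ≤ ENNReal.ofReal (upperConst d n m p q K₁ K₂ δ ε γ α₁ α₂ C₁ C₂ c L)
            * mixedNorm p q f := by
  have : Fact (1 ≤ ENNReal.ofReal p) := ⟨by simpa using ENNReal.ofReal_le_ofReal hp.le⟩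
  have : Fact (1 ≤ ENNReal.ofReal q) := ⟨by simpa using ENNReal.ofReal_le_ofReal hq.le⟩
  have hLtop := hψ.mixedNormOn_lt_top
  have hL0 : 0 < L := hL ▸ ENNReal.toReal_pos hψ_pos.ne' hLtop.ne
  have hL' : mixedNormOn 1 1 (cuboid d K₁ K₂) ψ = ENNReal.ofReal L := by
    rw [hL, ENNReal.ofReal_toReal hLtop.ne]
  have hc0 : 0 < c := hc ▸ cStar_pos hΦ hd hp hq
  have hω0 : 0 < ω := hω ▸ mul_pos (by linarith) hL0
  have hC₁ := hρ.lower_pos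
  have hA₂ := constA₂_nonneg (d := d) (r := r) (N := N) hc0
  have hγ1 : γ ≤ 1 := by
    have h1 : 0 < (1 - δ - ε) ^ (1 + p * q) := Real.rpow_pos_of_pos (by linarith) _
    have h2 := div_pos hε₀ h1
    linarith
  have hnm0 : (0 : ℝ) < n * m := (sampleThreshold_nonneg hK₁ hK₂ hγ₀ hC₁ hc0 hL0 hω0).trans_lt hnm
  have hn : 0 < n := Nat.pos_of_ne_zero fun h => by simp [h] at hnm0
  have hm : 0 < m := Nat.pos_of_ne_zero fun h => by simp [h] at hnm0
  -- If the first exponential term exceeds `1`, the claimed probability is negative and the empty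
  -- event will do. Otherwise the bound by `1` is available for the squaring step in the chaining
  -- estimate.
  rcases lt_or_ge 1 (constA₁ d r N c *
    Real.exp (-(n * m * rateβ₁ d p q K₁ K₂ γ C₁ c L ω))) with hY | hY
  · refine ⟨∅, MeasurableSet.empty, ?_, fun w hw => absurd hw (Set.notMem_empty w)⟩
    have : 0 ≤ constA₂ d r N c * Real.exp (-(n * m * rateβ₂ d p q K₁ K₂ γ C₁ c L ω)) := by
      positivity
    rw [measureReal_empty]
    linarith
  have := hρ.isProbabilityMeasure
  have : Nonempty (Fin n × Fin m) := ⟨(⟨0, hn⟩, ⟨0, hm⟩)⟩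
  have hcard : ((Fintype.card (Fin n × Fin m) : ℕ) : ℝ) = n * m := by simp
  have hinj : Function.Injective fun x : Fin n × Fin m => ((x.1 : ℕ), (x.2 : ℕ)) := by
    intro x y h
    simp only [Prod.mk.injEq] at h
    exact Prod.ext (Fin.ext h.1) (Fin.ext h.2)
  obtain ⟨A, hA, hPA, hdev⟩ := exists_uniform_deviation_event (N := N) (C₁ := C₁) (γ := γ)
    (ω := ω) (X := fun x : Fin n × Fin m => Z x.1 x.2) hd hr hp hq hK₁ hK₂ hΦ hψ
    (hZ_indep.precomp hinj) (fun x => hZ_law x.1 x.2) hγ₀ hC₁ hL0 hω0 (hψ.mixedNormOn_eq ▸ hL') hc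
    (by rwa [hcard]) (by rwa [hcard])
  rw [hcard] at hPA hdev
  -- The samples lie in the cuboid only almost surely, while the truncation error is controlled only
  -- there; a null set is removed from the event.
  have hmem : ∀ᵐ w ∂P, ∀ x : Fin n × Fin m, Z x.1 x.2 w ∈ cuboid d K₁ K₂ := by
    refine ae_all_iff.2 fun x => ?_
    have h1 : ∀ᵐ z ∂(P.map (Z x.1 x.2)), z ∈ cuboid d K₁ K₂ := by
      rw [(hZ_law x.1 x.2).map_eq]
      exact densityLaw_compl (measurableSet_cuboid d K₁ K₂) ρ
    exact ae_of_ae_map (hZ_law x.1 x.2).aemeasurable h1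
  obtain ⟨B, hBsub, hB, hPB⟩ := exists_measurable_superset_of_null hmem
  refine ⟨A \ B, hA.diff hB, ?_, fun w hw f hf => ?_⟩
  · have h1 : P (A \ B)ᶜ ≤ P Aᶜ := by
      have h2 : (A \ B)ᶜ ⊆ Aᶜ ∪ B := by
        intro w hw
        by_cases hwA : w ∈ A
        · exact Or.inr (by_contra fun hwB => hw ⟨hwA, hwB⟩)
        · exact Or.inl hwA
      refine (measure_mono h2).trans ((measure_union_le _ _).trans ?_)
      rw [hPB, add_zero]
    have hA₁ : 0 ≤ constA₁ d r N c := by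
      rw [constA₁_eq hc0]
      positivity
    have h3 : P.real (A \ B)ᶜ ≤ _ := ENNReal.toReal_le_of_le_ofReal (by positivity) (h1.trans hPA)
    rw [probReal_compl_eq_one_sub (hA.diff hB)] at h3
    linarith
  · have hz : ∀ x : Fin n × Fin m, Z x.1 x.2 w ∈ cuboid d K₁ K₂ := by
      by_contra h
      exact hw.2 (hBsub h)
    refine sampling_inequality_of_deviation hd hp hq hK₁ hK₂ hΦ hψ hρ hδ₀ hε₀ hε₁ hγ₀ hγ1 hL0 hL'
      hc ((le_max_left _ _).trans hN) ((le_max_right _ _).trans hN) hn hm (fun j k => hz (j, k))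
      (fun e => ?_) hf
    have h := hdev w hw.1 e
    rw [hω] at h
    simpa only [centredSum, Finset.sum_sub_distrib, Fintype.sum_prod_type, Finset.sum_const,
      Finset.card_univ, nsmul_eq_mul, hcard, mul_assoc] using h
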